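/- Let $n \ge 1$ and let $\Omega \subset \mathbb{C}^n$ be a bounded domain (a non-empty, connected, bounded open set). Let $A^2(\Omega)$ be the space of holomorphic functions on $\Omega$ that are square integrable with respect to Lebesgue measure $dV$, and let $K(z,\zeta)$, $z,\zeta\in\Omega$, be the Bergman kernel of $\Omega$, that is, $K(\cdot,\zeta)\in A^2(\Omega)$ and $f(\zeta)=\int_\Omega f(z)\,\overline{K(z,\zeta)}\,dV(z)$ for all $f\in A^2(\Omega)$ and $\zeta\in\Omega$. Suppose that the Bergman metric $g_{i\bar j}(z)=\dfrac{\partial^2\log K(z,z)}{\partial z_i\,\partial\bar z_j}$ has constant holomorphic sectional curvature: with $$R_{i\bar jk\bar l}=-\frac{\partial^2 g_{i\bar j}}{\partial z_k\,\partial\bar z_l}+\sum_{p,q=1}^n g^{\bar q p}\,\frac{\partial g_{i\bar q}}{\partial z_k}\,\frac{\partial g_{p\bar j}}{\partial\bar z_l},$$ where $[g^{\bar q p}]$ is the inverse of the matrix $[g_{p\bar q}]$, there is a real number $\kappa$ such that $$\frac{\sum_{i,j,k,l} R_{i\bar jk\bar l}(z)\,v_i\bar v_jv_k\bar v_l}{\bigl(\sum_{i,j}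 g_{i\bar j}(z)\,v_i\bar v_j\bigr)^2}=\kappa\qquad\text{for all } z\in\Omega \text{ and all } v\in\mathbb{C}^n\setminus\{0\}.$$ Then for every $p\in\Omega$ there is an open neighborhood $U_p\subset\Omega$ of $p$ such that $$\sup_{\zeta\in U_p}|K(z,\zeta)|\le 2\,|K(z,p)|\qquad\text{for every } z\in\Omega.$$ -/

import Mathlib

open MeasureTheory
open scoped ComplexConjugate ENNReal

noncomputable section

/-- The Bergman space `A²(Ω)`: functions that are holomorphic on `Ω ⊆ ℂⁿ` and square integrable on
`Ω` for Lebesgue measure on `ℂⁿ = ℝ²ⁿ`. (Here `ℂⁿ` is `Fin n → ℂ`; only its topology, its bounded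
sets and its Lebesgue measure matter, so the choice of norm is irrelevant. Values of `f` outside
`Ω` play no role.) -/
def bergmanSpace {n : ℕ} (Ω : Set (Fin n → ℂ)) : Set ((Fin n → ℂ) → ℂ) :=
  {f | DifferentiableOn ℂ f Ω ∧ MemLp f 2 (volume.restrict Ω)}

/-- `k` represents the evaluation at `w`: it lies in `A²(Ω)` and
`f(w) = ∫_Ω f(z) conj(k(z)) dV(z)` for every `f ∈ A²(Ω)`. -/
def IsReproducingAt {n : ℕ} (Ω : Set (Fin n → ℂ)) (w : Fin n → ℂ) (k : (Fin n → ℂ) → ℂ) : Prop :=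
  k ∈ bergmanSpace Ω ∧ ∀ f ∈ bergmanSpace Ω, f w = ∫ z in Ω, f z * conj (k z)

open Classical in
/-- The Bergman kernel `K(z, w)` of `Ω`: for `w ∈ Ω`, `K(·, w)` is the function in `A²(Ω)` that
represents the evaluation at `w`. For an open set `Ω` and `w ∈ Ω` such a function exists, and its
values on `Ω` are unique; the values for `z ∉ Ω` or `w ∉ Ω` carry no meaning. -/
def bergmanKernel {n : ℕ} (Ω : Set (Fin n → ℂ)) (z w : Fin n → ℂ) : ℂ :=
  if h : ∃ k, IsReproducingAt Ω w k then h.choose z else 0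

/-- The Wirtinger derivative `∂f/∂z_j = (∂f/∂x_j - i ∂f/∂y_j) / 2`. -/
def wirtinger {n : ℕ} (j : Fin n) (f : (Fin n → ℂ) → ℂ) (z : Fin n → ℂ) : ℂ :=
  (fderiv ℝ f z (Pi.single j 1) - Complex.I * fderiv ℝ f z (Pi.single j Complex.I)) / 2

/-- The conjugate Wirtinger derivative `∂f/∂z̄_j = (∂f/∂x_j + i ∂f/∂y_j) / 2`. -/
def wirtingerBar {n : ℕ} (j : Fin n) (f : (Fin n → ℂ) → ℂ) (z : Fin n → ℂ) : ℂ :=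
  (fderiv ℝ f z (Pi.single j 1) + Complex.I * fderiv ℝ f z (Pi.single j Complex.I)) / 2

/-- The Bergman metric `g_{j k̄}(z) = ∂² log K(z, z) / ∂z_j ∂z̄_k`, as the matrix with rows `j` and
columns `k`. -/
def bergmanMetric {n : ℕ} (Ω : Set (Fin n → ℂ)) (z : Fin n → ℂ) : Matrix (Fin n) (Fin n) ℂ :=
  Matrix.of fun j k =>
    wirtinger j
      (wirtingerBar k fun x => ((Real.log (bergmanKernel Ω x x).re : ℝ) : ℂ)) z

/-- The curvature tensor of the Kähler metric with matrix `g_{i j̄}`: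
`R_{i j̄ k l̄} = - ∂²g_{i j̄}/∂z_k∂z̄_l + ∑_{p, q} g^{q̄ p} (∂g_{i q̄}/∂z_k) (∂g_{p j̄}/∂z̄_l)`,
where `g^{q̄ p}` is the entry of the inverse matrix in row `q` and column `p`. -/
def kahlerCurvature {n : ℕ} (g : (Fin n → ℂ) → Matrix (Fin n) (Fin n) ℂ) (z : Fin n → ℂ)
    (i j k l : Fin n) : ℂ :=
  - wirtinger k (wirtingerBar l fun x => g x i j) z
    + ∑ p, ∑ q, (g z)⁻¹ q p * wirtinger k (fun x => g x i q) z * wirtingerBar l (fun x => g x p j) z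

/-- The holomorphic sectional curvature of the Kähler metric `g` at `z` in the direction `v ≠ 0`:
`(∑ R_{i j̄ k l̄} v_i v̄_j v_k v̄_l) / (∑ g_{i j̄} v_i v̄_j)²`. -/
def holomorphicSectionalCurvature {n : ℕ} (g : (Fin n → ℂ) → Matrix (Fin n) (Fin n) ℂ)
    (z v : Fin n → ℂ) : ℂ :=
  (∑ i, ∑ j, ∑ k, ∑ l, kahlerCurvature g z i j k l * v i * conj (v j) * v k * conj (v l))
    / (∑ i, ∑ j, g z i j * v i * conj (v j)) ^ 2

end

open Metric Set Filter Topology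

/-! ### Holomorphic maps of several variables, with Banach space values. -/

section SeveralVariables

/-! Write `k z` for the vector of the Bergman space that represents evaluation at `z`, so that K(z,
w) = ⟪k z, k w⟫, and polarize: P(x, y) = ⟪k x, k ȳ⟫ is holomorphic in (x, y) near (p, p̄). Subtract
from log P its restrictions to the two slices through (p, p̄), adding back the value there. The
result is Calabi's diastasis D, with the same mixed Hessian as log P and vanishing on both slices.

Local structure. By analytic continuation from the antidiagonal y = x̄, constant holomorphic
sectional curvature 2λ becomes an identity for the polarized curvature tensor. Integrating it in y
gives ∂ᵢ∂ₖD + λ ∂ᵢD ∂ₖD = ∑ Γ ∂D, with Christoffel symbols Γ depending on x only. A function e with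
e' = exp(λ·) turns this into a linear system for e(D), whose solutions are determined by their 1-jet
at x = p. Hence e(D) is a bilinear expression B in V(y) and conj V(x̄), where V is a local
holomorphic coordinate system (Bergman's representative coordinates up to a linear change), and exp
D = (1 + λB)^(1/λ) = ∑ cₘ Bᵐ. See `normalForm_of_hasConstantCurvatureOn` and
`HolomorphicKernel.exists_localStructure`.

Lines in the coordinates V. Along y(t) = V⁻¹(tv), normalize the reproducing vectors to φ(t) =
k(ȳ(t)) / ⟪k p, k(ȳ(t))⟫. The model form of the kernel makes the Taylor coefficients φₘ orthogonal,
with ‖φₘ‖² = cₘ Nᵐ / ‖k p‖². Since Ω is bounded, multiplication by zⱼ - pⱼ is a bounded operator,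
which prevents ‖φₘ₊₁‖ / ‖φₘ‖ from tending to 0. As cₘ₊₁ / cₘ = (1 - λm)/(m + 1), this forces λ < 0
(`IsModelCurve.lam_neg`), and then cₘ lies between two geometric sequences.

From local to global. Put eₘ(z) = ⟪k z, φₘ⟫. Near p these are h cₘ lᵐ, so eₘ₊₁ e₀ᵐ = cₘ₊₁ e₁ᵐ⁺¹
there, and on all of Ω by the identity theorem. Combined with |eₘ(z)| ≤ ‖k z‖ ‖φₘ‖ and m → ∞, this
gives |e₁(z)| ≤ C √N |e₀(z)|, where C is independent of z because the root removes the factor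
depending on z. For small v the series ∑ eₘ(z) is then dominated by a geometric one, so |⟪k z,
φ(1)⟫| ≤ 4/3 |⟪k z, φ(0)⟫| (`IsModelCurve.norm_inner_le`). Undoing the normalization costs a factor
of at most 3/2 near p, and 4/3 · 3/2 = 2. Zeros of K(·, p) are handled at the end by continuity and
the identity theorem. -/

theorem exists_bounded_ball {E F : Type*} [NormedAddCommGroup E] [NormedAddCommGroup F]
    {f : E → F} {U : Set E} (hU : IsOpen U) (hf : ContinuousOn f U) {c : E} (hc : c ∈ U) :
    ∃ R > 0, ∃ M, ball c R ⊆ U ∧ ∀ w ∈ ball c R, ‖f w‖ ≤ M := by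
  have h1 : ∀ᶠ w in 𝓝 c, w ∈ U ∧ ‖f w‖ < ‖f c‖ + 1 :=
    (show ∀ᶠ w in 𝓝 c, w ∈ U from hU.mem_nhds hc).and
      ((hf.continuousAt (hU.mem_nhds hc)).norm.eventually_lt_const (lt_add_one _))
  obtain ⟨R, hR, h⟩ := Metric.eventually_nhds_iff_ball.mp h1
  exact ⟨R, hR, ‖f c‖ + 1, fun w hw => (h w hw).1, fun w hw => (h w hw).2.le⟩

variable {E F V : Type*} [NormedAddCommGroup E] [NormedSpace ℂ E] [NormedAddCommGroup F]
  [NormedSpace ℂ F] [NormedAddCommGroup V] [NormedSpace ℂ V]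

/-- Schwarz lemma: the ball is mapped into the closed ball of radius `2 * M` about `f c`. -/
theorem norm_fderiv_le_of_bounded_ball {f : E → F} {c : E} {R M : ℝ} (hR : 0 < R)
    (hd : DifferentiableOn ℂ f (ball c R)) (hM : ∀ w ∈ ball c R, ‖f w‖ ≤ M) :
    ‖fderiv ℂ f c‖ ≤ 2 * M / R := by
  refine Complex.norm_fderiv_le_div_of_mapsTo_ball hd (fun w hw => ?_) hR
  rw [mem_closedBall, dist_eq_norm]
  linarith [norm_sub_le (f w) (f c), hM w hw, hM c (mem_ball_self hR)]

/-- Second order Taylor estimate for a bounded holomorphic map. -/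
theorem norm_sub_sub_fderiv_le_of_bounded_ball {f : E → F} {c z : E} {R M : ℝ}
    (hd : DifferentiableOn ℂ f (ball c R)) (hM : ∀ w ∈ ball c R, ‖f w‖ ≤ M) (hz : z ∈ ball c R) :
    ‖f z - f c - fderiv ℂ f c (z - c)‖ ≤ 4 * M * (dist z c / R) ^ 2 := by
  have hR : 0 < R := nonempty_ball.mp ⟨_, hz⟩
  have hL := norm_fderiv_le_of_bounded_ball hR hd hM
  have hc := hM c (mem_ball_self hR)
  have hM0 : 0 ≤ M := (norm_nonneg _).trans hc
  set L := fderiv ℂ f c with hLdef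
  set g : E → F := fun w => f w - f c - L (w - c) with hg
  have hgc : g c = 0 := by simp [hg]
  have hgd : DifferentiableOn ℂ g (ball c R) := by
    refine (hd.sub_const _).sub ?_
    exact (L.differentiable.comp (differentiable_id.sub_const c)).differentiableOn
  -- The remainder vanishes to second order at `c` and is bounded by `4 * M`, so the Schwarz lemma
  -- with a zero of order two applies.
  have hmaps : MapsTo g (ball c R) (closedBall (g c) (4 * M)) := by
    intro w hw
    rw [hgc, mem_closedBall_zero_iff]
    have h1 : ‖L (w - c)‖ ≤ 2 * M := by
      calc ‖L (w - c)‖ ≤ ‖L‖ * ‖w - c‖ := L.le_opNorm _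
        _ ≤ 2 * M / R * R := by
          gcongr
          rw [← dist_eq_norm]; exact (mem_ball.mp hw).le
        _ = 2 * M := by field_simp
    calc ‖g w‖ ≤ ‖f w - f c‖ + ‖L (w - c)‖ := norm_sub_le _ _
      _ ≤ ‖f w‖ + ‖f c‖ + ‖L (w - c)‖ := by gcongr; exact norm_sub_le _ _
      _ ≤ 4 * M := by linarith [hM w hw]
  have hlo : (g · - g c) =o[𝓝 c] (fun w ↦ ‖w - c‖ ^ 1) := by
    simp only [hgc, sub_zero, pow_one]
    have := (hd.differentiableAt (ball_mem_nhds c hR)).hasFDerivAt.isLittleO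
    exact this.norm_right
  have := Complex.dist_le_mul_div_pow_of_mapsTo_ball_of_isLittleO hgd hmaps hlo hz
  rwa [hgc, dist_zero_right] at this

/-- A quadratic remainder bound on a fixed ball survives limits and suprema, unlike the little-o
definition of the derivative. This is how differentiability is obtained in the next two results. -/
theorem hasFDerivAt_of_norm_sub_sub_le {f : E → F} {c : E} {L : E →L[ℂ] F} {R C : ℝ} (hR : 0 < R)
    (h : ∀ z ∈ ball c R, ‖f z - f c - L (z - c)‖ ≤ C * (dist z c / R) ^ 2) :
    HasFDerivAt f L c := by
  refine .of_isLittleO ?_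
  have h1 : (fun z => f z - f c - L (z - c)) =O[𝓝 c] (fun z => ‖z - c‖ ^ 2) := by
    refine Asymptotics.IsBigO.of_bound (C / R ^ 2) ?_
    filter_upwards [ball_mem_nhds c hR] with z hz
    refine (h z hz).trans (le_of_eq ?_)
    rw [dist_eq_norm, norm_pow, norm_norm]
    field_simp
  refine h1.trans_isLittleO ?_
  have h2 : (fun z => ‖z - c‖ ^ 2) =o[𝓝 c] (fun z => ‖z - c‖ ^ 1) := by
    have := (Asymptotics.isLittleO_pow_pow (𝕜 := ℝ) (show 1 < 2 by norm_num)).comp_tendsto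
      (show Tendsto (fun z : E => ‖z - c‖) (𝓝 c) (𝓝 0) from
        Continuous.tendsto' (by fun_prop) _ _ (by simp))
    exact this
  simpa using h2.norm_right.trans_isBigO (Asymptotics.isBigO_refl _ _)

/-- A uniform limit of uniformly bounded holomorphic maps on a ball is differentiable at the
center. -/
theorem differentiableAt_of_tendsto_of_bounded_ball [CompleteSpace F] {f : E → F} {g : ℕ → E → F}
    {c : E} {R M : ℝ} (hR : 0 < R) (hg : ∀ n, DifferentiableOn ℂ (g n) (ball c R))
    (hM : ∀ n, ∀ w ∈ ball c R, ‖g n w‖ ≤ M)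
    (hu : ∀ ε > 0, ∀ᶠ n in atTop, ∀ w ∈ ball c R, ‖g n w - f w‖ ≤ ε) :
    DifferentiableAt ℂ f c := by
  -- The derivative estimate applies to `g m - g n`, which is eventually bounded by `ε * R / 4`, so
  -- the derivatives at `c` differ by at most `ε / 2`.
  have hcau : CauchySeq fun n => fderiv ℂ (g n) c := by
    rw [Metric.cauchySeq_iff]
    intro ε hε
    obtain ⟨N, hN⟩ := eventually_atTop.mp (hu (ε * R / 8) (by positivity))
    refine ⟨N, fun m hm n hn => ?_⟩
    have hdm := (hg m).differentiableAt (ball_mem_nhds c hR)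
    have hdn := (hg n).differentiableAt (ball_mem_nhds c hR)
    rw [dist_eq_norm, ← fderiv_sub hdm hdn]
    have := norm_fderiv_le_of_bounded_ball (M := ε * R / 8 + ε * R / 8) hR ((hg m).sub (hg n))
      (fun w hw => by
        have h1 := hN m hm w hw
        have h2 := hN n hn w hw
        calc ‖(g m - g n) w‖ = ‖(g m w - f w) - (g n w - f w)‖ := by simp
          _ ≤ _ := (norm_sub_le _ _).trans (add_le_add h1 h2))
    refine this.trans_lt ?_
    have : 2 * (ε * R / 8 + ε * R / 8) / R = ε / 2 := by field_simp; norm_num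
    rw [this]; linarith
  obtain ⟨L, hL⟩ := cauchySeq_tendsto_of_complete hcau
  have hpt : ∀ w ∈ ball c R, Tendsto (fun n => g n w) atTop (𝓝 (f w)) := by
    intro w hw
    rw [Metric.tendsto_nhds]
    intro ε hε
    filter_upwards [hu (ε / 2) (by positivity)] with n hn
    rw [dist_eq_norm]
    exact (hn w hw).trans_lt (by linarith)
  refine (hasFDerivAt_of_norm_sub_sub_le (L := L) (C := 4 * M) hR fun z hz => ?_).differentiableAt
  have hlim : Tendsto (fun n => ‖g n z - g n c - fderiv ℂ (g n) c (z - c)‖) atTop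
      (𝓝 ‖f z - f c - L (z - c)‖) := by
    refine (((hpt z hz).sub (hpt c (mem_ball_self hR))).sub ?_).norm
    exact ((ContinuousLinearMap.apply ℂ F (z - c)).continuous.tendsto L).comp hL
  refine le_of_tendsto hlim (Eventually.of_forall fun n => ?_)
  exact norm_sub_sub_fderiv_le_of_bounded_ball (hg n) (hM n) hz

/-- A locally bounded family of operators that is strongly holomorphic is holomorphic in norm. -/
theorem differentiableAt_clm_of_apply_of_bounded_ball {T : E → V →L[ℂ] F} {c : E} {R M : ℝ}
    (hR : 0 < R) (hT : ∀ v, DifferentiableOn ℂ (fun w => T w v) (ball c R))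
    (hM : ∀ w ∈ ball c R, ‖T w‖ ≤ M) : DifferentiableAt ℂ T c := by
  have hM0 : 0 ≤ M := (norm_nonneg _).trans (hM c (mem_ball_self hR))
  have hda : ∀ v, DifferentiableAt ℂ (fun w => T w v) c := fun v =>
    (hT v).differentiableAt (ball_mem_nhds c hR)
  have hMv : ∀ v, ∀ w ∈ ball c R, ‖T w v‖ ≤ M * ‖v‖ := fun v w hw =>
    (T w).le_of_opNorm_le (hM w hw) v
  let B : E →ₗ[ℂ] V →ₗ[ℂ] F := LinearMap.mk₂ ℂ (fun h v => fderiv ℂ (fun w => T w v) c h)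
    (fun h h' v => by simp) (fun a h v => by simp)
    (fun h v v' => by
      have : (fun w => T w (v + v')) = (fun w => T w v) + fun w => T w v' := by ext w; simp
      rw [this, fderiv_add (hda v) (hda v')]; rfl)
    (fun a h v => by
      have : (fun w => T w (a • v)) = a • fun w => T w v := by ext w; simp
      rw [this, fderiv_const_smul (hda v)]; rfl)
  -- The candidate derivative collects the derivatives of all `w ↦ T w v`. The Taylor remainders are
  -- proportional to `‖v‖`, hence bounded in operator norm.
  let L : E →L[ℂ] V →L[ℂ] F := B.mkContinuous₂ (2 * M / R) fun h v => by
    have h1 := norm_fderiv_le_of_bounded_ball hR (hT v) (hMv v)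
    calc ‖B h v‖ = ‖fderiv ℂ (fun w => T w v) c h‖ := rfl
      _ ≤ 2 * (M * ‖v‖) / R * ‖h‖ := ContinuousLinearMap.le_of_opNorm_le _ h1 h
      _ = 2 * M / R * ‖h‖ * ‖v‖ := by ring
  refine (hasFDerivAt_of_norm_sub_sub_le (L := L) (C := 4 * M) hR fun z hz => ?_).differentiableAt
  refine ContinuousLinearMap.opNorm_le_bound _ (by positivity) fun v => ?_
  have := norm_sub_sub_fderiv_le_of_bounded_ball (hT v) (hMv v) hz
  calc ‖(T z - T c - L (z - c)) v‖ = ‖T z v - T c v - fderiv ℂ (fun w => T w v) c (z - c)‖ := rfl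
    _ ≤ _ := this
    _ = _ := by ring

/-- The difference quotients with steps `1 / (N + n)` are holomorphic, and by the second order
Taylor estimate they converge locally uniformly at rate `1 / (N + n)`. -/
theorem DifferentiableOn.fderiv_apply_of_isOpen [CompleteSpace F] {f : E → F} {U : Set E}
    (hU : IsOpen U) (hf : DifferentiableOn ℂ f U) (v : E) :
    DifferentiableOn ℂ (fun w => fderiv ℂ f w v) U := by
  intro c hc
  obtain ⟨R, hR, M, hRU, hM⟩ := exists_bounded_ball hU hf.continuousOn hc
  have hM0 : 0 ≤ M := (norm_nonneg _).trans (hM c (mem_ball_self hR))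
  set r := R / 3 with hr
  have hr0 : 0 < r := by positivity
  -- Starting at `N` keeps `w + v / (N + n)` within distance `r` of `w` for every `n`.
  obtain ⟨N, hN⟩ := exists_nat_gt (‖v‖ / r)
  have hN0 : (0 : ℝ) < N := lt_of_le_of_lt (by positivity) hN
  let t : ℕ → ℂ := fun n => ((N + n : ℕ) : ℂ)
  have htn : ∀ n, ‖t n‖ = N + n := fun n => by
    simp only [t, Complex.norm_natCast]; push_cast; ring
  have ht0 : ∀ n, t n ≠ 0 := fun n => by
    rw [← norm_pos_iff, htn]; positivity
  have hvn : ∀ n, ‖(t n)⁻¹ • v‖ < r := fun n => by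
    rw [norm_smul, norm_inv, htn]
    rw [inv_mul_lt_iff₀ (by positivity)]
    rw [div_lt_iff₀ hr0] at hN
    nlinarith [show (0 : ℝ) ≤ n from n.cast_nonneg]
  have hball : ∀ w ∈ ball c r, ball w r ⊆ ball c R := fun w hw =>
    ball_subset_ball' (by have := mem_ball.mp hw; linarith)
  have hq : ∀ n, ∀ w ∈ ball c r,
      ‖t n • (f (w + (t n)⁻¹ • v) - f w) - fderiv ℂ f w v‖ ≤ 4 * M * (‖v‖ / r) ^ 2 / (N + n) := by
    intro n w hw
    have h1 := norm_sub_sub_fderiv_le_of_bounded_ball (z := w + (t n)⁻¹ • v)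
      (hf.mono ((hball w hw).trans hRU)) (fun x hx => hM x (hball w hw hx))
      (by rw [mem_ball, dist_eq_norm, add_sub_cancel_left]; exact hvn n)
    rw [dist_eq_norm, add_sub_cancel_left, norm_smul, norm_inv, htn] at h1
    have h2 : t n • (f (w + (t n)⁻¹ • v) - f w) - fderiv ℂ f w v
        = t n • (f (w + (t n)⁻¹ • v) - f w - fderiv ℂ f w ((t n)⁻¹ • v)) := by
      rw [map_smul, smul_sub (t n) (_ - _), smul_smul, mul_inv_cancel₀ (ht0 n), one_smul]
    rw [h2, norm_smul, htn]
    calc _ ≤ ((N : ℝ) + n) * (4 * M * ((N + n : ℝ)⁻¹ * ‖v‖ / r) ^ 2) := by gcongr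
      _ = _ := by
        have : (N : ℝ) + n ≠ 0 := by positivity
        field_simp
  refine DifferentiableAt.differentiableWithinAt ?_
  -- The quotient is bounded by the derivative plus the approximation error; the first summand of
  -- the constant is only slack.
  refine differentiableAt_of_tendsto_of_bounded_ball (M := 2 * (N + 0 : ℝ) * M +
    ‖v‖ * (2 * M / r) + 4 * M * (‖v‖ / r) ^ 2 / N)
    (g := fun n w => t n • (f (w + (t n)⁻¹ • v) - f w)) hr0 (fun n => ?_) (fun n w hw => ?_) ?_
  · refine DifferentiableOn.const_smul (DifferentiableOn.sub ?_ (hf.mono ?_)) _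
    · refine hf.comp ((differentiable_id.add_const _).differentiableOn) fun w hw => hRU ?_
      refine hball w hw ?_
      simp only [mem_ball, dist_eq_norm, add_sub_cancel_left]
      exact hvn n
    · exact fun w hw => hRU (hball w hw (mem_ball_self hr0))
  · have h1 := hq n w hw
    have h2 : ‖fderiv ℂ f w v‖ ≤ 2 * M / r * ‖v‖ :=
      ContinuousLinearMap.le_of_opNorm_le _ (norm_fderiv_le_of_bounded_ball hr0
        (hf.mono ((hball w hw).trans hRU)) (fun x hx => hM x (hball w hw hx))) v
    have h3 : 4 * M * (‖v‖ / r) ^ 2 / (N + n) ≤ 4 * M * (‖v‖ / r) ^ 2 / N := by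
      gcongr; linarith [show (0 : ℝ) ≤ n from n.cast_nonneg]
    have h4 : 0 ≤ 2 * (N + 0 : ℝ) * M := by positivity
    have h5 := norm_add_le (t n • (f (w + (t n)⁻¹ • v) - f w) - fderiv ℂ f w v) (fderiv ℂ f w v)
    rw [sub_add_cancel] at h5
    linarith
  · intro ε hε
    have : Tendsto (fun n : ℕ => 4 * M * (‖v‖ / r) ^ 2 / ((N : ℝ) + n)) atTop (𝓝 0) :=
      tendsto_const_nhds.div_atTop (tendsto_atTop_add_const_left _ _ tendsto_natCast_atTop_atTop)
    filter_upwards [this.eventually_le_const hε] with n hn w hw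
    exact (hq n w hw).trans hn

/-- The derivative is holomorphic in each fixed direction and locally bounded in norm, so holomorphy
in operator norm follows. -/
theorem DifferentiableOn.fderiv_of_isOpen [CompleteSpace F] {f : E → F} {U : Set E}
    (hU : IsOpen U) (hf : DifferentiableOn ℂ f U) : DifferentiableOn ℂ (fderiv ℂ f) U := by
  intro c hc
  obtain ⟨R, hR, M, hRU, hM⟩ := exists_bounded_ball hU hf.continuousOn hc
  have hsub : ∀ w ∈ ball c (R / 2), ball w (R / 2) ⊆ ball c R := fun w hw =>
    ball_subset_ball' (by have := mem_ball.mp hw; linarith)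
  have h2 : 0 < R / 2 := by positivity
  refine (differentiableAt_clm_of_apply_of_bounded_ball (M := 2 * M / (R / 2)) h2
    (fun v => ?_) fun w hw => ?_).differentiableWithinAt
  · exact (hf.fderiv_apply_of_isOpen hU v).mono
      fun w hw => hRU (hsub w hw (mem_ball_self h2))
  · exact norm_fderiv_le_of_bounded_ball h2 (hf.mono ((hsub w hw).trans hRU))
      fun x hx => hM x (hsub w hw hx)

theorem DifferentiableOn.contDiffOn_one_of_isOpen [CompleteSpace F] {f : E → F} {U : Set E}
    (hU : IsOpen U) (hf : DifferentiableOn ℂ f U) : ContDiffOn ℂ 1 f U :=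
  (contDiffOn_succ_iff_fderiv_of_isOpen (n := 0) hU).mpr
    ⟨hf, by simp, contDiffOn_zero.mpr (hf.fderiv_of_isOpen hU).continuousOn⟩

theorem DifferentiableOn.contDiffOn_two_of_isOpen [CompleteSpace F] {f : E → F} {U : Set E}
    (hU : IsOpen U) (hf : DifferentiableOn ℂ f U) : ContDiffOn ℂ 2 f U :=
  (contDiffOn_succ_iff_fderiv_of_isOpen (n := 1) hU).mpr
    ⟨hf, by simp, (hf.fderiv_of_isOpen hU).contDiffOn_one_of_isOpen hU⟩

theorem fderiv_fderiv_comm [CompleteSpace F] {f : E → F} {U : Set E}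
    (hU : IsOpen U) (hf : DifferentiableOn ℂ f U) {z : E} (hz : z ∈ U) (v w : E) :
    fderiv ℂ (fun x => fderiv ℂ f x v) z w = fderiv ℂ (fun x => fderiv ℂ f x w) z v := by
  have h2 := (hf.contDiffOn_two_of_isOpen hU).contDiffAt (hU.mem_nhds hz)
  have hs := h2.isSymmSndFDerivAt (by simp)
  have hd := (hf.fderiv_of_isOpen hU).differentiableAt (hU.mem_nhds hz)
  have key : ∀ v w, fderiv ℂ (fun x => fderiv ℂ f x v) z w = fderiv ℂ (fderiv ℂ f) z w v := by
    intro v w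
    rw [fderiv_clm_apply hd (differentiableAt_const v)]
    simp
  rw [key, key, hs.eq]

/-- The complex line through `a` and `z` meets `U` in a convex planar domain, where the one-variable
identity theorem applies. -/
theorem eqOn_zero_of_convex_of_eventually {f : E → F} {U : Set E} (hU : IsOpen U)
    (hc : Convex ℝ U) [CompleteSpace F] (hf : DifferentiableOn ℂ f U) {a z : E} (ha : a ∈ U)
    (hz : z ∈ U) (h0 : ∀ᶠ x in 𝓝 a, f x = 0) : f z = 0 := by
  let γ : ℂ → E := fun t => a + t • (z - a)
  have hγ : Continuous γ := by fun_prop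
  have hγd : Differentiable ℂ γ := by fun_prop
  let S := γ ⁻¹' U
  have hS : IsOpen S := hU.preimage hγ
  have hSc : Convex ℝ S := by
    intro s hs t ht α β hα hβ hαβ
    have := hc hs ht hα hβ hαβ
    have e : α • γ s + β • γ t = γ (α • s + β • t) := by
      simp only [γ, smul_add, add_smul]
      rw [add_add_add_comm, ← add_smul, hαβ, one_smul, smul_assoc, smul_assoc]
    rw [e] at this
    exact this
  have hd : DifferentiableOn ℂ (f ∘ γ) S := hf.comp hγd.differentiableOn fun t ht => ht
  have h0S : (0 : ℂ) ∈ S := by simpa [S, γ] using ha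
  have h1S : (1 : ℂ) ∈ S := by simpa [S, γ] using hz
  have hev : (f ∘ γ) =ᶠ[𝓝 0] 0 := by
    have ht : Tendsto γ (𝓝 0) (𝓝 a) := hγ.tendsto' _ _ (by simp [γ])
    exact ht.eventually h0
  have := (hd.analyticOnNhd hS).eqOn_zero_of_preconnected_of_eventuallyEq_zero
    hSc.isPreconnected h0S hev h1S
  simpa [γ] using this

/-- **Identity theorem** in several complex variables. -/
theorem eqOn_zero_of_isPreconnected_of_eventually [CompleteSpace F] {f : E → F} {U : Set E}
    (hU : IsOpen U) (hc : IsPreconnected U) (hf : DifferentiableOn ℂ f U) {a : E} (ha : a ∈ U)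
    (h0 : ∀ᶠ x in 𝓝 a, f x = 0) : ∀ z ∈ U, f z = 0 := by
  let S : Set E := {x | ∀ᶠ y in 𝓝 x, f y = 0}
  have hSo : IsOpen S := isOpen_iff_mem_nhds.mpr fun x hx => eventually_eventually_nhds.mpr hx
  have key : U ⊆ S := by
    refine hc.subset_of_closure_inter_subset hSo ⟨a, ha, h0⟩ ?_
    rintro x ⟨hx, hxU⟩
    obtain ⟨r, hr, hrU⟩ := Metric.isOpen_iff.mp hU x hxU
    obtain ⟨b, hbS, hb⟩ := Metric.mem_closure_iff.mp hx r hr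
    have hb' : b ∈ ball x r := by rwa [mem_ball, dist_comm]
    filter_upwards [ball_mem_nhds x hr] with y hy
    exact eqOn_zero_of_convex_of_eventually isOpen_ball (convex_ball x r) (hf.mono hrU) hb' hy hbS
  exact fun z hz => (key hz).self_of_nhds

end SeveralVariables

/-! ### Mean value property over balls. -/

theorem measurePreserving_circle_smul {n : ℕ} (a : Circle) :
    MeasurePreserving (fun v : Fin n → ℂ => (a : ℂ) • v) := by
  have := volume_preserving_pi (fun _ : Fin n => (rotation a).measurePreserving)
  exact this

theorem setIntegral_closedBall_circle_smul {n : ℕ} (a : Circle) (r : ℝ) (g : (Fin n → ℂ) → ℂ) :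
    ∫ v in closedBall 0 r, g ((a : ℂ) • v) = ∫ v in closedBall 0 r, g v := by
  have h := measurePreserving_circle_smul (n := n) a
  have he : MeasurableEmbedding (fun v : Fin n → ℂ => (a : ℂ) • v) :=
    (Homeomorph.smulOfNeZero (a : ℂ) (Circle.coe_ne_zero a)).measurableEmbedding
  rw [← h.setIntegral_preimage_emb he g]
  congr 2
  ext v
  simp [norm_smul, Circle.norm_coe]

/-- The mean value property of holomorphic functions over balls. -/
theorem setIntegral_closedBall_eq_of_differentiableOn {n : ℕ} {f : (Fin n → ℂ) → ℂ}
    {U : Set (Fin n → ℂ)} (hf : DifferentiableOn ℂ f U) {z : Fin n → ℂ} {r : ℝ}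
    (hz : closedBall z r ⊆ U) :
    ∫ x in closedBall z r, f x = volume.real (closedBall (0 : Fin n → ℂ) r) * f z := by
  have htr : ∫ x in closedBall z r, f x = ∫ v in closedBall 0 r, f (z + v) := by
    rw [← (measurePreserving_add_left volume z).setIntegral_preimage_emb
      (measurableEmbedding_addLeft z)]
    congr 2
    ext v
    simp
  have hmem : ∀ c : ℂ, ‖c‖ ≤ 1 → ∀ v ∈ closedBall (0 : Fin n → ℂ) r, z + c • v ∈ U := by
    intro c hc v hv
    refine hz ?_
    rw [mem_closedBall, dist_eq_norm, add_sub_cancel_left, norm_smul]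
    rw [mem_closedBall_zero_iff] at hv
    nlinarith [norm_nonneg v, norm_nonneg c]
  -- For each `v` the circle mean of `f (z + c • v)` over `|c| = 1` is `f z`. Integrating over `v`
  -- and exchanging the integrals gives the claim, because rotating `v` does not change the integral
  -- over the ball.
  have hmv : ∀ v ∈ closedBall (0 : Fin n → ℂ) r,
      ∫ θ in (0 : ℝ)..2 * Real.pi, f (z + circleMap 0 1 θ • v) = 2 * Real.pi * f z := by
    intro v hv
    have hd : DiffContOnCl ℂ (fun c : ℂ => f (z + c • v)) (ball 0 |1|) := by
      rw [abs_one]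
      refine DifferentiableOn.diffContOnCl ?_
      rw [closure_ball _ one_ne_zero]
      refine hf.comp (Differentiable.differentiableOn (by fun_prop)) fun c hc => ?_
      exact hmem c (by simpa using hc) v hv
    have h1 := hd.circleAverage
    rw [Real.circleAverage_def] at h1
    simp only [zero_smul, add_zero] at h1
    rw [← h1, Complex.real_smul]
    push_cast
    field_simp
  have hint : Integrable (Function.uncurry fun (θ : ℝ) (v : Fin n → ℂ) =>
      f (z + circleMap 0 1 θ • v)) ((volume.restrict (Set.uIoc 0 (2 * Real.pi))).prod
        (volume.restrict (closedBall 0 r))) := by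
    rw [Measure.prod_restrict]
    have hcont : ContinuousOn (Function.uncurry fun (θ : ℝ) (v : Fin n → ℂ) =>
        f (z + circleMap 0 1 θ • v)) (Set.uIcc 0 (2 * Real.pi) ×ˢ closedBall 0 r) := by
      refine hf.continuousOn.comp ?_ ?_
      · exact Continuous.continuousOn (by
          have := continuous_circleMap 0 1
          fun_prop)
      · rintro ⟨θ, v⟩ ⟨-, hv⟩
        exact hmem _ (by simp) v hv
    have := hcont.integrableOn_compact (μ := volume.prod volume)
      (isCompact_uIcc.prod (isCompact_closedBall 0 r))
    exact this.mono_set (Set.prod_mono Set.uIoc_subset_uIcc le_rfl)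
  have hswap := intervalIntegral_integral_swap hint
  have hl : ∫ θ in (0 : ℝ)..2 * Real.pi, ∫ v in closedBall 0 r, f (z + circleMap 0 1 θ • v)
      = 2 * Real.pi * ∫ v in closedBall 0 r, f (z + v) := by
    have : ∀ θ : ℝ, ∫ v in closedBall 0 r, f (z + circleMap 0 1 θ • v)
        = ∫ v in closedBall 0 r, f (z + v) := by
      intro θ
      have := setIntegral_closedBall_circle_smul (Circle.exp θ) r fun v => f (z + v)
      rw [← this]
      simp [circleMap, Circle.coe_exp]
    simp [this]
  have hr : ∫ v in closedBall 0 r, ∫ θ in (0 : ℝ)..2 * Real.pi, f (z + circleMap 0 1 θ • v)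
      = volume.real (closedBall (0 : Fin n → ℂ) r) * (2 * Real.pi * f z) := by
    rw [setIntegral_congr_fun measurableSet_closedBall hmv]
    simp
  rw [hl, hr] at hswap
  rw [htr]
  have hpi : (2 * Real.pi : ℂ) ≠ 0 := by simp [Real.pi_ne_zero]
  apply mul_left_cancel₀ hpi
  rw [hswap]
  ring

/-! ### The Bergman space is a closed subspace of L². -/

section BergmanSpace

variable {n : ℕ} {Ω : Set (Fin n → ℂ)}

/-- The Bergman space as a subspace of `L²(Ω)`. -/
def bergmanSubmodule {n : ℕ} (Ω : Set (Fin n → ℂ)) :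
    Submodule ℂ (Lp ℂ 2 (volume.restrict Ω)) where
  carrier := {F | ∃ f, DifferentiableOn ℂ f Ω ∧ F =ᵐ[volume.restrict Ω] f}
  add_mem' := by
    rintro F G ⟨f, hf, hFf⟩ ⟨g, hg, hGg⟩
    exact ⟨f + g, hf.add hg, (Lp.coeFn_add F G).trans (hFf.add hGg)⟩
  zero_mem' := ⟨0, differentiableOn_const 0, Lp.coeFn_zero _ _ _⟩
  smul_mem' := by
    rintro c F ⟨f, hf, hFf⟩
    exact ⟨c • f, hf.const_smul c, (Lp.coeFn_smul c F).trans (hFf.const_smul c)⟩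

theorem volumeReal_closedBall_pos {r : ℝ} (hr : 0 < r) :
    0 < volume.real (closedBall (0 : Fin n → ℂ) r) :=
  ENNReal.toReal_pos (measure_closedBall_pos _ _ hr).ne' measure_closedBall_lt_top.ne

/-- Average over the closed ball of radius `r` about `z`, as an `L²` functional. -/
noncomputable def ballAverage (Ω : Set (Fin n → ℂ)) (r : ℝ) (z : Fin n → ℂ) :
    Lp ℂ 2 (volume.restrict Ω) →L[ℂ] ℂ :=
  ((volume.real (closedBall (0 : Fin n → ℂ) r) : ℂ)⁻¹) •
    innerSL ℂ (indicatorConstLp 2 (measurableSet_closedBall (x := z) (ε := r))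
      ((Measure.restrict_apply_le Ω _).trans_lt measure_closedBall_lt_top).ne (1 : ℂ))

/-- By the mean value property, evaluation at a point is the restriction to holomorphic functions of
a continuous functional on all of L². -/
theorem ballAverage_eq {F : Lp ℂ 2 (volume.restrict Ω)} {f : (Fin n → ℂ) → ℂ}
    (hf : DifferentiableOn ℂ f Ω) (hF : F =ᵐ[volume.restrict Ω] f) {z : Fin n → ℂ} {r : ℝ}
    (hr : 0 < r) (hz : closedBall z r ⊆ Ω) : ballAverage Ω r z F = f z := by
  have h0 : (volume.real (closedBall (0 : Fin n → ℂ) r) : ℂ) ≠ 0 := by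
    exact_mod_cast (volumeReal_closedBall_pos hr).ne'
  rw [ballAverage, smul_apply, innerSL_apply_apply,
    L2.inner_indicatorConstLp_one]
  have h1 : ∫ x in closedBall z r, F x ∂(volume.restrict Ω) = ∫ x in closedBall z r, f x := by
    rw [setIntegral_congr_ae measurableSet_closedBall (hF.mono fun x hx _ => hx),
      Measure.restrict_restrict measurableSet_closedBall, inter_eq_self_of_subset_left hz]
  rw [h1, setIntegral_closedBall_eq_of_differentiableOn hf hz, smul_eq_mul,
    inv_mul_cancel_left₀ h0]

/-- Cauchy–Schwarz against the normalized indicator function. The bound does not depend on the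
center, so L² convergence of holomorphic functions is locally uniform. -/
theorem norm_ballAverage_le (r : ℝ) (z : Fin n → ℂ) :
    ‖ballAverage Ω r z‖ ≤ (volume.real (closedBall (0 : Fin n → ℂ) r))⁻¹ *
      volume.real (closedBall (0 : Fin n → ℂ) r) ^ (1 / 2 : ℝ) := by
  rw [ballAverage, norm_smul, norm_inv, Complex.norm_real, Real.norm_of_nonneg measureReal_nonneg,
    innerSL_apply_norm]
  gcongr
  refine norm_indicatorConstLp_le.trans ?_
  rw [norm_one, one_mul]
  have h : (volume.restrict Ω).real (closedBall z r) ≤ volume.real (closedBall (0 : Fin n → ℂ) r) := by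
    refine ENNReal.toReal_mono measure_closedBall_lt_top.ne
      ((Measure.restrict_apply_le Ω _).trans ?_)
    rw [Measure.addHaar_closedBall_center]
  norm_num
  exact Real.rpow_le_rpow measureReal_nonneg h (by norm_num)

/-- In an open set, one radius serves all points near a given one. -/
theorem exists_closedBall_subset_of_isOpen (hΩ : IsOpen Ω) {z : Fin n → ℂ} (hz : z ∈ Ω) :
    ∃ r > 0, ∀ w ∈ ball z r, closedBall w r ⊆ Ω := by
  obtain ⟨R, hR, h⟩ := Metric.isOpen_iff.mp hΩ z hz
  refine ⟨R / 2, by positivity, fun w hw => (closedBall_subset_ball' ?_).trans h⟩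
  have := mem_ball.mp hw
  linarith

/-- Ball averages turn L² convergence into locally uniform convergence of the holomorphic
representatives, so the pointwise limit is holomorphic. -/
theorem isClosed_bergmanSubmodule (hΩ : IsOpen Ω) :
    IsClosed (bergmanSubmodule Ω : Set (Lp ℂ 2 (volume.restrict Ω))) := by
  refine isClosed_of_closure_subset fun F hF => ?_
  obtain ⟨G, hG, hlim⟩ := mem_closure_iff_seq_limit.mp hF
  choose g hg hGg using hG
  obtain ⟨B, hB⟩ : ∃ B, ∀ m, ‖G m‖ ≤ B := by
    obtain ⟨B, hB⟩ := (Metric.isBounded_range_of_tendsto G hlim).exists_norm_le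
    exact ⟨B, fun m => hB _ (mem_range_self m)⟩
  have hpt : ∀ z ∈ Ω, ∃ w, Tendsto (fun m => g m z) atTop (𝓝 w) := by
    intro z hz
    obtain ⟨r, hr, hb⟩ := exists_closedBall_subset_of_isOpen hΩ hz
    refine ⟨ballAverage Ω r z F, ?_⟩
    have h1 := ((ballAverage Ω r z).continuous.tendsto F).comp hlim
    refine h1.congr fun m => ?_
    exact ballAverage_eq (hg m) (hGg m) hr (hb z (mem_ball_self hr))
  choose! f hf using hpt
  refine ⟨f, fun z hz => ?_, ?_⟩
  · obtain ⟨r, hr, hb⟩ := exists_closedBall_subset_of_isOpen hΩ hz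
    set C := (volume.real (closedBall (0 : Fin n → ℂ) r))⁻¹ *
      volume.real (closedBall (0 : Fin n → ℂ) r) ^ (1 / 2 : ℝ) with hC
    have hbΩ : ball z r ⊆ Ω := fun w hw => hb w hw (mem_closedBall_self hr.le)
    have hC0 : 0 ≤ C := by positivity
    have hfe : ∀ w ∈ ball z r, f w = ballAverage Ω r w F := by
      intro w hw
      refine tendsto_nhds_unique (hf w (hbΩ hw)) ?_
      have h1 := ((ballAverage Ω r w).continuous.tendsto F).comp hlim
      exact h1.congr fun m => ballAverage_eq (hg m) (hGg m) hr (hb w hw)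
    have hge : ∀ m, ∀ w ∈ ball z r, g m w = ballAverage Ω r w (G m) := fun m w hw =>
      (ballAverage_eq (hg m) (hGg m) hr (hb w hw)).symm
    refine (differentiableAt_of_tendsto_of_bounded_ball (g := g) (M := C * B) hr
      (fun m => (hg m).mono hbΩ) (fun m w hw => ?_) ?_).differentiableWithinAt
    · rw [hge m w hw]
      exact (ContinuousLinearMap.le_of_opNorm_le _ (norm_ballAverage_le r w) _).trans
        (by gcongr; exact hB m)
    · intro ε hε
      have h2 : Tendsto (fun m => C * ‖G m - F‖) atTop (𝓝 0) := by
        have := (tendsto_iff_norm_sub_tendsto_zero.mp hlim).const_mul C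
        simpa using this
      filter_upwards [h2.eventually_le_const hε] with m hm w hw
      rw [hge m w hw, hfe w hw, ← map_sub]
      exact (ContinuousLinearMap.le_of_opNorm_le _ (norm_ballAverage_le r w) _).trans hm
  -- A subsequence converges almost everywhere to the L² limit, which identifies it with the
  -- pointwise limit `f`.
  · obtain ⟨ns, hns, hae⟩ := (tendstoInMeasure_of_tendsto_Lp hlim).exists_seq_tendsto_ae
    have hall : ∀ᵐ x ∂(volume.restrict Ω), ∀ m, G m x = g m x := ae_all_iff.mpr hGg
    filter_upwards [hae, hall, ae_restrict_mem hΩ.measurableSet] with x hx hGx hxΩ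
    refine tendsto_nhds_unique hx ?_
    simp only [hGx]
    exact (hf x hxΩ).comp hns.tendsto_atTop

end BergmanSpace

/-! ### Reproducing vectors of the Bergman space. -/

/-- A Hilbert space of holomorphic functions on `Ω`, given by its reproducing vectors `k z`
(so that `f` is the function `z ↦ ⟪k z, f⟫`), which vanish nowhere, and on which the coordinate
functions act by bounded multiplications. -/
structure HolomorphicKernel {n : ℕ} (Ω : Set (Fin n → ℂ)) {H : Type*} [NormedAddCommGroup H]
    [InnerProductSpace ℂ H] (k : (Fin n → ℂ) → H) : Prop where
  differentiableOn_star : DifferentiableOn ℂ (fun y => k (star y)) {y | star y ∈ Ω}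
  differentiableOn_innerSL : DifferentiableOn ℂ (fun z => innerSL ℂ (k z)) Ω
  ne_zero : ∀ z ∈ Ω, k z ≠ 0
  exists_mul : ∀ (j : Fin n) (a : ℂ), ∃ C : ℝ, 0 ≤ C ∧ ∀ f : H, ∃ g : H, ‖g‖ ≤ C * ‖f‖ ∧
    ∀ z ∈ Ω, inner ℂ (k z) g = (z j - a) * inner ℂ (k z) f

section BergmanSpace

variable {n : ℕ} {Ω : Set (Fin n → ℂ)}

/-- The holomorphic representative of an element of the Bergman space. -/
noncomputable def bergmanRep (F : bergmanSubmodule Ω) : (Fin n → ℂ) → ℂ := F.2.choose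

theorem differentiableOn_bergmanRep (F : bergmanSubmodule Ω) :
    DifferentiableOn ℂ (bergmanRep F) Ω := F.2.choose_spec.1

theorem ae_eq_bergmanRep (F : bergmanSubmodule Ω) :
    (F : Lp ℂ 2 (volume.restrict Ω)) =ᵐ[volume.restrict Ω] bergmanRep F := F.2.choose_spec.2

theorem bergmanRep_eq_of_ae_eq (hΩ : IsOpen Ω) {F : bergmanSubmodule Ω} {f : (Fin n → ℂ) → ℂ}
    (hf : DifferentiableOn ℂ f Ω)
    (hF : (F : Lp ℂ 2 (volume.restrict Ω)) =ᵐ[volume.restrict Ω] f) {z : Fin n → ℂ} (hz : z ∈ Ω) :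
    bergmanRep F z = f z := by
  obtain ⟨r, hr, hb⟩ := exists_closedBall_subset_of_isOpen hΩ hz
  rw [← ballAverage_eq hf hF hr (hb z (mem_ball_self hr)),
    ← ballAverage_eq (differentiableOn_bergmanRep F) (ae_eq_bergmanRep F) hr
      (hb z (mem_ball_self hr))]

theorem bergmanRep_memLp (F : bergmanSubmodule Ω) :
    MemLp (bergmanRep F) 2 (volume.restrict Ω) :=
  (memLp_congr_ae (ae_eq_bergmanRep F)).mp (Lp.memLp _)

theorem bergmanRep_mem_bergmanSpace (F : bergmanSubmodule Ω) : bergmanRep F ∈ bergmanSpace Ω :=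
  ⟨differentiableOn_bergmanRep F, bergmanRep_memLp F⟩

/-- The element of the Bergman space defined by a square integrable holomorphic function. -/
noncomputable def toBergman {f : (Fin n → ℂ) → ℂ} (hf : f ∈ bergmanSpace Ω) : bergmanSubmodule Ω :=
  ⟨hf.2.toLp f, f, hf.1, hf.2.coeFn_toLp⟩

theorem bergmanRep_toBergman (hΩ : IsOpen Ω) {f : (Fin n → ℂ) → ℂ} (hf : f ∈ bergmanSpace Ω)
    {z : Fin n → ℂ} (hz : z ∈ Ω) : bergmanRep (toBergman hf) z = f z :=
  bergmanRep_eq_of_ae_eq hΩ hf.1 hf.2.coeFn_toLp hz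

theorem inner_bergman_eq_integral {F G : bergmanSubmodule Ω} {f g : (Fin n → ℂ) → ℂ}
    (hF : (F : Lp ℂ 2 (volume.restrict Ω)) =ᵐ[volume.restrict Ω] f)
    (hG : (G : Lp ℂ 2 (volume.restrict Ω)) =ᵐ[volume.restrict Ω] g) :
    inner ℂ F G = ∫ z in Ω, g z * conj (f z) := by
  rw [Submodule.coe_inner, L2.inner_def]
  refine integral_congr_ae ?_
  filter_upwards [hF, hG] with x hx hy
  rw [hx, hy, RCLike.inner_apply]

/-- Evaluation at `z` on the Bergman space. -/
noncomputable def bergmanEval (Ω : Set (Fin n → ℂ)) (z : Fin n → ℂ) : bergmanSubmodule Ω →L[ℂ] ℂ :=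
  open Classical in
  if h : ∃ r > 0, closedBall z r ⊆ Ω then
    (ballAverage Ω h.choose z).comp (bergmanSubmodule Ω).subtypeL else 0

theorem bergmanEval_apply (hΩ : IsOpen Ω) {z : Fin n → ℂ} (hz : z ∈ Ω) (F : bergmanSubmodule Ω) :
    bergmanEval Ω z F = bergmanRep F z := by
  have h : ∃ r > 0, closedBall z r ⊆ Ω := by
    obtain ⟨r, hr, hb⟩ := exists_closedBall_subset_of_isOpen hΩ hz
    exact ⟨r, hr, hb z (mem_ball_self hr)⟩
  rw [bergmanEval, dif_pos h]
  exact ballAverage_eq (differentiableOn_bergmanRep F) (ae_eq_bergmanRep F) h.choose_spec.1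
    h.choose_spec.2

/-- Each `F` has a holomorphic representative, and the evaluation functionals are locally bounded in
norm, so weak holomorphy upgrades to norm holomorphy. -/
theorem differentiableOn_bergmanEval (hΩ : IsOpen Ω) :
    DifferentiableOn ℂ (bergmanEval Ω) Ω := by
  intro z hz
  obtain ⟨r, hr, hb⟩ := exists_closedBall_subset_of_isOpen hΩ hz
  have hbΩ : ball z r ⊆ Ω := fun w hw => hb w hw (mem_closedBall_self hr.le)
  refine (differentiableAt_clm_of_apply_of_bounded_ball
    (M := (volume.real (closedBall (0 : Fin n → ℂ) r))⁻¹ *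
      volume.real (closedBall (0 : Fin n → ℂ) r) ^ (1 / 2 : ℝ)) hr
    (fun F => ?_) fun w hw => ?_).differentiableWithinAt
  · exact ((differentiableOn_bergmanRep F).mono hbΩ).congr fun w hw =>
      bergmanEval_apply hΩ (hbΩ hw) F
  · refine ContinuousLinearMap.opNorm_le_bound _ (by positivity) fun F => ?_
    rw [bergmanEval_apply hΩ (hbΩ hw), ← ballAverage_eq (differentiableOn_bergmanRep F)
      (ae_eq_bergmanRep F) hr (hb w hw)]
    exact ContinuousLinearMap.le_of_opNorm_le _ (norm_ballAverage_le r w) _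

end BergmanSpace

/-- Conjugating a holomorphic map by conjugate linear maps on both sides gives a holomorphic map. -/
theorem DifferentiableAt.comp_semilinear {E E' F F' : Type*} [NormedAddCommGroup E]
    [NormedSpace ℂ E] [NormedAddCommGroup E'] [NormedSpace ℂ E'] [NormedAddCommGroup F]
    [NormedSpace ℂ F] [NormedAddCommGroup F'] [NormedSpace ℂ F'] {φ : E' → F'}
    (S : E →L⋆[ℂ] E') (J : F' →L⋆[ℂ] F) {x : E} (hφ : DifferentiableAt ℂ φ (S x)) :
    DifferentiableAt ℂ (fun y => J (φ (S y))) x := by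
  let L : E →L[ℂ] F := J.comp ((fderiv ℂ φ (S x)).comp S)
  have h : HasFDerivAt (fun y => J (φ (S y))) L x := by
    refine .of_isLittleO ?_
    have h1 := hφ.hasFDerivAt.isLittleO.comp_tendsto (S.continuous.tendsto x)
    have h2 : (fun y => J (φ (S y)) - J (φ (S x)) - L (y - x)) =O[𝓝 x]
        fun y => φ (S y) - φ (S x) - fderiv ℂ φ (S x) (S y - S x) := by
      refine Asymptotics.IsBigO.of_bound ‖J‖ (Eventually.of_forall fun y => ?_)
      have : J (φ (S y)) - J (φ (S x)) - L (y - x)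
          = J (φ (S y) - φ (S x) - fderiv ℂ φ (S x) (S y - S x)) := by
        simp [L]
      rw [this]
      exact J.le_opNorm _
    refine h2.trans_isLittleO (h1.trans_isBigO ?_)
    refine Asymptotics.IsBigO.of_bound ‖S‖ (Eventually.of_forall fun y => ?_)
    simp only [Function.comp_apply, ← map_sub]
    exact S.le_opNorm _
  exact h.differentiableAt

/-- The vectors are the Riesz representatives of the evaluations. Boundedness of Ω enters twice: the
constant 1 lies in the Bergman space, so no evaluation vanishes, and the coordinate functions are
bounded multipliers. Since the Riesz map is conjugate linear, holomorphy in the second variable is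
expressed after composing with `star`. -/
theorem exists_holomorphicKernel_bergman {n : ℕ} {Ω : Set (Fin n → ℂ)} (hΩ : IsOpen Ω)
    (hb : Bornology.IsBounded Ω) [CompleteSpace (bergmanSubmodule Ω)] :
    ∃ k : (Fin n → ℂ) → bergmanSubmodule Ω, HolomorphicKernel Ω k ∧
      ∀ z ∈ Ω, ∀ w ∈ Ω, bergmanKernel Ω z w = inner ℂ (k z) (k w) := by
  let k : (Fin n → ℂ) → bergmanSubmodule Ω := fun z =>
    (InnerProductSpace.toDual ℂ (bergmanSubmodule Ω)).symm (bergmanEval Ω z)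
  have hk : ∀ z ∈ Ω, ∀ F, inner ℂ (k z) F = bergmanRep F z := fun z hz F => by
    simp only [k]
    rw [InnerProductSpace.toDual_symm_apply, bergmanEval_apply hΩ hz]
  have hkSL : ∀ z, innerSL ℂ (k z) = bergmanEval Ω z := fun z => by
    ext F
    rw [innerSL_apply_apply]
    simp only [k, InnerProductSpace.toDual_symm_apply]
  obtain ⟨B, hB⟩ := hb.exists_norm_le
  have hfin : volume Ω ≠ ∞ := hb.measure_lt_top.ne
  have : IsFiniteMeasure (volume.restrict Ω) := ⟨by simpa using hfin.lt_top⟩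
  refine ⟨k, ⟨?_, ?_, ?_, ?_⟩, ?_⟩
  · intro y hy
    have hS : DifferentiableAt ℂ (bergmanEval Ω) (star y) :=
      (differentiableOn_bergmanEval hΩ).differentiableAt (hΩ.mem_nhds hy)
    let S : (Fin n → ℂ) →L⋆[ℂ] (Fin n → ℂ) :=
      { toFun := star, map_add' := star_add, map_smul' := star_smul, cont := continuous_star }
    let J : StrongDual ℂ (bergmanSubmodule Ω) →L⋆[ℂ] bergmanSubmodule Ω :=
      ((InnerProductSpace.toDual ℂ (bergmanSubmodule Ω)).symm.toContinuousLinearEquiv :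
        StrongDual ℂ (bergmanSubmodule Ω) →L⋆[ℂ] bergmanSubmodule Ω)
    have h : DifferentiableAt ℂ (fun y => J (bergmanEval Ω (S y))) y :=
      DifferentiableAt.comp_semilinear (φ := bergmanEval Ω) S J hS
    exact h.differentiableWithinAt
  · simp only [hkSL]
    exact differentiableOn_bergmanEval hΩ
  · intro z hz h0
    have h1 : (fun _ => 1 : (Fin n → ℂ) → ℂ) ∈ bergmanSpace Ω :=
      ⟨differentiableOn_const 1, memLp_const 1⟩
    have := hk z hz (toBergman h1)
    rw [bergmanRep_toBergman hΩ h1 hz, h0, inner_zero_left] at this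
    exact zero_ne_one this
  · intro j a
    refine ⟨|B| + ‖a‖, by positivity, fun F => ?_⟩
    have hbd : ∀ z ∈ Ω, ‖(z j - a) * bergmanRep F z‖ ≤ (|B| + ‖a‖) * ‖bergmanRep F z‖ := by
      intro z hz
      rw [norm_mul]
      gcongr
      refine (norm_sub_le _ _).trans ?_
      gcongr
      exact (norm_le_pi_norm z j).trans ((hB z hz).trans (le_abs_self B))
    have hd : DifferentiableOn ℂ (fun z => (z j - a) * bergmanRep F z) Ω := by
      refine DifferentiableOn.mul ?_ (differentiableOn_bergmanRep F)
      exact Differentiable.differentiableOn (by fun_prop)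
    have hae : ∀ᵐ z ∂(volume.restrict Ω), ‖(z j - a) * bergmanRep F z‖
        ≤ (|B| + ‖a‖) * ‖bergmanRep F z‖ := by
      filter_upwards [ae_restrict_mem hΩ.measurableSet] with z hz using hbd z hz
    have hg : (fun z => (z j - a) * bergmanRep F z) ∈ bergmanSpace Ω :=
      ⟨hd, (bergmanRep_memLp F).of_le_mul
        (hd.continuousOn.aestronglyMeasurable hΩ.measurableSet) hae⟩
    refine ⟨toBergman hg, ?_, fun z hz => ?_⟩
    · refine Lp.norm_le_mul_norm_of_ae_le_mul ?_
      filter_upwards [hae, ae_eq_bergmanRep F, hg.2.coeFn_toLp] with z h1 h2 h3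
      have h4 : ((toBergman hg : bergmanSubmodule Ω) : Lp ℂ 2 (volume.restrict Ω)) z
        = (z j - a) * bergmanRep F z := h3
      have h5 : ‖((toBergman hg : bergmanSubmodule Ω) : Lp ℂ 2 (volume.restrict Ω)) z‖
          ≤ (|B| + ‖a‖) * ‖(F : Lp ℂ 2 (volume.restrict Ω)) z‖ := by rwa [h4, h2]
      exact h5
    · rw [hk z hz, hk z hz, bergmanRep_toBergman hΩ hg hz]
  · intro z hz w hw
    have hrep : IsReproducingAt Ω w (bergmanRep (k w)) := by
      refine ⟨bergmanRep_mem_bergmanSpace _, fun f hf => ?_⟩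
      rw [← bergmanRep_toBergman hΩ hf hw, ← hk w hw]
      exact inner_bergman_eq_integral (ae_eq_bergmanRep _) hf.2.coeFn_toLp
    have hex : ∃ k, IsReproducingAt Ω w k := ⟨_, hrep⟩
    rw [bergmanKernel, dif_pos hex]
    obtain ⟨hmem, hrep'⟩ := hex.choose_spec
    -- `bergmanKernel` uses an arbitrary choice of representing function, but all choices define the
    -- same vector because they have the same inner products with the whole space.
    have hkw : toBergman hmem = k w := by
      refine ext_inner_right ℂ fun G => ?_
      rw [hk w hw, hrep' _ (bergmanRep_mem_bergmanSpace G)]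
      exact inner_bergman_eq_integral hmem.2.coeFn_toLp (ae_eq_bergmanRep G)
    rw [hk z hz, ← hkw, bergmanRep_toBergman hΩ hmem hz]

/-! ### Directional derivatives. -/

/-- The derivative of `f` at `z` in the complex direction `v`. -/
noncomputable def dirDeriv {E F : Type*} [NormedAddCommGroup E] [NormedSpace ℂ E]
    [NormedAddCommGroup F] [NormedSpace ℂ F] (v : E) (f : E → F) (z : E) : F := fderiv ℂ f z v

section DirDeriv

variable {E F : Type*} [NormedAddCommGroup E] [NormedSpace ℂ E]
  [NormedAddCommGroup F] [NormedSpace ℂ F] {U : Set E} {z : E}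

theorem DifferentiableOn.dirDeriv [CompleteSpace F] {f : E → F} (hf : DifferentiableOn ℂ f U)
    (hU : IsOpen U) (v : E) : DifferentiableOn ℂ (dirDeriv v f) U :=
  hf.fderiv_apply_of_isOpen hU v

theorem dirDeriv_congr {f g : E → F} (hU : IsOpen U) (h : EqOn f g U) (hz : z ∈ U) (v : E) :
    dirDeriv v f z = dirDeriv v g z := by
  have : f =ᶠ[𝓝 z] g := h.eventuallyEq_of_mem (hU.mem_nhds hz)
  rw [dirDeriv, dirDeriv, this.fderiv_eq]

theorem dirDeriv_comm [CompleteSpace F] {f : E → F} (hU : IsOpen U) (hf : DifferentiableOn ℂ f U)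
    (hz : z ∈ U) (v w : E) : dirDeriv v (dirDeriv w f) z = dirDeriv w (dirDeriv v f) z :=
  fderiv_fderiv_comm hU hf hz w v

theorem dirDeriv_const (v : E) (c : F) (z : E) : dirDeriv v (fun _ => c) z = 0 := by
  simp [dirDeriv]

theorem dirDeriv_add {f g : E → F} (hf : DifferentiableAt ℂ f z) (hg : DifferentiableAt ℂ g z)
    (v : E) : dirDeriv v (fun x => f x + g x) z = dirDeriv v f z + dirDeriv v g z := by
  simp only [dirDeriv]
  rw [fderiv_fun_add hf hg]; rfl

theorem dirDeriv_sub {f g : E → F} (hf : DifferentiableAt ℂ f z) (hg : DifferentiableAt ℂ g z)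
    (v : E) : dirDeriv v (fun x => f x - g x) z = dirDeriv v f z - dirDeriv v g z := by
  simp only [dirDeriv]
  rw [fderiv_fun_sub hf hg]; rfl

theorem dirDeriv_mul {f g : E → ℂ} (hf : DifferentiableAt ℂ f z) (hg : DifferentiableAt ℂ g z)
    (v : E) : dirDeriv v (fun x => f x * g x) z = dirDeriv v f z * g z + f z * dirDeriv v g z := by
  simp only [dirDeriv]
  rw [fderiv_fun_mul hf hg]
  simp only [add_apply, smul_apply, smul_eq_mul]
  ring

theorem dirDeriv_const_mul {f : E → ℂ} (hf : DifferentiableAt ℂ f z) (c : ℂ) (v : E) :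
    dirDeriv v (fun x => c * f x) z = c * dirDeriv v f z := by
  rw [dirDeriv_mul (differentiableAt_const c) hf, dirDeriv_const]; ring

theorem dirDeriv_sum {ι : Type*} (s : Finset ι) {f : ι → E → F}
    (hf : ∀ i ∈ s, DifferentiableAt ℂ (f i) z) (v : E) :
    dirDeriv v (fun x => ∑ i ∈ s, f i x) z = ∑ i ∈ s, dirDeriv v (f i) z := by
  simp only [dirDeriv]
  rw [fderiv_fun_sum hf]
  simp

theorem dirDeriv_comp_clm {E' : Type*} [NormedAddCommGroup E'] [NormedSpace ℂ E'] {f : E → F}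
    {g : E' → E} {z : E'} {A : E' →L[ℂ] E} (hf : DifferentiableAt ℂ f (g z))
    (hg : HasFDerivAt g A z) (v : E') : dirDeriv v (fun x => f (g x)) z = dirDeriv (A v) f (g z) := by
  simp only [dirDeriv]
  have := (hf.hasFDerivAt.comp z hg).fderiv
  simp only [Function.comp_def] at this
  rw [this]; rfl

theorem dirDeriv_comp_deriv {f : E → ℂ} {φ : ℂ → ℂ} {φ' : ℂ} (hf : DifferentiableAt ℂ f z)
    (hφ : HasDerivAt φ φ' (f z)) (v : E) :
    dirDeriv v (fun x => φ (f x)) z = φ' * dirDeriv v f z := by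
  simp only [dirDeriv]
  have := (hφ.comp_hasFDerivAt z hf.hasFDerivAt).fderiv
  simp only [Function.comp_def] at this
  rw [this]; simp

end DirDeriv

/-! ### Matrices of holomorphic functions and tensor algebra. -/

section Matrix

variable {E : Type*} [NormedAddCommGroup E] [NormedSpace ℂ E] {U : Set E} {ι : Type*} [Fintype ι]
  [DecidableEq ι]

theorem DifferentiableOn.matrix_det {G : E → Matrix ι ι ℂ}
    (hG : ∀ i j, DifferentiableOn ℂ (fun z => G z i j) U) :
    DifferentiableOn ℂ (fun z => (G z).det) U := by
  simp only [Matrix.det_apply]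
  refine DifferentiableOn.fun_sum fun σ _ => ?_
  refine DifferentiableOn.const_smul ?_ _
  intro z hz
  exact (HasFDerivWithinAt.finsetProd (u := Finset.univ) fun i _ =>
    (hG (σ i) i z hz).hasFDerivWithinAt).differentiableWithinAt

theorem DifferentiableOn.matrix_inv_apply {G : E → Matrix ι ι ℂ}
    (hG : ∀ i j, DifferentiableOn ℂ (fun z => G z i j) U) (hdet : ∀ z ∈ U, (G z).det ≠ 0) (i j : ι) :
    DifferentiableOn ℂ (fun z => (G z)⁻¹ i j) U := by
  simp only [Matrix.inv_def, Ring.inverse_eq_inv', Matrix.smul_apply, smul_eq_mul,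
    Matrix.adjugate_apply]
  refine ((DifferentiableOn.matrix_det hG).inv hdet).mul (DifferentiableOn.matrix_det fun k l => ?_)
  by_cases h : k = j
  · subst h
    simp only [Matrix.updateRow_self]
    exact differentiableOn_const _
  · simp only [Matrix.updateRow_ne h]
    exact hG k l

end Matrix

section Algebra

variable {ι : Type*} [Fintype ι] [DecidableEq ι]

/-- Polarization: the symmetric bilinear form is recovered from its values at `a + b`, `a` and `b`.
-/
theorem eq_zero_of_quadratic_eq_zero {Q : ι → ι → ℂ} (hs : ∀ i k, Q i k = Q k i)
    (h : ∀ a : ι → ℂ, ∑ i, ∑ k, Q i k * a i * a k = 0) (i k : ι) : Q i k = 0 := by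
  have hb : ∀ a b : ι → ℂ, ∑ i, ∑ k, Q i k * a i * b k = 0 := by
    intro a b
    have h1 := h (a + b)
    have h2 := h a
    have h3 := h b
    have h4 : ∑ i, ∑ k, Q i k * b i * a k = ∑ i, ∑ k, Q i k * a i * b k := by
      rw [Finset.sum_comm]
      refine Finset.sum_congr rfl fun i _ => Finset.sum_congr rfl fun k _ => ?_
      rw [hs k i]; ring
    have h5 : ∑ i, ∑ k, Q i k * (a + b) i * (a + b) k
        = ∑ i, ∑ k, Q i k * a i * a k + ∑ i, ∑ k, Q i k * a i * b k
          + ∑ i, ∑ k, Q i k * b i * a k + ∑ i, ∑ k, Q i k * b i * b k := by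
      simp only [← Finset.sum_add_distrib]
      refine Finset.sum_congr rfl fun i _ => Finset.sum_congr rfl fun k _ => ?_
      simp only [Pi.add_apply]; ring
    rw [h5, h2, h3, h4] at h1
    linear_combination h1 / 2
  have := hb (Pi.single i 1) (Pi.single k 1)
  simpa [Pi.single_apply] using this

/-- A tensor with the symmetries of a Kähler curvature tensor is determined by its biquadratic
form. -/
theorem eq_zero_of_biquadratic_eq_zero {T : ι → ι → ι → ι → ℂ} (h1 : ∀ i j k l, T i j k l = T k j i l)
    (h2 : ∀ i j k l, T i j k l = T i l k j)
    (h : ∀ a b : ι → ℂ, ∑ i, ∑ j, ∑ k, ∑ l, T i j k l * a i * b j * a k * b l = 0)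
    (i j k l : ι) : T i j k l = 0 := by
  -- With `b` fixed the expression is a quadratic form in `a`, whose coefficients are in turn
  -- quadratic forms in `b`.
  have key : ∀ b : ι → ℂ, ∀ i k, ∑ j, ∑ l, T i j k l * b j * b l = 0 := by
    intro b
    refine eq_zero_of_quadratic_eq_zero (fun i k => ?_) fun a => ?_
    · exact Finset.sum_congr rfl fun j _ => Finset.sum_congr rfl fun l _ => by rw [h1]
    · rw [← h a b]
      refine Finset.sum_congr rfl fun i _ => ?_
      simp only [Finset.sum_mul]
      rw [Finset.sum_comm]
      refine Finset.sum_congr rfl fun j _ => Finset.sum_congr rfl fun k _ =>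
        Finset.sum_congr rfl fun l _ => ?_
      ring
  exact eq_zero_of_quadratic_eq_zero (Q := fun j l => T i j k l) (fun j l => h2 i j k l)
    (fun b => key b i k) j l

end Algebra

/-! ### Uniqueness for first and second order systems in product coordinates. -/

section Uniqueness

variable {n : ℕ}

/-- The `i`-th coordinate direction of the first factor. -/
def dirFst (i : Fin n) : (Fin n → ℂ) × (Fin n → ℂ) := (Pi.single i 1, 0)

/-- The `j`-th coordinate direction of the second factor. -/
def dirSnd (j : Fin n) : (Fin n → ℂ) × (Fin n → ℂ) := (0, Pi.single j 1)

theorem sum_smul_dirFst (a : Fin n → ℂ) : ∑ i, a i • dirFst i = (a, 0) := by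
  ext j <;> simp [dirFst, Prod.fst_sum, Prod.snd_sum, Finset.sum_apply, Pi.single_apply]

theorem sum_smul_dirSnd (a : Fin n → ℂ) : ∑ i, a i • dirSnd i = (0, a) := by
  ext j <;> simp [dirSnd, Prod.fst_sum, Prod.snd_sum, Finset.sum_apply, Pi.single_apply]

theorem fderiv_fst_eq_sum {F : Type*} [NormedAddCommGroup F] [NormedSpace ℂ F]
    (f : (Fin n → ℂ) × (Fin n → ℂ) → F) (z) (a : Fin n → ℂ) :
    fderiv ℂ f z (a, 0) = ∑ i, a i • dirDeriv (dirFst i) f z := by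
  rw [← sum_smul_dirFst, map_sum]; simp [dirDeriv]

theorem fderiv_snd_eq_sum {F : Type*} [NormedAddCommGroup F] [NormedSpace ℂ F]
    (f : (Fin n → ℂ) × (Fin n → ℂ) → F) (z) (a : Fin n → ℂ) :
    fderiv ℂ f z (0, a) = ∑ i, a i • dirDeriv (dirSnd i) f z := by
  rw [← sum_smul_dirSnd, map_sum]; simp [dirDeriv]

theorem mem_ball_mk {p q x y : Fin n → ℂ} {r : ℝ} :
    (x, y) ∈ ball (p, q) r ↔ x ∈ ball p r ∧ y ∈ ball q r := by
  rw [← ball_prod_same]; rfl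

theorem eq_zero_of_dirSnd_eq_zero {p q : Fin n → ℂ} {r : ℝ} {f : (Fin n → ℂ) × (Fin n → ℂ) → ℂ}
    (hf : DifferentiableOn ℂ f (ball (p, q) r))
    (h : ∀ l, ∀ z ∈ ball (p, q) r, dirDeriv (dirSnd l) f z = 0)
    (h0 : ∀ x ∈ ball p r, f (x, q) = 0) : ∀ z ∈ ball (p, q) r, f z = 0 := by
  rintro ⟨x, y⟩ hz
  obtain ⟨hx, hy⟩ := mem_ball_mk.mp hz
  have hr : 0 < r := nonempty_ball.mp ⟨_, hx⟩
  have hg : ∀ y ∈ ball q r, HasFDerivAt (fun y => f (x, y)) (0 : (Fin n → ℂ) →L[ℂ] ℂ) y := by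
    intro y hy
    have hxy : (x, y) ∈ ball (p, q) r := mem_ball_mk.mpr ⟨hx, hy⟩
    have h1 := (hf.differentiableAt (isOpen_ball.mem_nhds hxy)).hasFDerivAt.comp y
      (hasFDerivAt_prodMk_right x y)
    refine h1.congr_fderiv (ContinuousLinearMap.ext fun v => ?_)
    have h2 := fderiv_snd_eq_sum f (x, y) v
    simp only [h _ _ hxy, smul_zero, Finset.sum_const_zero] at h2
    exact h2
  rw [← h0 x hx]
  exact isOpen_ball.is_const_of_fderiv_eq_zero (convex_ball q r).isPreconnected
    (fun y hy => (hg y hy).differentiableAt.differentiableWithinAt)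
    (fun y hy => (hg y hy).fderiv) hy (mem_ball_self hr)

/-- Uniqueness for the overdetermined linear system `∂ᵢ∂ₖf = ∑ₚ Γᵖᵢₖ ∂ₚf`. -/
theorem eq_zero_of_second_order_system {p q y : Fin n → ℂ} {r : ℝ}
    {f : (Fin n → ℂ) × (Fin n → ℂ) → ℂ} {Γ : Fin n → Fin n → Fin n → (Fin n → ℂ) → ℂ}
    (hy : y ∈ ball q r)
    (hf : DifferentiableOn ℂ f (ball (p, q) r)) (hΓ : ∀ s i k, ContinuousOn (Γ s i k) (ball p r))
    (h : ∀ i k, ∀ x ∈ ball p r, dirDeriv (dirFst k) (dirDeriv (dirFst i) f) (x, y)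
      = ∑ s, Γ s i k x * dirDeriv (dirFst s) f (x, y))
    (h0 : f (p, y) = 0) (h1 : ∀ i, dirDeriv (dirFst i) f (p, y) = 0) :
    ∀ x ∈ ball p r, f (x, y) = 0 := by
  intro x hx
  have hr : 0 < r := nonempty_ball.mp ⟨_, hx⟩
  set a := x - p with ha
  let γ : ℝ → Fin n → ℂ := fun t => p + t • a
  have hγc : Continuous γ := by fun_prop
  have hγ : ∀ t ∈ Icc (0 : ℝ) 1, γ t ∈ ball p r := by
    intro t ht
    rw [mem_ball, dist_eq_norm] at hx ⊢
    simp only [γ, add_sub_cancel_left, norm_smul, Real.norm_of_nonneg ht.1]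
    nlinarith [norm_nonneg a, ht.1, ht.2]
  have hγB : ∀ t ∈ Icc (0 : ℝ) 1, (γ t, y) ∈ ball (p, q) r := fun t ht =>
    mem_ball_mk.mpr ⟨hγ t ht, hy⟩
  have hder : ∀ g : (Fin n → ℂ) × (Fin n → ℂ) → ℂ, DifferentiableOn ℂ g (ball (p, q) r) →
      ∀ t ∈ Icc (0 : ℝ) 1, HasDerivAt (fun t => g (γ t, y))
        (∑ k, a k * dirDeriv (dirFst k) g (γ t, y)) t := by
    intro g hg t ht
    have hg1 := (hg.differentiableAt (isOpen_ball.mem_nhds (hγB t ht))).hasFDerivAt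
    have hg2 := hg1.restrictScalars ℝ
    have hγ' : HasDerivAt (fun t => (γ t, y)) (a, 0) t := by
      refine HasDerivAt.prodMk ?_ (hasDerivAt_const _ _)
      have := ((hasDerivAt_id t).smul_const a).const_add p
      rw [one_smul] at this
      exact this
    have := hg2.comp_hasDerivAt t hγ'
    refine this.congr_deriv ?_
    simp only [ContinuousLinearMap.coe_restrictScalars']
    rw [fderiv_fst_eq_sum]
    simp
  obtain ⟨C, hC0, hC⟩ : ∃ C : ℝ, 0 ≤ C ∧ ∀ s i k, ∀ t ∈ Icc (0 : ℝ) 1, ‖Γ s i k (γ t)‖ ≤ C := by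
    have : ∀ s i k, ∃ C : ℝ, ∀ t ∈ Icc (0 : ℝ) 1, ‖Γ s i k (γ t)‖ ≤ C := fun s i k =>
      isCompact_Icc.exists_bound_of_continuousOn ((hΓ s i k).comp hγc.continuousOn hγ)
    choose C hC using this
    refine ⟨∑ s, ∑ i, ∑ k, |C s i k|, by positivity, fun s i k t ht => ?_⟩
    refine (hC s i k t ht).trans ((le_abs_self _).trans ?_)
    refine le_trans ?_ (Finset.single_le_sum (f := fun s => ∑ i, ∑ k, |C s i k|)
      (fun _ _ => by positivity) (Finset.mem_univ s))
    refine le_trans ?_ (Finset.single_le_sum (f := fun i => ∑ k, |C s i k|)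
      (fun _ _ => by positivity) (Finset.mem_univ i))
    exact Finset.single_le_sum (f := fun k => |C s i k|)
      (fun _ _ => by positivity) (Finset.mem_univ k)
  -- Along the segment from `p` to `x`, the pair of `f` and its first derivatives satisfies a linear
  -- ODE with bounded coefficients and zero initial value, so Gronwall's inequality makes it vanish.
  let u : ℝ → ℂ × (Fin n → ℂ) := fun t =>
    (f (γ t, y), fun i => dirDeriv (dirFst i) f (γ t, y))
  let u' : ℝ → ℂ × (Fin n → ℂ) := fun t =>
    (∑ k, a k * dirDeriv (dirFst k) f (γ t, y),
      fun i => ∑ k, a k * ∑ s, Γ s i k (γ t) * dirDeriv (dirFst s) f (γ t, y))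
  have hu : ∀ t ∈ Icc (0 : ℝ) 1, HasDerivAt u (u' t) t := by
    intro t ht
    refine (hder f hf t ht).prodMk (hasDerivAt_pi.mpr fun i => ?_)
    refine (hder _ (hf.dirDeriv isOpen_ball _) t ht).congr_deriv ?_
    exact Finset.sum_congr rfl fun k _ => by rw [h i k _ (hγ t ht)]
  have hbound : ∀ t ∈ Icc (0 : ℝ) 1, ‖u' t‖ ≤ (n * ‖a‖ + n * (‖a‖ * (n * C))) * ‖u t‖ + 0 := by
    intro t ht
    have hcomp : ∀ s, ‖dirDeriv (dirFst s) f (γ t, y)‖ ≤ ‖u t‖ := fun s =>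
      (norm_le_pi_norm (u t).2 s).trans (norm_snd_le _)
    have hsum : ∀ i k, ‖∑ s, Γ s i k (γ t) * dirDeriv (dirFst s) f (γ t, y)‖ ≤ n * C * ‖u t‖ := by
      intro i k
      refine (norm_sum_le _ _).trans ?_
      calc _ ≤ ∑ _s : Fin n, C * ‖u t‖ := Finset.sum_le_sum fun s _ => by
            rw [norm_mul]
            exact mul_le_mul (hC s i k t ht) (hcomp s) (norm_nonneg _) hC0
        _ = _ := by simp; ring
    rw [add_zero, Prod.norm_def]
    refine max_le ?_ ?_
    · refine (norm_sum_le Finset.univ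
        fun k => a k * dirDeriv (dirFst k) f (γ t, y)).trans ?_
      calc _ ≤ ∑ _k : Fin n, ‖a‖ * ‖u t‖ := Finset.sum_le_sum fun k _ => by
            rw [norm_mul]
            exact mul_le_mul (norm_le_pi_norm a k) (hcomp k) (norm_nonneg _) (norm_nonneg _)
        _ = n * ‖a‖ * ‖u t‖ := by simp; ring
        _ ≤ _ := by gcongr; linarith [show 0 ≤ n * (‖a‖ * (n * C)) by positivity]
    · refine (pi_norm_le_iff_of_nonneg (by positivity)).mpr fun i => ?_
      refine (norm_sum_le Finset.univ fun k => a k * ∑ s, Γ s i k (γ t) *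
        dirDeriv (dirFst s) f (γ t, y)).trans ?_
      calc _ ≤ ∑ _k : Fin n, ‖a‖ * (n * C * ‖u t‖) := Finset.sum_le_sum fun k _ => by
            rw [norm_mul]
            exact mul_le_mul (norm_le_pi_norm a k) (hsum i k) (norm_nonneg _) (norm_nonneg _)
        _ = n * (‖a‖ * (n * C)) * ‖u t‖ := by simp; ring
        _ ≤ _ := by gcongr; linarith [show 0 ≤ n * ‖a‖ by positivity]
  have hu0 : ‖u 0‖ ≤ 0 := by
    have : u 0 = 0 := by
      simp only [u, γ, zero_smul, add_zero, h0, h1]; rfl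
    simp [this]
  have := norm_le_gronwallBound_of_norm_deriv_right_le
    (fun t ht => (hu t ht).continuousAt.continuousWithinAt)
    (fun t ht => (hu t (Ico_subset_Icc_self ht)).hasDerivWithinAt) hu0
    (fun t ht => hbound t (Ico_subset_Icc_self ht)) 1 (right_mem_Icc.mpr zero_le_one)
  rw [gronwallBound_ε0_δ0] at this
  have h2 : f (γ 1, y) = 0 := norm_le_zero_iff.mp ((norm_fst_le (u 1)).trans this)
  simpa [γ, ha] using h2

end Uniqueness

/-! ### Normal form of a potential with constant curvature. -/

section NormalForm

variable {n : ℕ} {p q : Fin n → ℂ} {r : ℝ}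

/-- The matrix of mixed second derivatives `∂²f/∂xᵢ∂yⱼ`. -/
noncomputable def mixedHessian (f : (Fin n → ℂ) × (Fin n → ℂ) → ℂ)
    (z : (Fin n → ℂ) × (Fin n → ℂ)) : Matrix (Fin n) (Fin n) ℂ :=
  Matrix.of fun i j => dirDeriv (dirFst i) (dirDeriv (dirSnd j) f) z

theorem dirFst_eq_zero_of_slice {f : (Fin n → ℂ) × (Fin n → ℂ) → ℂ}
    (hf : DifferentiableOn ℂ f (ball (p, q) r)) {y : Fin n → ℂ} (hy : y ∈ ball q r)
    (h : ∀ x ∈ ball p r, f (x, y) = 0) (k : Fin n) :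
    ∀ x ∈ ball p r, dirDeriv (dirFst k) f (x, y) = 0 := by
  intro x hx
  have hxy : (x, y) ∈ ball (p, q) r := mem_ball_mk.mpr ⟨hx, hy⟩
  have h1 : HasFDerivAt (f ∘ fun x => (x, y)) _ x :=
    (hf.differentiableAt (isOpen_ball.mem_nhds hxy)).hasFDerivAt.comp (f := fun x => (x, y)) x
      (hasFDerivAt_prodMk_left x y)
  have h2 : HasFDerivAt (f ∘ fun x => (x, y)) (0 : (Fin n → ℂ) →L[ℂ] ℂ) x := by
    refine (hasFDerivAt_const (0 : ℂ) x).congr_of_eventuallyEq ?_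
    filter_upwards [isOpen_ball.mem_nhds hx] with w hw using h w hw
  exact congrArg (fun A : (Fin n → ℂ) →L[ℂ] ℂ => A (Pi.single k 1)) (h1.unique h2)

theorem hasFDerivAt_fst_slice (z : (Fin n → ℂ) × (Fin n → ℂ)) :
    HasFDerivAt (fun z : (Fin n → ℂ) × (Fin n → ℂ) => (z.1, q))
      ((ContinuousLinearMap.fst ℂ (Fin n → ℂ) (Fin n → ℂ)).prod 0) z :=
  hasFDerivAt_fst.prodMk (hasFDerivAt_const q z)

theorem slice_mem_ball {z : (Fin n → ℂ) × (Fin n → ℂ)} (hz : z ∈ ball (p, q) r) :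
    (z.1, q) ∈ ball (p, q) r := by
  have hr : 0 < r := nonempty_ball.mp ⟨_, hz⟩
  exact mem_ball_mk.mpr ⟨(mem_ball_mk.mp (show (z.1, z.2) ∈ _ from hz)).1, mem_ball_self hr⟩

theorem DifferentiableOn.comp_slice {f : (Fin n → ℂ) × (Fin n → ℂ) → ℂ}
    (hf : DifferentiableOn ℂ f (ball (p, q) r)) :
    DifferentiableOn ℂ (fun z => f (z.1, q)) (ball (p, q) r) :=
  hf.comp (fun z _ => (hasFDerivAt_fst_slice z).differentiableAt.differentiableWithinAt)
    fun _ hz => slice_mem_ball hz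

theorem dirDeriv_dirFst_comp_slice {f : (Fin n → ℂ) × (Fin n → ℂ) → ℂ}
    (hf : DifferentiableOn ℂ f (ball (p, q) r)) {z : (Fin n → ℂ) × (Fin n → ℂ)}
    (hz : z ∈ ball (p, q) r) (k : Fin n) :
    dirDeriv (dirFst k) (fun z => f (z.1, q)) z = dirDeriv (dirFst k) f (z.1, q) :=
  dirDeriv_comp_clm (g := fun z : (Fin n → ℂ) × (Fin n → ℂ) => (z.1, q))
    (hf.differentiableAt (isOpen_ball.mem_nhds (slice_mem_ball hz)))
    (hasFDerivAt_fst_slice z) _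

theorem dirDeriv_dirSnd_comp_slice {f : (Fin n → ℂ) × (Fin n → ℂ) → ℂ}
    (hf : DifferentiableOn ℂ f (ball (p, q) r)) {z : (Fin n → ℂ) × (Fin n → ℂ)}
    (hz : z ∈ ball (p, q) r) (k : Fin n) :
    dirDeriv (dirSnd k) (fun z => f (z.1, q)) z = 0 := by
  rw [dirDeriv_comp_clm (g := fun z : (Fin n → ℂ) × (Fin n → ℂ) => (z.1, q))
    (hf.differentiableAt (isOpen_ball.mem_nhds (slice_mem_ball hz)))
    (hasFDerivAt_fst_slice z)]
  exact map_zero (fderiv ℂ f (z.1, q))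

variable {D : (Fin n → ℂ) × (Fin n → ℂ) → ℂ} {lam : ℂ}

/-- The curvature of the (polarized) Kähler metric with potential `D` is the one of a space of
constant holomorphic sectional curvature `2 * lam`. -/
def HasConstantCurvatureOn (D : (Fin n → ℂ) × (Fin n → ℂ) → ℂ) (lam : ℂ)
    (U : Set ((Fin n → ℂ) × (Fin n → ℂ))) : Prop :=
  ∀ z ∈ U, ∀ i j k l,
    - dirDeriv (dirFst k) (dirDeriv (dirSnd l) fun z => mixedHessian D z i j) z
      + ∑ s, ∑ t, (mixedHessian D z)⁻¹ t s * dirDeriv (dirFst k) (fun z => mixedHessian D z i t) z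
        * dirDeriv (dirSnd l) (fun z => mixedHessian D z s j) z
    = lam * (mixedHessian D z i j * mixedHessian D z k l
        + mixedHessian D z i l * mixedHessian D z k j)

theorem differentiableOn_mixedHessian {U : Set ((Fin n → ℂ) × (Fin n → ℂ))} (hU : IsOpen U)
    (hD : DifferentiableOn ℂ D U) (i j : Fin n) :
    DifferentiableOn ℂ (fun z => mixedHessian D z i j) U :=
  (hD.dirDeriv hU _).dirDeriv hU _

/-- The Christoffel symbols of the polarized metric. -/
noncomputable def christoffel (D : (Fin n → ℂ) × (Fin n → ℂ) → ℂ) (s i k : Fin n)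
    (z : (Fin n → ℂ) × (Fin n → ℂ)) : ℂ :=
  ∑ t, dirDeriv (dirFst k) (fun z => mixedHessian D z i t) z * (mixedHessian D z)⁻¹ t s

theorem differentiableOn_christoffel (hD : DifferentiableOn ℂ D (ball (p, q) r))
    (hdet : ∀ z ∈ ball (p, q) r, (mixedHessian D z).det ≠ 0) (s i k : Fin n) :
    DifferentiableOn ℂ (christoffel D s i k) (ball (p, q) r) :=
  DifferentiableOn.fun_sum fun t _ =>
    ((differentiableOn_mixedHessian isOpen_ball hD i t).dirDeriv isOpen_ball _).mul
      (DifferentiableOn.matrix_inv_apply (differentiableOn_mixedHessian isOpen_ball hD) hdet t s)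

theorem dirDeriv_mixedHessian_eq_christoffel
    {z : (Fin n → ℂ) × (Fin n → ℂ)} (hdet : (mixedHessian D z).det ≠ 0) (i k t : Fin n) :
    dirDeriv (dirFst k) (fun z => mixedHessian D z i t) z
      = ∑ s, christoffel D s i k z * mixedHessian D z s t := by
  have hu : IsUnit (mixedHessian D z).det := hdet.isUnit
  set v : Fin n → ℂ := fun t => dirDeriv (dirFst k) (fun z => mixedHessian D z i t) z with hv
  have h1 : Matrix.vecMul (Matrix.vecMul v (mixedHessian D z)⁻¹) (mixedHessian D z) = v := by
    rw [Matrix.vecMul_vecMul, Matrix.nonsing_inv_mul _ hu, Matrix.vecMul_one]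
  exact (congrFun h1 t).symm

/-- Differentiating ∂ₖGᵢⱼ = ∑ Γˢᵢₖ Gₛⱼ in y shows that the curvature tensor is -∑ (∂Γˢᵢₖ/∂yₗ) Gₛⱼ.
The constant curvature equation then determines ∂Γ/∂yₗ because G is invertible. -/
theorem dirSnd_christoffel (hD : DifferentiableOn ℂ D (ball (p, q) r))
    (hdet : ∀ z ∈ ball (p, q) r, (mixedHessian D z).det ≠ 0)
    (hcurv : HasConstantCurvatureOn D lam (ball (p, q) r)) (s i k l : Fin n) :
    ∀ z ∈ ball (p, q) r, dirDeriv (dirSnd l) (christoffel D s i k) z =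
      - lam * ((if i = s then mixedHessian D z k l else 0)
        + if k = s then mixedHessian D z i l else 0) := by
  intro z hz
  have hnhds : ball (p, q) r ∈ 𝓝 z := isOpen_ball.mem_nhds hz
  have hG := differentiableOn_mixedHessian isOpen_ball hD
  have hΓ := differentiableOn_christoffel hD hdet
  -- `u` is the difference of the two sides; it is shown to be annihilated by the invertible metric
  -- matrix.
  let u : Fin n → ℂ := fun s => dirDeriv (dirSnd l) (christoffel D s i k) z
    + lam * ((if i = s then mixedHessian D z k l else 0)
        + if k = s then mixedHessian D z i l else 0)
  have hu : Matrix.vecMul u (mixedHessian D z) = 0 := by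
    ext j
    have h1 : dirDeriv (dirSnd l) (dirDeriv (dirFst k) fun z => mixedHessian D z i j) z
        = ∑ s, (dirDeriv (dirSnd l) (christoffel D s i k) z * mixedHessian D z s j
          + christoffel D s i k z * dirDeriv (dirSnd l) (fun z => mixedHessian D z s j) z) := by
      rw [dirDeriv_congr (g := fun z => ∑ s, christoffel D s i k z * mixedHessian D z s j)
        isOpen_ball (fun z hz => dirDeriv_mixedHessian_eq_christoffel (hdet z hz) i k j) hz,
        dirDeriv_sum]
      · refine Finset.sum_congr rfl fun s _ => ?_
        exact dirDeriv_mul ((hΓ s i k).differentiableAt hnhds) ((hG s j).differentiableAt hnhds) _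
      · exact fun s _ => ((hΓ s i k).mul (hG s j)).differentiableAt hnhds
    have h2 := hcurv z hz i j k l
    rw [dirDeriv_comm isOpen_ball (hG i j) hz, h1] at h2
    have h3 : ∑ s, ∑ t, (mixedHessian D z)⁻¹ t s
        * dirDeriv (dirFst k) (fun z => mixedHessian D z i t) z
        * dirDeriv (dirSnd l) (fun z => mixedHessian D z s j) z
        = ∑ s, christoffel D s i k z * dirDeriv (dirSnd l) (fun z => mixedHessian D z s j) z := by
      refine Finset.sum_congr rfl fun s _ => ?_
      rw [christoffel, Finset.sum_mul]
      exact Finset.sum_congr rfl fun t _ => by ring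
    rw [h3, Finset.sum_add_distrib] at h2
    simp only [Matrix.vecMul, dotProduct, u, Pi.zero_apply, add_mul, mul_add, ite_mul, mul_ite,
      zero_mul, mul_zero, Finset.sum_add_distrib, Finset.sum_ite_eq, Finset.mem_univ, if_true]
    linear_combination - h2
  have := congrFun (Matrix.eq_zero_of_vecMul_eq_zero (hdet z hz) hu) s
  simp only [u, Pi.zero_apply] at this
  linear_combination this

/-- This is the preceding formula integrated in y: a metric coefficient is the y-derivative of
∂D/∂xₖ, and the x-derivatives of `D` vanish on the slice y = q. -/
theorem christoffel_eq_slice (hD : DifferentiableOn ℂ D (ball (p, q) r))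
    (hDq : ∀ x ∈ ball p r, D (x, q) = 0)
    (hdet : ∀ z ∈ ball (p, q) r, (mixedHessian D z).det ≠ 0)
    (hcurv : HasConstantCurvatureOn D lam (ball (p, q) r)) (s i k : Fin n) :
    ∀ z ∈ ball (p, q) r, christoffel D s i k z = christoffel D s i k (z.1, q)
      - lam * ((if i = s then dirDeriv (dirFst k) D z else 0)
        + if k = s then dirDeriv (dirFst i) D z else 0) := by
  intro z hz
  have hr : 0 < r := nonempty_ball.mp ⟨_, hz⟩
  have hΓ := differentiableOn_christoffel hD hdet
  have hd : ∀ (c : Prop) [Decidable c] (k : Fin n), DifferentiableOn ℂ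
      (fun z => if c then dirDeriv (dirFst k) D z else 0) (ball (p, q) r) := by
    intro c _ k
    split_ifs
    · exact hD.dirDeriv isOpen_ball _
    · exact differentiableOn_const 0
  have hdd : ∀ (c : Prop) [Decidable c] (k l : Fin n), ∀ z ∈ ball (p, q) r,
      dirDeriv (dirSnd l) (fun z => if c then dirDeriv (dirFst k) D z else 0) z
        = if c then mixedHessian D z k l else 0 := by
    intro c _ k l z hz
    split_ifs
    · exact dirDeriv_comm isOpen_ball hD hz _ _
    · exact dirDeriv_const _ _ _
  have hsl := fun k => dirFst_eq_zero_of_slice hD (mem_ball_self hr) hDq k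
  have hsum := ((hd (i = s) k).fun_add (hd (k = s) i)).const_mul lam
  have := eq_zero_of_dirSnd_eq_zero (f := fun z => (christoffel D s i k z
      - christoffel D s i k (z.1, q)) + lam * ((if i = s then dirDeriv (dirFst k) D z else 0)
        + if k = s then dirDeriv (dirFst i) D z else 0))
    (((hΓ s i k).fun_sub (hΓ s i k).comp_slice).fun_add hsum) ?_ ?_ z hz
  · linear_combination this
  · intro l z hz
    have hn : ball (p, q) r ∈ 𝓝 z := isOpen_ball.mem_nhds hz
    rw [dirDeriv_add (((hΓ s i k).fun_sub (hΓ s i k).comp_slice).differentiableAt hn)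
      (hsum.differentiableAt hn), dirDeriv_sub ((hΓ s i k).differentiableAt hn)
      ((hΓ s i k).comp_slice.differentiableAt hn), dirDeriv_dirSnd_comp_slice (hΓ s i k) hz,
      dirDeriv_const_mul (((hd (i = s) k).fun_add (hd (k = s) i)).differentiableAt hn),
      dirDeriv_add ((hd (i = s) k).differentiableAt hn) ((hd (k = s) i).differentiableAt hn),
      hdd _ _ _ z hz, hdd _ _ _ z hz, dirSnd_christoffel hD hdet hcurv s i k l z hz]
    ring
  · intro x hx
    simp [hsl _ x hx]

/-- Both sides vanish on the slice y = q. Their y-derivatives agree because ∂ₖGᵢₗ = ∑ Γˢᵢₖ Gₛₗ and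
the y-dependent part of Γ produces exactly the derivative of the quadratic term. -/
theorem second_derivative_eq (hD : DifferentiableOn ℂ D (ball (p, q) r))
    (hDq : ∀ x ∈ ball p r, D (x, q) = 0)
    (hdet : ∀ z ∈ ball (p, q) r, (mixedHessian D z).det ≠ 0)
    (hcurv : HasConstantCurvatureOn D lam (ball (p, q) r)) (i k : Fin n) :
    ∀ z ∈ ball (p, q) r, dirDeriv (dirFst k) (dirDeriv (dirFst i) D) z
      + lam * (dirDeriv (dirFst i) D z * dirDeriv (dirFst k) D z)
      = ∑ s, christoffel D s i k (z.1, q) * dirDeriv (dirFst s) D z := by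
  intro z hz
  have hr : 0 < r := nonempty_ball.mp ⟨_, hz⟩
  have hΓ := differentiableOn_christoffel hD hdet
  have hD1 : ∀ i, DifferentiableOn ℂ (dirDeriv (dirFst i) D) (ball (p, q) r) := fun i =>
    hD.dirDeriv isOpen_ball _
  have hD2 := (hD1 i).dirDeriv isOpen_ball (dirFst k)
  have hG : ∀ i l, ∀ z ∈ ball (p, q) r, dirDeriv (dirSnd l) (dirDeriv (dirFst i) D) z
      = mixedHessian D z i l := fun i l z hz => dirDeriv_comm isOpen_ball hD hz _ _
  have hsl := fun k => dirFst_eq_zero_of_slice hD (mem_ball_self hr) hDq k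
  have hsl2 := dirFst_eq_zero_of_slice (hD1 i) (mem_ball_self hr) (hsl i) k
  have hA := ((hD1 i).fun_mul (hD1 k)).const_mul lam
  have hS : ∀ s ∈ Finset.univ, DifferentiableOn ℂ
      (fun z : (Fin n → ℂ) × (Fin n → ℂ) => christoffel D s i k (z.1, q)
        * dirDeriv (dirFst s) D z) (ball (p, q) r) :=
    fun s _ => (hΓ s i k).comp_slice.mul (hD1 s)
  have hSS := DifferentiableOn.fun_sum hS
  have := eq_zero_of_dirSnd_eq_zero (f := fun z => (dirDeriv (dirFst k) (dirDeriv (dirFst i) D) z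
      + lam * (dirDeriv (dirFst i) D z * dirDeriv (dirFst k) D z))
      - ∑ s, christoffel D s i k (z.1, q) * dirDeriv (dirFst s) D z)
    ((hD2.fun_add hA).sub hSS) ?_ ?_ z hz
  · linear_combination this
  · intro l z hz
    have hn : ball (p, q) r ∈ 𝓝 z := isOpen_ball.mem_nhds hz
    rw [dirDeriv_sub ((hD2.fun_add hA).differentiableAt hn) (hSS.differentiableAt hn),
      dirDeriv_add (hD2.differentiableAt hn) (hA.differentiableAt hn),
      dirDeriv_const_mul (((hD1 i).fun_mul (hD1 k)).differentiableAt hn),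
      dirDeriv_mul ((hD1 i).differentiableAt hn) ((hD1 k).differentiableAt hn),
      hG _ _ z hz, hG _ _ z hz, dirDeriv_sum _ fun s hs => (hS s hs).differentiableAt hn,
      dirDeriv_comm isOpen_ball (hD1 i) hz,
      dirDeriv_congr isOpen_ball (hG i l) hz, dirDeriv_mixedHessian_eq_christoffel (hdet z hz)]
    have h1 : ∀ s, dirDeriv (dirSnd l) (fun z : (Fin n → ℂ) × (Fin n → ℂ) =>
        christoffel D s i k (z.1, q) * dirDeriv (dirFst s) D z) z
        = christoffel D s i k (z.1, q) * mixedHessian D z s l := by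
      intro s
      rw [dirDeriv_mul ((hΓ s i k).comp_slice.differentiableAt hn) ((hD1 s).differentiableAt hn),
        dirDeriv_dirSnd_comp_slice (hΓ s i k) hz, hG _ _ z hz]
      ring
    simp only [h1]
    simp only [christoffel_eq_slice hD hDq hdet hcurv _ i k z hz, sub_mul, mul_add, add_mul,
      mul_ite, ite_mul, mul_zero, zero_mul, Finset.sum_sub_distrib, Finset.sum_add_distrib,
      Finset.sum_ite_eq, Finset.mem_univ, if_true]
    ring
  · intro x hx
    simp [hsl _ x hx, hsl2 x hx]

/-- A potential of constant holomorphic sectional curvature, vanishing on `{p} × · ` and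
`· × {q}`, is a function of a bilinear expression in its first derivatives there. -/
theorem normalForm_of_hasConstantCurvatureOn (hD : DifferentiableOn ℂ D (ball (p, q) r))
    (hDq : ∀ x ∈ ball p r, D (x, q) = 0) (hDp : ∀ y ∈ ball q r, D (p, y) = 0)
    (hdet : ∀ z ∈ ball (p, q) r, (mixedHessian D z).det ≠ 0)
    (hcurv : HasConstantCurvatureOn D lam (ball (p, q) r)) {e : ℂ → ℂ} (he0 : e 0 = 0)
    (he : ∀ d, HasDerivAt e (Complex.exp (lam * d)) d) {x y : Fin n → ℂ} (hx : x ∈ ball p r)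
    (hy : y ∈ ball q r) :
    e (D (x, y)) = ∑ s, ∑ t, dirDeriv (dirSnd s) D (x, q) * (mixedHessian D (p, q))⁻¹ s t
      * dirDeriv (dirFst t) D (p, y) := by
  have hr : 0 < r := nonempty_ball.mp ⟨_, hx⟩
  have hpq : (p, q) ∈ ball (p, q) r := mem_ball_self hr
  have hΓ := differentiableOn_christoffel hD hdet
  have hD1 : ∀ v, DifferentiableOn ℂ (dirDeriv v D) (ball (p, q) r) := fun v =>
    hD.dirDeriv isOpen_ball _
  -- Since e'' = λ e', composition with `e` absorbs the quadratic term, and `e ∘ D` solves a linear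
  -- system whose coefficients depend on x only.
  have hP : DifferentiableOn ℂ (fun z => e (D z)) (ball (p, q) r) := fun z hz =>
    (he (D z)).differentiableAt.comp_differentiableWithinAt z (hD z hz)
  have hP1 : ∀ i, ∀ z ∈ ball (p, q) r, dirDeriv (dirFst i) (fun z => e (D z)) z
      = Complex.exp (lam * D z) * dirDeriv (dirFst i) D z := fun i z hz =>
    dirDeriv_comp_deriv (hD.differentiableAt (isOpen_ball.mem_nhds hz)) (he _) _
  have hP2 : ∀ i k, ∀ z ∈ ball (p, q) r,
      dirDeriv (dirFst k) (dirDeriv (dirFst i) fun z => e (D z)) z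
      = ∑ s, christoffel D s i k (z.1, q) * dirDeriv (dirFst s) (fun z => e (D z)) z := by
    intro i k z hz
    have hn : ball (p, q) r ∈ 𝓝 z := isOpen_ball.mem_nhds hz
    have hexp : HasDerivAt (fun d => Complex.exp (lam * d)) (Complex.exp (lam * D z) * lam) (D z) := by
      have := ((hasDerivAt_id (D z)).const_mul lam).cexp
      simpa using this
    rw [dirDeriv_congr isOpen_ball (hP1 i) hz, dirDeriv_mul (f := fun z => Complex.exp (lam * D z))
      (hexp.differentiableAt.comp z (hD.differentiableAt hn))
      ((hD1 _).differentiableAt hn), dirDeriv_comp_deriv (hD.differentiableAt hn) hexp]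
    have h1 : ∑ s, christoffel D s i k (z.1, q) * dirDeriv (dirFst s) (fun z => e (D z)) z
        = Complex.exp (lam * D z) *
          ∑ s, christoffel D s i k (z.1, q) * dirDeriv (dirFst s) D z := by
      rw [Finset.mul_sum]
      exact Finset.sum_congr rfl fun s _ => by rw [hP1 s z hz]; ring
    rw [h1, ← second_derivative_eq hD hDq hdet hcurv i k z hz]
    ring
  -- The functions ∂D/∂yₛ (x, q) solve the same linear system and vanish at x = p, where their
  -- gradients form the metric matrix. Multiplying by its inverse selects the combination with the
  -- same 1-jet at p as `e ∘ D`.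
  set b : Fin n → ℂ := fun s => ∑ t, (mixedHessian D (p, q))⁻¹ s t * dirDeriv (dirFst t) D (p, y)
    with hb
  have hW : ∀ s, DifferentiableOn ℂ
      (fun z : (Fin n → ℂ) × (Fin n → ℂ) => b s * dirDeriv (dirSnd s) D (z.1, q))
      (ball (p, q) r) := fun s => (hD1 _).comp_slice.const_mul _
  have hWs := DifferentiableOn.fun_sum fun s (_ : s ∈ Finset.univ) => hW s
  have hW1 : ∀ i, ∀ z ∈ ball (p, q) r, dirDeriv (dirFst i) (fun z : (Fin n → ℂ) × (Fin n → ℂ) =>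
      ∑ s, b s * dirDeriv (dirSnd s) D (z.1, q)) z
      = ∑ s, b s * mixedHessian D (z.1, q) i s := by
    intro i z hz
    have hn : ball (p, q) r ∈ 𝓝 z := isOpen_ball.mem_nhds hz
    rw [dirDeriv_sum _ fun s _ => (hW s).differentiableAt hn]
    refine Finset.sum_congr rfl fun s _ => ?_
    rw [dirDeriv_const_mul ((hD1 _).comp_slice.differentiableAt hn),
      dirDeriv_dirFst_comp_slice (hD1 _) hz]
    rfl
  have hGd := differentiableOn_mixedHessian isOpen_ball hD
  have hW2 : ∀ i k, ∀ z ∈ ball (p, q) r,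
      dirDeriv (dirFst k) (dirDeriv (dirFst i) fun z : (Fin n → ℂ) × (Fin n → ℂ) =>
      ∑ s, b s * dirDeriv (dirSnd s) D (z.1, q)) z
      = ∑ s, christoffel D s i k (z.1, q) * ∑ t, b t * mixedHessian D (z.1, q) s t := by
    intro i k z hz
    have hn : ball (p, q) r ∈ 𝓝 z := isOpen_ball.mem_nhds hz
    rw [dirDeriv_congr isOpen_ball (hW1 i) hz, dirDeriv_sum _ fun s _ =>
      ((hGd i s).comp_slice.differentiableAt hn).const_mul _]
    simp only [Finset.mul_sum]
    rw [Finset.sum_comm]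
    refine Finset.sum_congr rfl fun t _ => ?_
    rw [dirDeriv_const_mul ((hGd i t).comp_slice.differentiableAt hn),
      dirDeriv_dirFst_comp_slice (hGd i t) hz,
      dirDeriv_mixedHessian_eq_christoffel (hdet _ (slice_mem_ball hz)), Finset.mul_sum]
    exact Finset.sum_congr rfl fun s _ => by ring
  have hDp1 : ∀ s, dirDeriv (dirSnd s) D (p, q) = 0 := by
    intro s
    have h1 := (hD.differentiableAt (isOpen_ball.mem_nhds hpq)).hasFDerivAt.comp q
      (hasFDerivAt_prodMk_right p q)
    have h2 : HasFDerivAt (D ∘ fun y => (p, y)) (0 : (Fin n → ℂ) →L[ℂ] ℂ) q := by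
      refine (hasFDerivAt_const (0 : ℂ) q).congr_of_eventuallyEq ?_
      filter_upwards [ball_mem_nhds q hr] with w hw using hDp w hw
    exact congrArg (fun A : (Fin n → ℂ) →L[ℂ] ℂ => A (Pi.single s 1)) (h1.unique h2)
  have key := eq_zero_of_second_order_system (f := fun z => e (D z)
      - ∑ s, b s * dirDeriv (dirSnd s) D (z.1, q)) (Γ := fun s i k x => christoffel D s i k (x, q))
    hy (hP.sub hWs) (fun s i k => ?_) (fun i k x hx => ?_) ?_ (fun i => ?_) x hx
  · rw [sub_eq_zero.mp key]
    refine Finset.sum_congr rfl fun s _ => ?_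
    rw [hb, Finset.sum_mul]
    exact Finset.sum_congr rfl fun t _ => by ring
  · exact (hΓ s i k).continuousOn.comp (by fun_prop)
      fun x hx => mem_ball_mk.mpr ⟨hx, mem_ball_self hr⟩
  · have hz : (x, y) ∈ ball (p, q) r := mem_ball_mk.mpr ⟨hx, hy⟩
    have hfst : ∀ i, ∀ z ∈ ball (p, q) r, dirDeriv (dirFst i) (fun z => e (D z)
        - ∑ s, b s * dirDeriv (dirSnd s) D (z.1, q)) z
        = dirDeriv (dirFst i) (fun z => e (D z)) z - dirDeriv (dirFst i)
          (fun z : (Fin n → ℂ) × (Fin n → ℂ) => ∑ s, b s * dirDeriv (dirSnd s) D (z.1, q)) z :=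
      fun i z hz => dirDeriv_sub (hP.differentiableAt (isOpen_ball.mem_nhds hz))
        (hWs.differentiableAt (isOpen_ball.mem_nhds hz)) _
    rw [dirDeriv_congr isOpen_ball (hfst i) hz, dirDeriv_sub
      ((hP.dirDeriv isOpen_ball _).differentiableAt (isOpen_ball.mem_nhds hz))
      ((hWs.dirDeriv isOpen_ball _).differentiableAt (isOpen_ball.mem_nhds hz)),
      hP2 i k _ hz, hW2 i k _ hz, ← Finset.sum_sub_distrib]
    refine Finset.sum_congr rfl fun s _ => ?_
    rw [hfst s _ hz, hW1 s _ hz]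
    ring
  · simp [hDp y hy, he0, hDp1]
  · have hz : (p, y) ∈ ball (p, q) r := mem_ball_mk.mpr ⟨mem_ball_self hr, hy⟩
    rw [dirDeriv_sub (hP.differentiableAt (isOpen_ball.mem_nhds hz))
      (hWs.differentiableAt (isOpen_ball.mem_nhds hz)), hP1 i _ hz, hW1 i _ hz, hDp y hy]
    have hu : IsUnit (mixedHessian D (p, q)).det := (hdet _ hpq).isUnit
    have h1 : Matrix.mulVec (mixedHessian D (p, q)) (Matrix.mulVec (mixedHessian D (p, q))⁻¹
        fun t => dirDeriv (dirFst t) D (p, y)) = fun t => dirDeriv (dirFst t) D (p, y) := by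
      rw [Matrix.mulVec_mulVec, Matrix.mul_nonsing_inv _ hu, Matrix.one_mulVec]
    have h2 := congrFun h1 i
    simp only [Matrix.mulVec, dotProduct] at h2
    rw [mul_zero, Complex.exp_zero, one_mul, sub_eq_zero, ← h2]
    exact Finset.sum_congr rfl fun s _ => by simp only [hb]; ring

end NormalForm

/-! ### The polarized kernel and its derivatives. -/

section Polarization

variable {n : ℕ} {Ω : Set (Fin n → ℂ)} {H : Type*} [NormedAddCommGroup H] [InnerProductSpace ℂ H]
  {k : (Fin n → ℂ) → H}

theorem isOpen_star_mem (hΩ : IsOpen Ω) : IsOpen {y : Fin n → ℂ | star y ∈ Ω} :=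
  hΩ.preimage continuous_star

/-- The domain of the polarized kernel. -/
def polarDomain (Ω : Set (Fin n → ℂ)) : Set ((Fin n → ℂ) × (Fin n → ℂ)) :=
  {z | z.1 ∈ Ω ∧ star z.2 ∈ Ω}

theorem isOpen_polarDomain (hΩ : IsOpen Ω) : IsOpen (polarDomain Ω) :=
  (hΩ.preimage continuous_fst).inter ((isOpen_star_mem hΩ).preimage continuous_snd)

/-- The kernel `⟪k x, k ȳ⟫`, holomorphic in both variables. -/
noncomputable def polarKernel (k : (Fin n → ℂ) → H) (z : (Fin n → ℂ) × (Fin n → ℂ)) : ℂ :=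
  inner ℂ (k z.1) (k (star z.2))

/-- The derivative of `y ↦ k ȳ` in the `j`-th coordinate direction. -/
noncomputable def kernelDeriv (k : (Fin n → ℂ) → H) (j : Fin n) (y : Fin n → ℂ) : H :=
  dirDeriv (Pi.single j 1) (fun y => k (star y)) y

namespace HolomorphicKernel

theorem differentiableOn_inner (hk : HolomorphicKernel Ω k) (f : H) :
    DifferentiableOn ℂ (fun z => inner ℂ (k z) f) Ω := fun z hz => by
  have := (hk.differentiableOn_innerSL z hz).clm_apply (differentiableWithinAt_const f)
  exact this

/-- Both sides are the real derivative of one function along the line t ↦ x + t a. The conjugate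
linearity of the inner product compensates for the antiholomorphy of `k`. -/
theorem fderiv_inner_left (hk : HolomorphicKernel Ω k) (hΩ : IsOpen Ω) (f : H) {x : Fin n → ℂ}
    (hx : x ∈ Ω) (a : Fin n → ℂ) : fderiv ℂ (fun z => inner ℂ (k z) f) x a
      = inner ℂ (fderiv ℂ (fun y => k (star y)) (star x) (star a)) f := by
  have hline : ∀ x a : Fin n → ℂ, HasDerivAt (fun t : ℝ => x + t • a) a 0 := by
    intro x a
    have := ((hasDerivAt_id (0 : ℝ)).smul_const a).const_add x
    rw [one_smul] at this
    exact this
  have h1 : HasDerivAt (fun t : ℝ => inner ℂ (k (x + t • a)) f)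
      (fderiv ℂ (fun z => inner ℂ (k z) f) x a) 0 := by
    have h := (((hk.differentiableOn_inner f).differentiableAt
      (hΩ.mem_nhds hx)).hasFDerivAt.restrictScalars ℝ)
    rw [show x = x + (0 : ℝ) • a by simp] at h
    have := HasFDerivAt.comp_hasDerivAt (f := fun t : ℝ => x + t • a) 0 h (hline x a)
    simpa [Function.comp_def] using this
  have h2 : HasDerivAt (fun t : ℝ => k (star (star x + t • star a)))
      (fderiv ℂ (fun y => k (star y)) (star x) (star a)) 0 := by
    have hx' : star (star x) ∈ Ω := by rwa [star_star]
    have h := ((hk.differentiableOn_star.differentiableAt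
      ((isOpen_star_mem hΩ).mem_nhds hx')).hasFDerivAt.restrictScalars ℝ)
    rw [show star x = star x + (0 : ℝ) • star a by simp] at h
    have := HasFDerivAt.comp_hasDerivAt (f := fun t : ℝ => star x + t • star a) 0 h
      (hline (star x) (star a))
    simpa [Function.comp_def] using this
  have h3 := h2.inner ℂ (hasDerivAt_const (0 : ℝ) f)
  have h4 : (fun t : ℝ => inner ℂ (k (star (star x + t • star a))) f)
      = fun t : ℝ => inner ℂ (k (x + t • a)) f := by
    ext t
    congr 2
    ext j
    simp
  rw [h4] at h3
  have := h1.unique h3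
  simpa using this

theorem differentiableOn_inner_comp (hk : HolomorphicKernel Ω k) {φ : (Fin n → ℂ) → H}
    (hφ : DifferentiableOn ℂ φ {y | star y ∈ Ω}) :
    DifferentiableOn ℂ (fun z : (Fin n → ℂ) × (Fin n → ℂ) => inner ℂ (k z.1) (φ z.2))
      (polarDomain Ω) := by
  have h1 : DifferentiableOn ℂ (fun z : (Fin n → ℂ) × (Fin n → ℂ) => innerSL ℂ (k z.1))
      (polarDomain Ω) :=
    hk.differentiableOn_innerSL.comp differentiableOn_fst fun z hz => hz.1
  have h2 : DifferentiableOn ℂ (fun z : (Fin n → ℂ) × (Fin n → ℂ) => φ z.2) (polarDomain Ω) :=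
    hφ.comp differentiableOn_snd fun z hz => hz.2
  exact fun z hz => (h1 z hz).clm_apply (h2 z hz)

theorem differentiableOn_polarKernel (hk : HolomorphicKernel Ω k) :
    DifferentiableOn ℂ (polarKernel k) (polarDomain Ω) :=
  hk.differentiableOn_inner_comp hk.differentiableOn_star

theorem dirSnd_inner_comp (hk : HolomorphicKernel Ω k) (hΩ : IsOpen Ω) {φ : (Fin n → ℂ) → H}
    (hφ : DifferentiableOn ℂ φ {y | star y ∈ Ω}) {z : (Fin n → ℂ) × (Fin n → ℂ)}
    (hz : z ∈ polarDomain Ω) (j : Fin n) :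
    dirDeriv (dirSnd j) (fun z => inner ℂ (k z.1) (φ z.2)) z
      = inner ℂ (k z.1) (dirDeriv (Pi.single j 1) φ z.2) := by
  obtain ⟨x, y⟩ := z
  have h1 : HasFDerivAt ((fun z : (Fin n → ℂ) × (Fin n → ℂ) => inner ℂ (k z.1) (φ z.2)) ∘
      fun y => (x, y)) _ y :=
    ((hk.differentiableOn_inner_comp hφ).differentiableAt
      ((isOpen_polarDomain hΩ).mem_nhds hz)).hasFDerivAt.comp (f := fun y => (x, y)) y
      (hasFDerivAt_prodMk_right x y)
  have h2 := (innerSL ℂ (k x)).hasFDerivAt.comp y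
    ((hφ.differentiableAt ((isOpen_star_mem hΩ).mem_nhds hz.2)).hasFDerivAt)
  exact congrArg (fun A : (Fin n → ℂ) →L[ℂ] ℂ => A (Pi.single j 1)) (h1.unique h2)

theorem dirFst_inner_comp (hk : HolomorphicKernel Ω k) (hΩ : IsOpen Ω) {φ : (Fin n → ℂ) → H}
    (hφ : DifferentiableOn ℂ φ {y | star y ∈ Ω}) {z : (Fin n → ℂ) × (Fin n → ℂ)}
    (hz : z ∈ polarDomain Ω) (i : Fin n) :
    dirDeriv (dirFst i) (fun z => inner ℂ (k z.1) (φ z.2)) z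
      = inner ℂ (kernelDeriv k i (star z.1)) (φ z.2) := by
  obtain ⟨x, y⟩ := z
  have h1 : HasFDerivAt ((fun z : (Fin n → ℂ) × (Fin n → ℂ) => inner ℂ (k z.1) (φ z.2)) ∘
      fun x => (x, y)) _ x :=
    ((hk.differentiableOn_inner_comp hφ).differentiableAt
      ((isOpen_polarDomain hΩ).mem_nhds hz)).hasFDerivAt.comp (f := fun x => (x, y)) x
      (hasFDerivAt_prodMk_left x y)
  have h2 := ((hk.differentiableOn_inner (φ y)).differentiableAt
    (hΩ.mem_nhds hz.1)).hasFDerivAt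
  have h3 := congrArg (fun A : (Fin n → ℂ) →L[ℂ] ℂ => A (Pi.single i 1)) (h1.unique h2)
  refine Eq.trans h3 ?_
  have h4 := hk.fderiv_inner_left hΩ (φ y) hz.1 (Pi.single i 1)
  have h5 : star (Pi.single i 1 : Fin n → ℂ) = Pi.single i 1 := by
    ext j; by_cases h : j = i
    · subst h; simp
    · simp [h]
  rw [h5] at h4
  exact h4

theorem differentiableOn_kernelDeriv [CompleteSpace H] (hk : HolomorphicKernel Ω k) (hΩ : IsOpen Ω)
    (j : Fin n) : DifferentiableOn ℂ (kernelDeriv k j) {y | star y ∈ Ω} :=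
  hk.differentiableOn_star.dirDeriv (isOpen_star_mem hΩ) _

theorem fderiv_star_eq_sum (k : (Fin n → ℂ) → H) (y a : Fin n → ℂ) :
    fderiv ℂ (fun y => k (star y)) y a = ∑ j, a j • kernelDeriv k j y := by
  conv_lhs => rw [show a = ∑ j, a j • Pi.single j (1 : ℂ) by
    ext i; simp [Finset.sum_apply, Pi.single_apply]]
  rw [map_sum]
  simp [kernelDeriv, _root_.dirDeriv]

/-- The reproducing vector and its derivatives are linearly independent. -/
theorem eq_zero_of_sum_kernelDeriv (hk : HolomorphicKernel Ω k) (hΩ : IsOpen Ω) {z : Fin n → ℂ}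
    (hz : z ∈ Ω) {a : Fin n → ℂ} {c : ℂ}
    (h : ∑ j, a j • kernelDeriv k j (star z) = c • k z) : a = 0 := by
  ext j
  -- The vector `g` stands for the function (wⱼ - zⱼ) K(w, z). Pairing it with the derivative of the
  -- reproducing vectors at `z` in direction `a` gives aⱼ ‖k z‖², while its pairing with `k z` is
  -- zero because this function vanishes at `z`.
  obtain ⟨C, -, hC⟩ := hk.exists_mul j (z j)
  obtain ⟨g, -, hg⟩ := hC (k z)
  have hy : star (star z) ∈ Ω := by rwa [star_star]
  have hκ := (hk.differentiableOn_star.differentiableAt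
    ((isOpen_star_mem hΩ).mem_nhds hy)).hasFDerivAt
  have hgy : ∀ y : Fin n → ℂ, star y ∈ Ω → inner ℂ g (k (star y))
      = (y j - star z j) * inner ℂ (k z) (k (star y)) := by
    intro y hy
    rw [← inner_conj_symm, hg _ hy, map_mul, inner_conj_symm]
    simp
  have h1 := (innerSL ℂ g).hasFDerivAt.comp (star z) hκ
  have h2 : HasFDerivAt (fun y : Fin n → ℂ => (y j - star z j) * inner ℂ (k z) (k (star y)))
      _ (star z) :=
    (((ContinuousLinearMap.proj (R := ℂ) (φ := fun _ : Fin n => ℂ) j).hasFDerivAt).sub_const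
      (star z j)).mul ((innerSL ℂ (k z)).hasFDerivAt.comp (star z) hκ)
  have h3 : (fun y => innerSL ℂ g (k (star y))) =ᶠ[𝓝 (star z)]
      fun y : Fin n → ℂ => (y j - star z j) * inner ℂ (k z) (k (star y)) := by
    filter_upwards [(isOpen_star_mem hΩ).mem_nhds hy] with y hy using hgy y hy
  have h4 := congrArg (fun A : (Fin n → ℂ) →L[ℂ] ℂ => A a)
    (h1.unique (h2.congr_of_eventuallyEq h3))
  have h5 : inner ℂ g (∑ j, a j • kernelDeriv k j (star z)) = a j * inner ℂ (k z) (k z) := by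
    rw [← fderiv_star_eq_sum]
    simpa [mul_comm] using h4
  have h6 : inner ℂ g (k z) = 0 := by
    have := hgy (star z) hy
    simpa using this
  rw [h, inner_smul_right, h6, mul_zero] at h5
  have h7 : inner ℂ (k z) (k z) ≠ 0 := inner_self_ne_zero.mpr (hk.ne_zero z hz)
  exact (mul_eq_zero.mp h5.symm).resolve_right h7

end HolomorphicKernel

end Polarization

/-! ### Wirtinger derivatives as holomorphic derivatives on the antidiagonal. -/

section Wirtinger

variable {n : ℕ}

theorem hasFDerivAt_comp_diag {f : (Fin n → ℂ) × (Fin n → ℂ) → ℂ} {z : Fin n → ℂ}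
    (hf : DifferentiableAt ℂ f (z, star z)) (v : Fin n → ℂ) :
    fderiv ℝ (fun z => f (z, star z)) z v = fderiv ℂ f (z, star z) (v, star v) := by
  have h1 : HasFDerivAt (fun z : Fin n → ℂ => (z, star z))
      ((ContinuousLinearMap.id ℝ (Fin n → ℂ)).prod
        ((starL' ℝ : (Fin n → ℂ) ≃L[ℝ] (Fin n → ℂ)) : (Fin n → ℂ) →L[ℝ] (Fin n → ℂ))) z :=
    (hasFDerivAt_id z).prodMk
      ((starL' ℝ : (Fin n → ℂ) ≃L[ℝ] (Fin n → ℂ)) : (Fin n → ℂ) →L[ℝ] (Fin n → ℂ)).hasFDerivAt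
  have h2 := (hf.hasFDerivAt.restrictScalars ℝ).comp z h1
  have h3 := h2.fderiv
  simp only [Function.comp_def] at h3
  rw [h3]
  rfl

theorem star_single_one (j : Fin n) : star (Pi.single j 1 : Fin n → ℂ) = Pi.single j 1 := by
  ext i; by_cases h : i = j
  · subst h; simp
  · simp [h]

theorem fderiv_diag_I (A : (Fin n → ℂ) × (Fin n → ℂ) →L[ℂ] ℂ) (j : Fin n) :
    A (Pi.single j Complex.I, star (Pi.single j Complex.I))
      = Complex.I * (A (dirFst j) - A (dirSnd j)) := by
  have : ((Pi.single j Complex.I : Fin n → ℂ), star (Pi.single j Complex.I : Fin n → ℂ))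
      = Complex.I • (dirFst j - dirSnd j : (Fin n → ℂ) × (Fin n → ℂ)) := by
    ext i <;> by_cases h : i = j
    · subst h; simp [dirFst, dirSnd]
    · simp [dirFst, dirSnd, h]
    · subst h; simp [dirFst, dirSnd]
    · simp [dirFst, dirSnd, h]
  rw [this, map_smul, map_sub, smul_eq_mul]

theorem fderiv_diag_one (A : (Fin n → ℂ) × (Fin n → ℂ) →L[ℂ] ℂ) (j : Fin n) :
    A (Pi.single j 1, star (Pi.single j 1)) = A (dirFst j) + A (dirSnd j) := by
  rw [star_single_one, ← map_add]
  simp [dirFst, dirSnd]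

/-- On real directions v and iv the differential along z ↦ (z, z̄) is A(v, v̄) and i A(v, -v̄) for v
a coordinate vector, so the Wirtinger combination isolates the holomorphic derivative in the first
block. Its conjugate isolates the second. -/
theorem wirtinger_comp_diag {f : (Fin n → ℂ) × (Fin n → ℂ) → ℂ} {z : Fin n → ℂ}
    (hf : DifferentiableAt ℂ f (z, star z)) (j : Fin n) :
    wirtinger j (fun z => f (z, star z)) z = dirDeriv (dirFst j) f (z, star z) := by
  rw [wirtinger, hasFDerivAt_comp_diag hf, hasFDerivAt_comp_diag hf, fderiv_diag_I,
    fderiv_diag_one, dirDeriv, ← mul_assoc, Complex.I_mul_I]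
  ring

theorem wirtingerBar_comp_diag {f : (Fin n → ℂ) × (Fin n → ℂ) → ℂ} {z : Fin n → ℂ}
    (hf : DifferentiableAt ℂ f (z, star z)) (j : Fin n) :
    wirtingerBar j (fun z => f (z, star z)) z = dirDeriv (dirSnd j) f (z, star z) := by
  rw [wirtingerBar, hasFDerivAt_comp_diag hf, hasFDerivAt_comp_diag hf, fderiv_diag_I,
    fderiv_diag_one, dirDeriv, ← mul_assoc, Complex.I_mul_I]
  ring

theorem wirtinger_congr {f g : (Fin n → ℂ) → ℂ} {z : Fin n → ℂ} (h : f =ᶠ[𝓝 z] g) (j : Fin n) :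
    wirtinger j f z = wirtinger j g z := by
  rw [wirtinger, wirtinger, h.fderiv_eq]

theorem wirtingerBar_congr {f g : (Fin n → ℂ) → ℂ} {z : Fin n → ℂ} (h : f =ᶠ[𝓝 z] g) (j : Fin n) :
    wirtingerBar j f z = wirtingerBar j g z := by
  rw [wirtingerBar, wirtingerBar, h.fderiv_eq]

/-- Agreement is required only on the part of the antidiagonal inside an open set, so the rule can
be applied repeatedly and iterated Wirtinger derivatives become iterated holomorphic ones. -/
theorem wirtingerBar_eq_of_eqOn {f : (Fin n → ℂ) × (Fin n → ℂ) → ℂ} {g : (Fin n → ℂ) → ℂ}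
    {U : Set ((Fin n → ℂ) × (Fin n → ℂ))} (hU : IsOpen U) (hf : DifferentiableOn ℂ f U)
    (h : ∀ z, (z, star z) ∈ U → g z = f (z, star z)) {z : Fin n → ℂ} (hz : (z, star z) ∈ U)
    (j : Fin n) : wirtingerBar j g z = dirDeriv (dirSnd j) f (z, star z) := by
  rw [← wirtingerBar_comp_diag (hf.differentiableAt (hU.mem_nhds hz))]
  refine wirtingerBar_congr ?_ j
  have hc : Continuous fun z : Fin n → ℂ => (z, star z) := by fun_prop
  filter_upwards [(hU.preimage hc).mem_nhds hz] with w hw using h w hw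

theorem wirtinger_eq_of_eqOn {f : (Fin n → ℂ) × (Fin n → ℂ) → ℂ} {g : (Fin n → ℂ) → ℂ}
    {U : Set ((Fin n → ℂ) × (Fin n → ℂ))} (hU : IsOpen U) (hf : DifferentiableOn ℂ f U)
    (h : ∀ z, (z, star z) ∈ U → g z = f (z, star z)) {z : Fin n → ℂ} (hz : (z, star z) ∈ U)
    (j : Fin n) : wirtinger j g z = dirDeriv (dirFst j) f (z, star z) := by
  rw [← wirtinger_comp_diag (hf.differentiableAt (hU.mem_nhds hz))]
  refine wirtinger_congr ?_ j
  have hc : Continuous fun z : Fin n → ℂ => (z, star z) := by fun_prop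
  filter_upwards [(hU.preimage hc).mem_nhds hz] with w hw using h w hw

/-- A holomorphic function vanishing on the antidiagonal `y = x̄` near `(p, p̄)` vanishes near
`(p, p̄)`. -/
theorem eq_zero_of_diag_eq_zero {f : (Fin n → ℂ) × (Fin n → ℂ) → ℂ} {p : Fin n → ℂ} {r : ℝ}
    (hf : DifferentiableOn ℂ f (ball (p, star p) r)) (h : ∀ x ∈ ball p r, f (x, star x) = 0) :
    ∀ z ∈ ball (p, star p) (r / 3), f z = 0 := by
  rintro ⟨x, y⟩ hz
  obtain ⟨hx, hy⟩ := mem_ball_mk.mp hz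
  rw [mem_ball, dist_eq_norm] at hx hy
  have hy' : ‖star y - p‖ < r / 3 := by rw [← norm_star, star_sub, star_star]; exact hy
  -- `u` and `v` are chosen so that x = u + iv and y = ū + i v̄. The complex line t ↦ (u + tv, ū + t
  -- v̄) lies on the antidiagonal for real t and passes through (x, y) at t = i. It stays in the
  -- ball for |t| < 2, since `u - p` and `v` have norm below r/3.
  let u : Fin n → ℂ := (2 : ℂ)⁻¹ • (x + star y)
  let v : Fin n → ℂ := (-(Complex.I / 2)) • (x - star y)
  have hu : ‖u - p‖ < r / 3 := by
    have : u - p = (2 : ℂ)⁻¹ • ((x - p) + (star y - p)) := by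
      simp only [u]; module
    rw [this, norm_smul]
    have := norm_add_le (x - p) (star y - p)
    norm_num
    linarith
  have hv : ‖v‖ < r / 3 := by
    have : v = (-(Complex.I / 2)) • ((x - p) - (star y - p)) := by
      simp only [v]; congr 1; abel
    rw [this, norm_smul]
    have := norm_sub_le (x - p) (star y - p)
    rw [sub_sub_sub_cancel_right] at this
    norm_num
    linarith
  let γ : ℂ → (Fin n → ℂ) × (Fin n → ℂ) := fun t => (u + t • v, star u + t • star v)
  have hγ : ∀ t ∈ ball (0 : ℂ) 2, γ t ∈ ball (p, star p) r := by
    intro t ht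
    rw [mem_ball_zero_iff] at ht
    have key : ∀ s w : Fin n → ℂ, ‖s‖ < r / 3 → ‖w‖ < r / 3 → ‖s + t • w‖ < r := by
      intro s w hs hw
      have h1 := norm_add_le s (t • w)
      rw [norm_smul] at h1
      nlinarith [norm_nonneg w, norm_nonneg t]
    refine mem_ball_mk.mpr ⟨?_, ?_⟩
    · rw [mem_ball, dist_eq_norm, show u + t • v - p = (u - p) + t • v by abel]
      exact key _ _ hu hv
    · rw [mem_ball, dist_eq_norm, show star u + t • star v - star p
        = star (u - p) + t • star v by rw [star_sub]; abel]
      exact key _ _ (by rwa [norm_star]) (by rwa [norm_star])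
  have hγd : Differentiable ℂ γ := by fun_prop
  have hd : DifferentiableOn ℂ (fun t => f (γ t)) (ball 0 2) :=
    hf.comp hγd.differentiableOn hγ
  have hreal : ∀ t : ℝ, |t| < 2 → f (γ t) = 0 := by
    intro t ht
    have hm := hγ t (by simpa using ht)
    have : γ t = ((u + (t : ℂ) • v), star (u + (t : ℂ) • v)) := by
      simp only [γ, star_add, star_smul]
      simp
    rw [this] at hm ⊢
    exact h _ (mem_ball_mk.mp hm).1
  -- The zeros at the real points 1/(m + 1) accumulate at 0, so the one-variable identity theorem
  -- applies.
  have hfreq : ∃ᶠ t in 𝓝[≠] (0 : ℂ), f (γ t) = 0 := by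
    have ht : Tendsto (fun m : ℕ => ((1 / ((m : ℝ) + 1) : ℝ) : ℂ)) atTop (𝓝[≠] 0) := by
      refine tendsto_nhdsWithin_iff.mpr ⟨?_, Eventually.of_forall fun m => ?_⟩
      · have := (Complex.continuous_ofReal.tendsto 0).comp
          (tendsto_one_div_add_atTop_nhds_zero_nat (𝕜 := ℝ))
        simpa [Function.comp_def] using this
      · have : (1 / ((m : ℝ) + 1) : ℝ) ≠ 0 := by positivity
        simp only [mem_compl_iff, mem_singleton_iff]
        exact_mod_cast this
    refine ht.frequently (Frequently.of_forall fun m => hreal _ ?_)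
    rw [abs_of_pos (by positivity)]
    have : 1 / ((m : ℝ) + 1) ≤ 1 := by
      rw [div_le_one (by positivity)]; linarith [show (0 : ℝ) ≤ m from m.cast_nonneg]
    linarith
  have := (hd.analyticOnNhd isOpen_ball).eqOn_zero_of_preconnected_of_frequently_eq_zero
    (convex_ball (0 : ℂ) 2).isPreconnected (mem_ball_self two_pos) hfreq
    (show Complex.I ∈ ball (0 : ℂ) 2 by simp)
  have hI : γ Complex.I = (x, y) := by
    have h1 : Complex.I * -(Complex.I / 2) = 1 / 2 := by
      rw [mul_neg, ← mul_div_assoc, Complex.I_mul_I]; norm_num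
    have h2 : Complex.I * star (-(Complex.I / 2)) = -(1 / 2) := by
      simp only [star_neg, star_div₀, Complex.star_def, Complex.conj_I]
      rw [neg_div, neg_neg, ← mul_div_assoc, Complex.I_mul_I, map_ofNat]; norm_num
    simp only [γ, u, v, star_smul, smul_smul, h1, h2, star_add, star_sub, star_star]
    refine Prod.ext ?_ ?_ <;> ext j <;> simp <;> ring
  simpa [hI] using this

end Wirtinger

/-! ### The Bergman metric and its curvature in polarized form. -/

section LogKernel

variable {n : ℕ} {Ω : Set (Fin n → ℂ)} {H : Type*} [NormedAddCommGroup H] [InnerProductSpace ℂ H]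
  {k : (Fin n → ℂ) → H}

/-- The logarithm of the polarized kernel, a local potential of the Bergman metric. -/
noncomputable def logKernel (k : (Fin n → ℂ) → H) (z : (Fin n → ℂ) × (Fin n → ℂ)) : ℂ :=
  Complex.log (polarKernel k z)

/-- The part of the domain of the polarized kernel where its principal logarithm is holomorphic. -/
def logDomain (Ω : Set (Fin n → ℂ)) (k : (Fin n → ℂ) → H) : Set ((Fin n → ℂ) × (Fin n → ℂ)) :=
  polarDomain Ω ∩ {z | polarKernel k z ∈ Complex.slitPlane}

theorem polarKernel_diag (k : (Fin n → ℂ) → H) (z : Fin n → ℂ) :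
    polarKernel k (z, star z) = ((‖k z‖ ^ 2 : ℝ) : ℂ) := by
  simp [polarKernel]

namespace HolomorphicKernel

theorem isOpen_logDomain (hk : HolomorphicKernel Ω k) (hΩ : IsOpen Ω) :
    IsOpen (logDomain Ω k) :=
  hk.differentiableOn_polarKernel.continuousOn.isOpen_inter_preimage (isOpen_polarDomain hΩ)
    Complex.isOpen_slitPlane

theorem diag_mem_logDomain (hk : HolomorphicKernel Ω k) {z : Fin n → ℂ} (hz : z ∈ Ω) :
    (z, star z) ∈ logDomain Ω k := by
  refine ⟨⟨hz, by simpa using hz⟩, ?_⟩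
  rw [mem_ofPred_eq, polarKernel_diag, Complex.ofReal_mem_slitPlane]
  have := norm_pos_iff.mpr (hk.ne_zero z hz)
  positivity

theorem differentiableOn_logKernel (hk : HolomorphicKernel Ω k) :
    DifferentiableOn ℂ (logKernel k) (logDomain Ω k) :=
  (hk.differentiableOn_polarKernel.mono inter_subset_left).clog fun _ hz => hz.2

theorem dirSnd_logKernel (hk : HolomorphicKernel Ω k) (hΩ : IsOpen Ω)
    {z : (Fin n → ℂ) × (Fin n → ℂ)} (hz : z ∈ logDomain Ω k) (j : Fin n) :
    dirDeriv (dirSnd j) (logKernel k) z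
      = (polarKernel k z)⁻¹ * inner ℂ (k z.1) (kernelDeriv k j z.2) := by
  have h1 := hk.differentiableOn_polarKernel.differentiableAt
    ((isOpen_polarDomain hΩ).mem_nhds hz.1)
  refine (dirDeriv_comp_deriv h1 (Complex.hasDerivAt_log hz.2) _).trans ?_
  exact congrArg _ (hk.dirSnd_inner_comp hΩ hk.differentiableOn_star hz.1 j)

theorem dirFst_logKernel (hk : HolomorphicKernel Ω k) (hΩ : IsOpen Ω)
    {z : (Fin n → ℂ) × (Fin n → ℂ)} (hz : z ∈ logDomain Ω k) (i : Fin n) :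
    dirDeriv (dirFst i) (logKernel k) z
      = (polarKernel k z)⁻¹ * inner ℂ (kernelDeriv k i (star z.1)) (k (star z.2)) := by
  have h1 := hk.differentiableOn_polarKernel.differentiableAt
    ((isOpen_polarDomain hΩ).mem_nhds hz.1)
  refine (dirDeriv_comp_deriv h1 (Complex.hasDerivAt_log hz.2) _).trans ?_
  exact congrArg _ (hk.dirFst_inner_comp hΩ hk.differentiableOn_star hz.1 i)

theorem mixedHessian_logKernel [CompleteSpace H] (hk : HolomorphicKernel Ω k) (hΩ : IsOpen Ω)
    {z : (Fin n → ℂ) × (Fin n → ℂ)} (hz : z ∈ logDomain Ω k) (i j : Fin n) :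
    mixedHessian (logKernel k) z i j = (polarKernel k z)⁻¹
        * inner ℂ (kernelDeriv k i (star z.1)) (kernelDeriv k j z.2)
      - ((polarKernel k z)⁻¹) ^ 2 * (inner ℂ (k z.1) (kernelDeriv k j z.2)
        * inner ℂ (kernelDeriv k i (star z.1)) (k (star z.2))) := by
  have hU := hk.isOpen_logDomain hΩ
  have h0 : polarKernel k z ≠ 0 := Complex.slitPlane_ne_zero hz.2
  have h1 := hk.differentiableOn_polarKernel.differentiableAt
    ((isOpen_polarDomain hΩ).mem_nhds hz.1)
  have hd := hk.differentiableOn_kernelDeriv hΩ j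
  have h2 := (hk.differentiableOn_inner_comp hd).differentiableAt
    ((isOpen_polarDomain hΩ).mem_nhds hz.1)
  have h3 : dirDeriv (dirFst i) (polarKernel k) z
      = inner ℂ (kernelDeriv k i (star z.1)) (k (star z.2)) :=
    hk.dirFst_inner_comp hΩ hk.differentiableOn_star hz.1 i
  have h4 := dirDeriv_comp_deriv h1 (hasDerivAt_inv h0) (dirFst i)
  rw [mixedHessian, Matrix.of_apply,
    dirDeriv_congr hU (fun z hz => hk.dirSnd_logKernel hΩ hz j) hz,
    dirDeriv_mul (f := fun z => (polarKernel k z)⁻¹) (h1.fun_inv h0) h2, h4,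
    hk.dirFst_inner_comp hΩ hd hz.1, h3]
  field_simp
  ring

/-- The Bergman metric is nondegenerate. -/
theorem sum_mixedHessian_logKernel_ne_zero [CompleteSpace H] (hk : HolomorphicKernel Ω k)
    (hΩ : IsOpen Ω) {z : Fin n → ℂ} (hz : z ∈ Ω) {v : Fin n → ℂ} (hv : v ≠ 0) :
    ∑ i, ∑ j, mixedHessian (logKernel k) (z, star z) i j * v i * conj (v j) ≠ 0 := by
  have h0 : k z ≠ 0 := hk.ne_zero z hz
  have hN : (inner ℂ (k z) (k z) : ℂ) ≠ 0 := inner_self_ne_zero.mpr h0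
  set w : H := ∑ j, conj (v j) • kernelDeriv k j (star z) with hw
  have hK : polarKernel k (z, star z) = inner ℂ (k z) (k z) := by simp [polarKernel]
  have e1 : inner ℂ w w = ∑ i, ∑ j, v i * conj (v j) *
      inner ℂ (kernelDeriv k i (star z)) (kernelDeriv k j (star z)) := by
    rw [hw]
    simp only [sum_inner, inner_sum, inner_smul_left, inner_smul_right, Complex.conj_conj, Finset.mul_sum]
    rw [Finset.sum_comm]
    exact Finset.sum_congr rfl fun i _ => Finset.sum_congr rfl fun j _ => by ring
  have e2 : inner ℂ (k z) w = ∑ j, conj (v j) * inner ℂ (k z) (kernelDeriv k j (star z)) := by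
    rw [hw]; simp only [inner_sum, inner_smul_right]
  have e3 : inner ℂ w (k z) = ∑ i, v i * inner ℂ (kernelDeriv k i (star z)) (k z) := by
    rw [hw]; simp only [sum_inner, inner_smul_left, Complex.conj_conj]
  have hsum : ∑ i, ∑ j, mixedHessian (logKernel k) (z, star z) i j * v i * conj (v j)
      = (inner ℂ (k z) (k z))⁻¹ * inner ℂ w w
        - ((inner ℂ (k z) (k z))⁻¹) ^ 2 * (inner ℂ w (k z) * inner ℂ (k z) w) := by
    rw [e1, e2, e3, Finset.sum_mul_sum]
    simp only [Finset.mul_sum, ← Finset.sum_sub_distrib]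
    refine Finset.sum_congr rfl fun i _ => Finset.sum_congr rfl fun j _ => ?_
    rw [hk.mixedHessian_logKernel hΩ (hk.diag_mem_logDomain hz), hK]
    simp only [star_star]
    ring
  rw [hsum]
  intro hzero
  have h1 : inner ℂ (k z) (k z) * inner ℂ w w - inner ℂ w (k z) * inner ℂ (k z) w = 0 := by
    have : inner ℂ (k z) (k z) * inner ℂ w w - inner ℂ w (k z) * inner ℂ (k z) w
        = (inner ℂ (k z) (k z)) ^ 2 * ((inner ℂ (k z) (k z))⁻¹ * inner ℂ w w
        - ((inner ℂ (k z) (k z))⁻¹) ^ 2 * (inner ℂ w (k z) * inner ℂ (k z) w)) := by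
      field_simp
    rw [this, hzero, mul_zero]
  -- Equality in Cauchy–Schwarz makes `w` a multiple of `k z`, contrary to the independence of `k z`
  -- and its derivatives.
  have h2 : (inner ℂ (k z) (k z) : ℂ) • w - (inner ℂ (k z) w : ℂ) • k z = 0 := by
    rw [← inner_self_eq_zero (𝕜 := ℂ)]
    simp only [inner_sub_left, inner_sub_right, inner_smul_left, inner_smul_right,
      inner_conj_symm]
    linear_combination (inner ℂ (k z) (k z)) * h1
  have h3 : ∑ j, conj (v j) • kernelDeriv k j (star z)
      = ((inner ℂ (k z) (k z))⁻¹ * inner ℂ (k z) w) • k z := by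
    rw [← hw, mul_smul, ← sub_eq_zero.mp h2, smul_smul, inv_mul_cancel₀ hN, one_smul]
  have h4 := hk.eq_zero_of_sum_kernelDeriv hΩ hz h3
  refine hv (funext fun j => ?_)
  have := congrFun h4 j
  simpa using this

theorem det_mixedHessian_logKernel_ne_zero [CompleteSpace H] (hk : HolomorphicKernel Ω k)
    (hΩ : IsOpen Ω) {z : Fin n → ℂ} (hz : z ∈ Ω) :
    (mixedHessian (logKernel k) (z, star z)).det ≠ 0 := by
  intro h0
  obtain ⟨v, hv, hv0⟩ := Matrix.exists_vecMul_eq_zero_iff.mpr h0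
  refine hk.sum_mixedHessian_logKernel_ne_zero hΩ hz hv ?_
  rw [Finset.sum_comm]
  refine Finset.sum_eq_zero fun j _ => ?_
  rw [← Finset.sum_mul]
  have := congrFun hv0 j
  simp only [Matrix.vecMul, dotProduct, Pi.zero_apply] at this
  rw [show ∑ i, mixedHessian (logKernel k) (z, star z) i j * v i
    = ∑ i, v i * mixedHessian (logKernel k) (z, star z) i j from
    Finset.sum_congr rfl fun i _ => mul_comm _ _, this, zero_mul]

theorem bergmanMetric_eq (hk : HolomorphicKernel Ω k) (hΩ : IsOpen Ω)
    (hK : ∀ z ∈ Ω, ∀ w ∈ Ω, bergmanKernel Ω z w = inner ℂ (k z) (k w)) {z : Fin n → ℂ}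
    (hz : z ∈ Ω) : bergmanMetric Ω z = mixedHessian (logKernel k) (z, star z) := by
  have hU := hk.isOpen_logDomain hΩ
  ext i j
  have h1 : ∀ z, (z, star z) ∈ logDomain Ω k →
      ((Real.log (bergmanKernel Ω z z).re : ℝ) : ℂ) = logKernel k (z, star z) := by
    intro z hz
    have h2 : (inner ℂ (k z) (k z)).re = ‖k z‖ ^ 2 := inner_self_eq_norm_sq (𝕜 := ℂ) (k z)
    rw [hK z hz.1.1 z hz.1.1, logKernel, polarKernel_diag, h2,
      Complex.ofReal_log (sq_nonneg ‖k z‖)]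
  exact wirtinger_eq_of_eqOn hU (hk.differentiableOn_logKernel.dirDeriv hU _)
    (fun z hz => wirtingerBar_eq_of_eqOn hU hk.differentiableOn_logKernel h1 hz j)
    (hk.diag_mem_logDomain hz) i

/-- The polarization of the curvature tensor of the metric with potential `L`. -/
noncomputable def _root_.polarCurvature (L : (Fin n → ℂ) × (Fin n → ℂ) → ℂ) (i j s l : Fin n)
    (z : (Fin n → ℂ) × (Fin n → ℂ)) : ℂ :=
  - dirDeriv (dirFst s) (dirDeriv (dirSnd l) fun z => mixedHessian L z i j) z
    + ∑ a, ∑ b, (mixedHessian L z)⁻¹ b a * dirDeriv (dirFst s) (fun z => mixedHessian L z i b) z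
      * dirDeriv (dirSnd l) (fun z => mixedHessian L z a j) z

theorem kahlerCurvature_eq [CompleteSpace H] (hk : HolomorphicKernel Ω k) (hΩ : IsOpen Ω)
    (hK : ∀ z ∈ Ω, ∀ w ∈ Ω, bergmanKernel Ω z w = inner ℂ (k z) (k w)) {z : Fin n → ℂ}
    (hz : z ∈ Ω) (i j s l : Fin n) : kahlerCurvature (bergmanMetric Ω) z i j s l
      = polarCurvature (logKernel k) i j s l (z, star z) := by
  have hU := hk.isOpen_logDomain hΩ
  have hG := differentiableOn_mixedHessian hU hk.differentiableOn_logKernel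
  have hzU := hk.diag_mem_logDomain hz
  have hg : ∀ i j z, (z, star z) ∈ logDomain Ω k →
      bergmanMetric Ω z i j = mixedHessian (logKernel k) (z, star z) i j := fun i j z hz => by
    rw [hk.bergmanMetric_eq hΩ hK hz.1.1]
  rw [kahlerCurvature, polarCurvature, hk.bergmanMetric_eq hΩ hK hz,
    wirtinger_eq_of_eqOn hU ((hG i j).dirDeriv hU _)
      (fun z hz => wirtingerBar_eq_of_eqOn hU (hG i j) (hg i j) hz l) hzU s]
  congr 1
  refine Finset.sum_congr rfl fun a _ => Finset.sum_congr rfl fun b _ => ?_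
  rw [wirtinger_eq_of_eqOn hU (hG i b) (hg i b) hzU s,
    wirtingerBar_eq_of_eqOn hU (hG a j) (hg a j) hzU l]

end HolomorphicKernel

section Symmetry

variable {L : (Fin n → ℂ) × (Fin n → ℂ) → ℂ} {U : Set ((Fin n → ℂ) × (Fin n → ℂ))}
  {z : (Fin n → ℂ) × (Fin n → ℂ)}

theorem dirFst_mixedHessian_comm (hU : IsOpen U) (hL : DifferentiableOn ℂ L U) (hz : z ∈ U)
    (i j s : Fin n) : dirDeriv (dirFst s) (fun z => mixedHessian L z i j) z
      = dirDeriv (dirFst i) (fun z => mixedHessian L z s j) z :=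
  dirDeriv_comm hU (hL.dirDeriv hU _) hz _ _

theorem dirSnd_mixedHessian_comm (hU : IsOpen U) (hL : DifferentiableOn ℂ L U) (hz : z ∈ U)
    (i j l : Fin n) : dirDeriv (dirSnd l) (fun z => mixedHessian L z i j) z
      = dirDeriv (dirSnd j) (fun z => mixedHessian L z i l) z := by
  have h : ∀ j, EqOn (fun z => mixedHessian L z i j) (dirDeriv (dirSnd j) (dirDeriv (dirFst i) L))
      U := fun j z hz => dirDeriv_comm hU hL hz _ _
  rw [dirDeriv_congr hU (h j) hz, dirDeriv_congr hU (h l) hz]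
  exact dirDeriv_comm hU (hL.dirDeriv hU _) hz _ _

/-- The Kähler symmetries come from commuting the derivatives of the potential; they allow the
sectional curvature to determine the whole tensor. -/
theorem polarCurvature_comm_fst (hU : IsOpen U) (hL : DifferentiableOn ℂ L U) (hz : z ∈ U)
    (i j s l : Fin n) : polarCurvature L i j s l z = polarCurvature L s j i l z := by
  have hG := differentiableOn_mixedHessian hU hL
  rw [polarCurvature, polarCurvature]
  congr 1
  · rw [dirDeriv_comm hU (hG i j) hz, dirDeriv_comm hU (hG s j) hz,
      dirDeriv_congr hU (fun z hz => dirFst_mixedHessian_comm hU hL hz i j s) hz]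
  · exact Finset.sum_congr rfl fun a _ => Finset.sum_congr rfl fun b _ => by
      rw [dirFst_mixedHessian_comm hU hL hz]

theorem polarCurvature_comm_snd (hU : IsOpen U) (hL : DifferentiableOn ℂ L U) (hz : z ∈ U)
    (i j s l : Fin n) : polarCurvature L i j s l z = polarCurvature L i l s j z := by
  rw [polarCurvature, polarCurvature]
  congr 1
  · rw [dirDeriv_congr hU (fun z hz => dirSnd_mixedHessian_comm hU hL hz i j l) hz]
  · exact Finset.sum_congr rfl fun a _ => Finset.sum_congr rfl fun b _ => by
      rw [dirSnd_mixedHessian_comm hU hL hz]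

theorem differentiableOn_polarCurvature (hU : IsOpen U) (hL : DifferentiableOn ℂ L U)
    (hdet : ∀ z ∈ U, (mixedHessian L z).det ≠ 0) (i j s l : Fin n) :
    DifferentiableOn ℂ (polarCurvature L i j s l) U := by
  have hG := differentiableOn_mixedHessian hU hL
  refine (((hG i j).dirDeriv hU _).dirDeriv hU _).neg.add ?_
  exact DifferentiableOn.fun_sum fun a _ => DifferentiableOn.fun_sum fun b _ =>
    ((DifferentiableOn.matrix_inv_apply hG hdet b a).mul ((hG i b).dirDeriv hU _)).mul
      ((hG a j).dirDeriv hU _)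

end Symmetry

/-- The factor 2 is the reason why sectional curvature `c` corresponds to the constant `c / 2` in
the tensor equation. -/
theorem sum_biquadratic_eq {ι : Type*} [Fintype ι] (G : ι → ι → ℂ) (lam : ℂ) (a b : ι → ℂ) :
    ∑ i, ∑ j, ∑ s, ∑ l, lam * (G i j * G s l + G i l * G s j) * a i * b j * a s * b l
      = 2 * lam * (∑ i, ∑ j, G i j * a i * b j) ^ 2 := by
  have h1 : ∑ i, ∑ j, ∑ s, ∑ l, G i j * G s l * a i * b j * a s * b l
      = (∑ i, ∑ j, G i j * a i * b j) ^ 2 := by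
    rw [sq]
    simp only [Finset.sum_mul, Finset.mul_sum]
    exact Finset.sum_congr rfl fun i _ => Finset.sum_congr rfl fun j _ =>
      Finset.sum_congr rfl fun s _ => Finset.sum_congr rfl fun l _ => by ring
  have h2 : ∑ i, ∑ j, ∑ s, ∑ l, G i l * G s j * a i * b j * a s * b l
      = ∑ i, ∑ j, ∑ s, ∑ l, G i j * G s l * a i * b j * a s * b l := by
    refine Finset.sum_congr rfl fun i _ => ?_
    rw [Finset.sum_comm]
    conv_rhs => rw [Finset.sum_comm]
    refine Finset.sum_congr rfl fun s _ => ?_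
    rw [Finset.sum_comm]
    exact Finset.sum_congr rfl fun j _ => Finset.sum_congr rfl fun l _ => by ring
  have h3 : ∑ i, ∑ j, ∑ s, ∑ l, lam * (G i j * G s l + G i l * G s j) * a i * b j * a s * b l
      = lam * (∑ i, ∑ j, ∑ s, ∑ l, G i j * G s l * a i * b j * a s * b l
        + ∑ i, ∑ j, ∑ s, ∑ l, G i l * G s j * a i * b j * a s * b l) := by
    simp only [Finset.mul_sum, ← Finset.sum_add_distrib]
    exact Finset.sum_congr rfl fun i _ => Finset.sum_congr rfl fun j _ =>
      Finset.sum_congr rfl fun s _ => Finset.sum_congr rfl fun l _ => by ring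
  rw [h3, h2, h1]; ring

namespace HolomorphicKernel

/-- On the diagonal, constant holomorphic sectional curvature determines the curvature tensor. -/
theorem polarCurvature_diag_eq [CompleteSpace H] (hk : HolomorphicKernel Ω k) (hΩ : IsOpen Ω)
    (hK : ∀ z ∈ Ω, ∀ w ∈ Ω, bergmanKernel Ω z w = inner ℂ (k z) (k w)) {c : ℂ} {z : Fin n → ℂ}
    (hz : z ∈ Ω) (hc : ∀ v : Fin n → ℂ, v ≠ 0 →
      holomorphicSectionalCurvature (bergmanMetric Ω) z v = c) (i j s l : Fin n) :
    polarCurvature (logKernel k) i j s l (z, star z)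
      = c / 2 * (mixedHessian (logKernel k) (z, star z) i j
          * mixedHessian (logKernel k) (z, star z) s l
        + mixedHessian (logKernel k) (z, star z) i l
          * mixedHessian (logKernel k) (z, star z) s j) := by
  have hU := hk.isOpen_logDomain hΩ
  have hL := hk.differentiableOn_logKernel
  have hzU := hk.diag_mem_logDomain hz
  set G := mixedHessian (logKernel k) (z, star z) with hG
  rw [← sub_eq_zero]
  refine eq_zero_of_biquadratic_eq_zero (T := fun i j s l =>
    polarCurvature (logKernel k) i j s l (z, star z) - c / 2 * (G i j * G s l + G i l * G s j))
    (fun i j s l => ?_) (fun i j s l => ?_) (fun a b => ?_) i j s l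
  · rw [polarCurvature_comm_fst hU hL hzU]; ring
  · rw [polarCurvature_comm_snd hU hL hzU]; ring
  · have key : ∀ a b : Fin n → ℂ, ∑ i, ∑ j, ∑ s, ∑ l,
        (polarCurvature (logKernel k) i j s l (z, star z)
          - c / 2 * (G i j * G s l + G i l * G s j)) * a i * b j * a s * b l
        = ∑ i, ∑ j, ∑ s, ∑ l, polarCurvature (logKernel k) i j s l (z, star z)
            * a i * b j * a s * b l - c * (∑ i, ∑ j, G i j * a i * b j) ^ 2 := by
      intro a b
      have h := sum_biquadratic_eq G (c / 2) a b
      rw [show 2 * (c / 2) = c by ring] at h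
      rw [← h]
      simp only [← Finset.sum_sub_distrib, sub_mul]
    -- The curvature hypothesis concerns only b = ā. The expression is polynomial in (a, b), so its
    -- vanishing on that antidiagonal forces it to vanish identically.
    let f : (Fin n → ℂ) × (Fin n → ℂ) → ℂ := fun w => ∑ i, ∑ j, ∑ s, ∑ l,
        (polarCurvature (logKernel k) i j s l (z, star z)
          - c / 2 * (G i j * G s l + G i l * G s j)) * w.1 i * w.2 j * w.1 s * w.2 l
    have hf : Differentiable ℂ f := by fun_prop
    have hdiag : ∀ v : Fin n → ℂ, f (v, star v) = 0 := by
      intro v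
      simp only [f]
      rw [key]
      by_cases hv : v = 0
      · subst hv; simp
      · have h1 := hc v hv
        have h2 := hk.sum_mixedHessian_logKernel_ne_zero hΩ hz hv
        rw [holomorphicSectionalCurvature, hk.bergmanMetric_eq hΩ hK hz,
          div_eq_iff (pow_ne_zero 2 h2)] at h1
        simp only [hk.kahlerCurvature_eq hΩ hK hz] at h1
        rw [sub_eq_zero]
        exact h1
    set R := 3 * (‖(a, b)‖ + 1) with hR
    refine eq_zero_of_diag_eq_zero (f := f) (p := 0) (r := R) hf.differentiableOn
      (fun x _ => hdiag x) (a, b) ?_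
    rw [star_zero, show ((0 : Fin n → ℂ), (0 : Fin n → ℂ)) = 0 from rfl, mem_ball_zero_iff]
    rw [hR]; linarith

/-- The Bergman metric, polarized, has constant curvature near the diagonal. -/
theorem exists_hasConstantCurvatureOn [CompleteSpace H] (hk : HolomorphicKernel Ω k)
    (hΩ : IsOpen Ω) (hK : ∀ z ∈ Ω, ∀ w ∈ Ω, bergmanKernel Ω z w = inner ℂ (k z) (k w)) {c : ℂ}
    (hc : ∀ z ∈ Ω, ∀ v : Fin n → ℂ, v ≠ 0 →
      holomorphicSectionalCurvature (bergmanMetric Ω) z v = c) {p : Fin n → ℂ} (hp : p ∈ Ω) :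
    ∃ r > 0, ball (p, star p) r ⊆ logDomain Ω k ∧
      (∀ z ∈ ball (p, star p) r, (mixedHessian (logKernel k) z).det ≠ 0) ∧
      HasConstantCurvatureOn (logKernel k) (c / 2) (ball (p, star p) r) := by
  have hU := hk.isOpen_logDomain hΩ
  have hL := hk.differentiableOn_logKernel
  have hG := differentiableOn_mixedHessian hU hL
  have hdetc := (DifferentiableOn.matrix_det hG).continuousOn
  have hO : IsOpen (logDomain Ω k ∩ (fun z => (mixedHessian (logKernel k) z).det) ⁻¹' {0}ᶜ) :=
    hdetc.isOpen_inter_preimage hU isOpen_compl_singleton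
  obtain ⟨R, hR, hball⟩ := Metric.isOpen_iff.mp hO (p, star p)
    ⟨hk.diag_mem_logDomain hp, hk.det_mixedHessian_logKernel_ne_zero hΩ hp⟩
  -- Continuation from the antidiagonal reduces the radius by the factor 3 of
  -- `eq_zero_of_diag_eq_zero`.
  have hsub : ball (p, star p) (R / 3) ⊆ ball (p, star p) R := ball_subset_ball (by linarith)
  have hBU : ball (p, star p) R ⊆ logDomain Ω k := fun z hz => (hball hz).1
  refine ⟨R / 3, by positivity, hsub.trans hBU, fun z hz => (hball (hsub hz)).2,
    fun z hz i j s l => ?_⟩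
  have hcd := (differentiableOn_polarCurvature isOpen_ball (hL.mono hBU)
    (fun z hz => (hball hz).2) i j s l).fun_sub
    (((((hG i j).mul (hG s l)).fun_add ((hG i l).mul (hG s j))).const_mul (c / 2)).mono hBU)
  have := eq_zero_of_diag_eq_zero hcd (fun x hx => ?_) z hz
  · exact sub_eq_zero.mp this
  · have hx' : x ∈ Ω := by
      refine (hBU (mem_ball_mk.mpr ⟨hx, ?_⟩ : (x, star x) ∈ _)).1.1
      rw [mem_ball, dist_eq_norm, ← star_sub, norm_star, ← dist_eq_norm]
      exact hx
    rw [sub_eq_zero]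
    exact hk.polarCurvature_diag_eq hΩ hK hx' (hc x hx') i j s l

end HolomorphicKernel

end LogKernel

/-! ### Calabi's diastasis. -/

section NormalizedPotential

variable {n : ℕ} {p q : Fin n → ℂ} {r : ℝ}

theorem hasFDerivAt_snd_slice (z : (Fin n → ℂ) × (Fin n → ℂ)) :
    HasFDerivAt (fun z : (Fin n → ℂ) × (Fin n → ℂ) => (p, z.2))
      ((0 : (Fin n → ℂ) × (Fin n → ℂ) →L[ℂ] (Fin n → ℂ)).prod
        (ContinuousLinearMap.snd ℂ (Fin n → ℂ) (Fin n → ℂ))) z :=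
  (hasFDerivAt_const p z).prodMk hasFDerivAt_snd

theorem slice_snd_mem_ball {z : (Fin n → ℂ) × (Fin n → ℂ)} (hz : z ∈ ball (p, q) r) :
    (p, z.2) ∈ ball (p, q) r := by
  have hr : 0 < r := nonempty_ball.mp ⟨_, hz⟩
  exact mem_ball_mk.mpr ⟨mem_ball_self hr, (mem_ball_mk.mp (show (z.1, z.2) ∈ _ from hz)).2⟩

theorem DifferentiableOn.comp_slice_snd {f : (Fin n → ℂ) × (Fin n → ℂ) → ℂ}
    (hf : DifferentiableOn ℂ f (ball (p, q) r)) :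
    DifferentiableOn ℂ (fun z => f (p, z.2)) (ball (p, q) r) :=
  hf.comp (fun z _ => (hasFDerivAt_snd_slice z).differentiableAt.differentiableWithinAt)
    fun _ hz => slice_snd_mem_ball hz

theorem dirDeriv_dirSnd_comp_slice_snd {f : (Fin n → ℂ) × (Fin n → ℂ) → ℂ}
    (hf : DifferentiableOn ℂ f (ball (p, q) r)) {z : (Fin n → ℂ) × (Fin n → ℂ)}
    (hz : z ∈ ball (p, q) r) (k : Fin n) :
    dirDeriv (dirSnd k) (fun z => f (p, z.2)) z = dirDeriv (dirSnd k) f (p, z.2) :=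
  dirDeriv_comp_clm (g := fun z : (Fin n → ℂ) × (Fin n → ℂ) => (p, z.2))
    (hf.differentiableAt (isOpen_ball.mem_nhds (slice_snd_mem_ball hz)))
    (hasFDerivAt_snd_slice z) _

theorem dirDeriv_dirFst_comp_slice_snd {f : (Fin n → ℂ) × (Fin n → ℂ) → ℂ}
    (hf : DifferentiableOn ℂ f (ball (p, q) r)) {z : (Fin n → ℂ) × (Fin n → ℂ)}
    (hz : z ∈ ball (p, q) r) (k : Fin n) :
    dirDeriv (dirFst k) (fun z => f (p, z.2)) z = 0 := by
  rw [dirDeriv_comp_clm (g := fun z : (Fin n → ℂ) × (Fin n → ℂ) => (p, z.2))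
    (hf.differentiableAt (isOpen_ball.mem_nhds (slice_snd_mem_ball hz)))
    (hasFDerivAt_snd_slice z)]
  exact map_zero (fderiv ℂ f (p, z.2))

/-- The potential with the same mixed derivatives as `L` that vanishes on the slices through
`(p, q)`. -/
def normalizedPotential (L : (Fin n → ℂ) × (Fin n → ℂ) → ℂ) (p q : Fin n → ℂ)
    (z : (Fin n → ℂ) × (Fin n → ℂ)) : ℂ :=
  L z - L (z.1, q) - L (p, z.2) + L (p, q)

variable {L : (Fin n → ℂ) × (Fin n → ℂ) → ℂ} {z : (Fin n → ℂ) × (Fin n → ℂ)}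

theorem differentiableOn_normalizedPotential (hL : DifferentiableOn ℂ L (ball (p, q) r)) :
    DifferentiableOn ℂ (normalizedPotential L p q) (ball (p, q) r) :=
  ((hL.fun_sub hL.comp_slice).fun_sub hL.comp_slice_snd).add_const _

theorem dirSnd_normalizedPotential (hL : DifferentiableOn ℂ L (ball (p, q) r))
    (hz : z ∈ ball (p, q) r) (j : Fin n) : dirDeriv (dirSnd j) (normalizedPotential L p q) z
      = dirDeriv (dirSnd j) L z - dirDeriv (dirSnd j) L (p, z.2) := by
  have hn : ball (p, q) r ∈ 𝓝 z := isOpen_ball.mem_nhds hz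
  have h1 := hL.differentiableAt hn
  have h2 := hL.comp_slice.differentiableAt hn
  have h3 := hL.comp_slice_snd.differentiableAt hn
  have : dirDeriv (dirSnd j) (normalizedPotential L p q) z = _ :=
    dirDeriv_add ((h1.fun_sub h2).fun_sub h3) (differentiableAt_const (L (p, q))) (dirSnd j)
  rw [this, dirDeriv_const, dirDeriv_sub (h1.fun_sub h2) h3, dirDeriv_sub h1 h2,
    dirDeriv_dirSnd_comp_slice hL hz, dirDeriv_dirSnd_comp_slice_snd hL hz]
  ring

theorem dirFst_normalizedPotential (hL : DifferentiableOn ℂ L (ball (p, q) r))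
    (hz : z ∈ ball (p, q) r) (j : Fin n) : dirDeriv (dirFst j) (normalizedPotential L p q) z
      = dirDeriv (dirFst j) L z - dirDeriv (dirFst j) L (z.1, q) := by
  have hn : ball (p, q) r ∈ 𝓝 z := isOpen_ball.mem_nhds hz
  have h1 := hL.differentiableAt hn
  have h2 := hL.comp_slice.differentiableAt hn
  have h3 := hL.comp_slice_snd.differentiableAt hn
  have : dirDeriv (dirFst j) (normalizedPotential L p q) z = _ :=
    dirDeriv_add ((h1.fun_sub h2).fun_sub h3) (differentiableAt_const (L (p, q))) (dirFst j)
  rw [this, dirDeriv_const, dirDeriv_sub (h1.fun_sub h2) h3, dirDeriv_sub h1 h2,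
    dirDeriv_dirFst_comp_slice hL hz, dirDeriv_dirFst_comp_slice_snd hL hz]
  ring

/-- Each subtracted term depends on only one of the two variables. -/
theorem mixedHessian_normalizedPotential (hL : DifferentiableOn ℂ L (ball (p, q) r))
    (hz : z ∈ ball (p, q) r) :
    mixedHessian (normalizedPotential L p q) z = mixedHessian L z := by
  ext i j
  have hn : ball (p, q) r ∈ 𝓝 z := isOpen_ball.mem_nhds hz
  have hd := hL.dirDeriv isOpen_ball (dirSnd j)
  rw [mixedHessian, Matrix.of_apply,
    dirDeriv_congr isOpen_ball (fun z hz => dirSnd_normalizedPotential hL hz j) hz,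
    dirDeriv_sub (hd.differentiableAt hn) (hd.comp_slice_snd.differentiableAt hn),
    dirDeriv_dirFst_comp_slice_snd hd hz, sub_zero]
  rfl

theorem HasConstantCurvatureOn.normalizedPotential (hL : DifferentiableOn ℂ L (ball (p, q) r))
    {lam : ℂ} (h : HasConstantCurvatureOn L lam (ball (p, q) r)) :
    HasConstantCurvatureOn (normalizedPotential L p q) lam (ball (p, q) r) := by
  intro z hz i j s l
  have hG : ∀ i j, EqOn (fun z => mixedHessian (_root_.normalizedPotential L p q) z i j)
      (fun z => mixedHessian L z i j) (ball (p, q) r) := fun i j z hz =>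
    congrFun (congrFun (mixedHessian_normalizedPotential hL hz) i) j
  rw [mixedHessian_normalizedPotential hL hz, ← h z hz i j s l]
  congr 1
  · rw [dirDeriv_congr isOpen_ball (fun z hz => dirDeriv_congr isOpen_ball (hG i j) hz _) hz]
  · refine Finset.sum_congr rfl fun a _ => Finset.sum_congr rfl fun b _ => ?_
    rw [dirDeriv_congr isOpen_ball (hG i b) hz, dirDeriv_congr isOpen_ball (hG a j) hz]

end NormalizedPotential

/-! ### The power series of the model kernel. -/

section ModelSeries

/-- The Taylor coefficients of `(1 + lam * s) ^ (1 / lam)`, or of `exp s` when `lam = 0`. -/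
noncomputable def modelCoeff (lam : ℝ) : ℕ → ℝ
  | 0 => 1
  | m + 1 => (1 - lam * m) / (m + 1) * modelCoeff lam m

/-- The primitive of `exp (lam * ·)` vanishing at `0`. -/
noncomputable def modelExp (lam : ℝ) (d : ℂ) : ℂ :=
  if lam = 0 then d else (Complex.exp (lam * d) - 1) / lam

theorem modelExp_zero (lam : ℝ) : modelExp lam 0 = 0 := by
  simp [modelExp]

theorem hasDerivAt_modelExp (lam : ℝ) (d : ℂ) :
    HasDerivAt (modelExp lam) (Complex.exp (lam * d)) d := by
  unfold modelExp
  by_cases h : lam = 0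
  · simp only [h, if_true, Complex.ofReal_zero, zero_mul, Complex.exp_zero]
    exact hasDerivAt_id d
  · have h' : (lam : ℂ) ≠ 0 := by exact_mod_cast h
    simp only [h, if_false]
    have := ((((hasDerivAt_id d).const_mul (lam : ℂ)).cexp).sub_const 1).div_const (lam : ℂ)
    refine this.congr_deriv ?_
    simp [h']

theorem modelCoeff_zero_eq (m : ℕ) : modelCoeff 0 m = 1 / m.factorial := by
  induction m with
  | zero => simp [modelCoeff]
  | succ m ih =>
    rw [modelCoeff, ih, Nat.factorial_succ]
    push_cast
    have : (m.factorial : ℝ) ≠ 0 := by positivity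
    field_simp
    simp

theorem ringChoose_succ (a : ℂ) (m : ℕ) :
    ((m : ℂ) + 1) * Ring.choose a (m + 1) = (a - m) * Ring.choose a m := by
  have h1 := Ring.descPochhammer_eq_factorial_smul_choose a (m + 1)
  have h2 := Ring.descPochhammer_eq_factorial_smul_choose a m
  rw [descPochhammer_succ_right, Polynomial.smeval_mul, h2] at h1
  simp only [Polynomial.smeval_sub, Polynomial.smeval_X, Polynomial.smeval_natCast, pow_one,
    pow_zero, nsmul_eq_mul, mul_one, Nat.factorial_succ] at h1
  have h3 : (m.factorial : ℂ) ≠ 0 := by exact_mod_cast m.factorial_ne_zero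
  apply mul_left_cancel₀ h3
  push_cast at h1
  linear_combination - h1

theorem modelCoeff_eq_choose {lam : ℝ} (h : lam ≠ 0) (m : ℕ) :
    (modelCoeff lam m : ℂ) = Ring.choose ((lam : ℂ)⁻¹) m * (lam : ℂ) ^ m := by
  have h' : (lam : ℂ) ≠ 0 := by exact_mod_cast h
  induction m with
  | zero => simp [modelCoeff]
  | succ m ih =>
    have h1 : ((m : ℂ) + 1) ≠ 0 := by exact_mod_cast m.succ_ne_zero
    have h2 := ringChoose_succ ((lam : ℂ)⁻¹) m
    rw [modelCoeff]
    push_cast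
    rw [ih]
    apply mul_left_cancel₀ h1
    have h3 : ((m : ℂ) + 1) * (Ring.choose ((lam : ℂ)⁻¹) (m + 1) * (lam : ℂ) ^ (m + 1))
        = (((m : ℂ) + 1) * Ring.choose ((lam : ℂ)⁻¹) (m + 1)) * (lam : ℂ) ^ (m + 1) := by ring
    rw [h3, h2]
    field_simp
    ring

/-- For λ ≠ 0, exp d = (1 + λ e(d))^(1/λ) with 1 + λ e(d) = exp(λd). The radius ensures both
convergence of the binomial series and |Im(λd)| < π, so that the principal logarithm returns λd. -/
theorem exists_hasSum_modelCoeff (lam : ℝ) : ∃ ρ > 0, ∀ d : ℂ, ‖d‖ < ρ →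
    HasSum (fun m => (modelCoeff lam m : ℂ) * modelExp lam d ^ m) (Complex.exp d) := by
  by_cases h : lam = 0
  · subst h
    refine ⟨1, one_pos, fun d _ => ?_⟩
    have := NormedSpace.expSeries_div_hasSum_exp (𝔸 := ℂ) d
    rw [← Complex.exp_eq_exp_ℂ] at this
    refine this.congr_fun ?_
    intro m
    simp [modelCoeff_zero_eq, modelExp, div_eq_inv_mul]
  · have h' : (lam : ℂ) ≠ 0 := by exact_mod_cast h
    have hc : ContinuousAt (fun d : ℂ => Complex.exp (lam * d)) 0 := by fun_prop
    have h1 : ∀ᶠ d in 𝓝 (0 : ℂ), ‖Complex.exp (lam * d) - 1‖ < 1 := by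
      have : Tendsto (fun d : ℂ => ‖Complex.exp (lam * d) - 1‖) (𝓝 0) (𝓝 0) :=
        Continuous.tendsto' (by fun_prop) _ _ (by simp)
      exact this.eventually_lt_const one_pos
    have h2 : ∀ᶠ d in 𝓝 (0 : ℂ), ‖(lam : ℂ) * d‖ < Real.pi := by
      have : Tendsto (fun d : ℂ => ‖(lam : ℂ) * d‖) (𝓝 0) (𝓝 0) :=
        Continuous.tendsto' (by fun_prop) _ _ (by simp)
      exact this.eventually_lt_const Real.pi_pos
    obtain ⟨ρ, hρ, hρ'⟩ := Metric.eventually_nhds_iff_ball.mp (h1.and h2)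
    refine ⟨ρ, hρ, fun d hd => ?_⟩
    obtain ⟨h3, h4⟩ := hρ' d (by simpa using hd)
    have h5 := Complex.one_add_cpow_hasFPowerSeriesOnBall_zero (a := (lam : ℂ)⁻¹)
    have h6 := h5.hasSum (y := Complex.exp (lam * d) - 1) (by
      rw [← ENNReal.ofReal_one, Metric.eball_ofReal]; simpa using h3)
    have him := abs_lt.mp ((Complex.abs_im_le_norm _).trans_lt h4)
    rw [zero_add, add_sub_cancel, Complex.cpow_def_of_ne_zero (Complex.exp_ne_zero _),
      Complex.log_exp him.1 him.2.le, mul_comm (lam : ℂ) d, mul_assoc, mul_inv_cancel₀ h',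
      mul_one] at h6
    refine h6.congr_fun ?_
    intro m
    rw [binomialSeries_apply, modelCoeff_eq_choose h]
    simp only [modelExp, h, if_false, List.ofFn_const, List.prod_replicate, smul_eq_mul, div_pow]
    field_simp

end ModelSeries

/-! ### Local form of the kernel. -/

section LocalStructure

variable {n : ℕ} {Ω : Set (Fin n → ℂ)} {H : Type*} [NormedAddCommGroup H] [InnerProductSpace ℂ H]
  {k : (Fin n → ℂ) → H}

theorem star_mem_ball_iff {p x : Fin n → ℂ} {r : ℝ} : star x ∈ ball (star p) r ↔ x ∈ ball p r := by
  rw [mem_ball, mem_ball, dist_eq_norm, dist_eq_norm, ← star_sub, norm_star]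

/-- Local normal form of a kernel whose metric has constant holomorphic sectional curvature: in
the holomorphic coordinates `V`, its normalization is the model kernel. -/
theorem HolomorphicKernel.exists_localStructure [CompleteSpace H] (hk : HolomorphicKernel Ω k)
    (hΩ : IsOpen Ω) (hK : ∀ z ∈ Ω, ∀ w ∈ Ω, bergmanKernel Ω z w = inner ℂ (k z) (k w)) {lam : ℝ}
    (hc : ∀ z ∈ Ω, ∀ v : Fin n → ℂ, v ≠ 0 →
      holomorphicSectionalCurvature (bergmanMetric Ω) z v = 2 * lam) {p : Fin n → ℂ} (hp : p ∈ Ω) :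
    ∃ r > 0, ∃ V : (Fin n → ℂ) → Fin n → ℂ, ∃ A : Matrix (Fin n) (Fin n) ℂ,
      ball p r ⊆ Ω ∧ DifferentiableOn ℂ V (ball (star p) r) ∧ V (star p) = 0 ∧
      (∀ a, fderiv ℂ V (star p) a = 0 → a = 0) ∧
      ∀ x ∈ ball p r, ∀ y ∈ ball (star p) r,
        polarKernel k (x, star p) ≠ 0 ∧ polarKernel k (p, y) ≠ 0 ∧
        HasSum (fun m => (modelCoeff lam m : ℂ) *
          (∑ s, ∑ t, conj (V (star x) s) * A s t * V y t) ^ m)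
          (polarKernel k (x, y) * polarKernel k (p, star p) /
            (polarKernel k (x, star p) * polarKernel k (p, y))) := by
  obtain ⟨R, hR, hRU, hdet, hcurv⟩ := hk.exists_hasConstantCurvatureOn hΩ hK hc hp
  rw [mul_div_cancel_left₀ _ (two_ne_zero' ℂ)] at hcurv
  obtain ⟨ρ, hρ, hsum⟩ := exists_hasSum_modelCoeff lam
  set q := star p with hq
  set L := logKernel k with hLdef
  set D := normalizedPotential L p q with hDdef
  have hL : DifferentiableOn ℂ L (ball (p, q) R) := hk.differentiableOn_logKernel.mono hRU
  have hD : DifferentiableOn ℂ D (ball (p, q) R) := differentiableOn_normalizedPotential hL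
  -- The ball is shrunk so that the values of `D` lie where the model series converges.
  obtain ⟨r, hr, hrR, hrD⟩ : ∃ r > 0, r ≤ R ∧ ∀ z ∈ ball (p, q) r, ‖D z‖ < ρ := by
    have h1 : ContinuousAt D (p, q) := hD.continuousOn.continuousAt (ball_mem_nhds _ hR)
    have h2 : D (p, q) = 0 := by simp [hDdef, normalizedPotential]
    have h3 : ∀ᶠ z in 𝓝 (p, q), ‖D z‖ < ρ := h1.norm.eventually_lt_const (by simpa [h2] using hρ)
    obtain ⟨r, hr, h⟩ := Metric.eventually_nhds_iff_ball.mp h3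
    exact ⟨min r R, lt_min hr hR, min_le_right _ _, fun z hz => h z (ball_subset_ball
      (min_le_left _ _) hz)⟩
  have hsub : ball (p, q) r ⊆ ball (p, q) R := ball_subset_ball hrR
  have hLr := hL.mono hsub
  have hDr := hD.mono hsub
  have hqr : q ∈ ball q r := mem_ball_self hr
  have hpr : p ∈ ball p r := mem_ball_self hr
  have hpq : (p, q) ∈ ball (p, q) r := mem_ball_self hr
  have hG : ∀ z ∈ ball (p, q) r, mixedHessian D z = mixedHessian L z := fun z hz =>
    mixedHessian_normalizedPotential hLr hz
  -- The coordinates are the x-gradient of the diastasis at x = p, which is one of the two factors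
  -- in the normal form.
  let V : (Fin n → ℂ) → Fin n → ℂ := fun y t => dirDeriv (dirFst t) D (p, y)
  have hVt : ∀ t, ∀ y ∈ ball q r, HasFDerivAt (fun y => V y t)
      ((fderiv ℂ (dirDeriv (dirFst t) D) (p, y)).comp
        (ContinuousLinearMap.inr ℂ (Fin n → ℂ) (Fin n → ℂ))) y := by
    intro t y hy
    have hxy : (p, y) ∈ ball (p, q) r := mem_ball_mk.mpr ⟨hpr, hy⟩
    exact ((hDr.dirDeriv isOpen_ball (dirFst t)).differentiableAt
      (isOpen_ball.mem_nhds hxy)).hasFDerivAt.comp (f := fun y => (p, y)) y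
      (hasFDerivAt_prodMk_right p y)
  have hV : ∀ y ∈ ball q r, HasFDerivAt V (ContinuousLinearMap.pi fun t =>
      (fderiv ℂ (dirDeriv (dirFst t) D) (p, y)).comp
        (ContinuousLinearMap.inr ℂ (Fin n → ℂ) (Fin n → ℂ))) y := fun y hy =>
    hasFDerivAt_pi.mpr fun t => hVt t y hy
  have hVy : ∀ y ∈ ball q r, ∀ t, V y t = (polarKernel k (p, y))⁻¹
      * inner ℂ (kernelDeriv k t q) (k (star y)) - (polarKernel k (p, q))⁻¹
      * inner ℂ (kernelDeriv k t q) (k (star q)) := by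
    intro y hy t
    have hxy : (p, y) ∈ ball (p, q) r := mem_ball_mk.mpr ⟨hpr, hy⟩
    refine (dirFst_normalizedPotential hLr hxy t).trans ?_
    rw [hk.dirFst_logKernel hΩ (hRU (hsub hxy)), hk.dirFst_logKernel hΩ (hRU (hsub hpq))]
  -- Hermitian symmetry of the kernel identifies the other factor of the normal form with the
  -- conjugate of the same coordinates.
  have hW : ∀ x ∈ ball p r, ∀ s, dirDeriv (dirSnd s) D (x, q) = conj (V (star x) s) := by
    intro x hx s
    have hxq : (x, q) ∈ ball (p, q) r := mem_ball_mk.mpr ⟨hx, hqr⟩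
    have hconj : ∀ x, conj (polarKernel k (p, star x)) = polarKernel k (x, q) := fun x => by
      simp [polarKernel, hq]
    rw [hVy _ (star_mem_ball_iff.mpr hx), map_sub, map_mul, map_mul, map_inv₀, map_inv₀,
      inner_conj_symm, inner_conj_symm, hconj, hconj]
    refine (dirSnd_normalizedPotential hLr hxq s).trans ?_
    rw [hk.dirSnd_logKernel hΩ (hRU (hsub hxq)), hk.dirSnd_logKernel hΩ (hRU (hsub hpq))]
    simp [hq]
  refine ⟨r, hr, V, (mixedHessian D (p, q))⁻¹, fun x hx => ?_, fun y hy => ?_, ?_, ?_, ?_⟩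
  · exact (hRU (hsub (mem_ball_mk.mpr ⟨hx, hqr⟩ : (x, q) ∈ _))).1.1
  · exact (hV y hy).differentiableAt.differentiableWithinAt
  · ext t
    rw [hVy q hqr, sub_self]; rfl
  · intro a ha
    -- The differential of `V` at `star p` is given by the metric matrix, which is invertible.
    rw [(hV q hqr).fderiv] at ha
    refine Matrix.eq_zero_of_mulVec_eq_zero (M := mixedHessian D (p, q)) ?_ ?_
    · rw [hG _ hpq]; exact hdet _ (hsub hpq)
    · ext t
      have h1 := congrFun ha t
      have h2 := fderiv_snd_eq_sum (dirDeriv (dirFst t) D) (p, q) a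
      have h3 : fderiv ℂ (dirDeriv (dirFst t) D) (p, q) (0, a) = 0 := h1
      rw [h3] at h2
      simp only [Matrix.mulVec, dotProduct, Pi.zero_apply]
      rw [h2]
      refine Finset.sum_congr rfl fun j _ => ?_
      rw [dirDeriv_comm isOpen_ball hDr hpq, smul_eq_mul, mul_comm]
      rfl
  · intro x hx y hy
    have hxq : (x, q) ∈ ball (p, q) r := mem_ball_mk.mpr ⟨hx, hqr⟩
    have hpy : (p, y) ∈ ball (p, q) r := mem_ball_mk.mpr ⟨hpr, hy⟩
    have hxy : (x, y) ∈ ball (p, q) r := mem_ball_mk.mpr ⟨hx, hy⟩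
    have h0 : ∀ z ∈ ball (p, q) r, polarKernel k z ≠ 0 := fun z hz =>
      Complex.slitPlane_ne_zero (hRU (hsub hz)).2
    refine ⟨h0 _ hxq, h0 _ hpy, ?_⟩
    have hexp : Complex.exp (D (x, y)) = polarKernel k (x, y) * polarKernel k (p, q) /
        (polarKernel k (x, q) * polarKernel k (p, y)) := by
      simp only [hDdef, normalizedPotential, hLdef, logKernel]
      rw [Complex.exp_add, Complex.exp_sub, Complex.exp_sub, Complex.exp_log (h0 _ hxy),
        Complex.exp_log (h0 _ hxq), Complex.exp_log (h0 _ hpy), Complex.exp_log (h0 _ hpq)]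
      field_simp
    have hnf := normalForm_of_hasConstantCurvatureOn (lam := (lam : ℂ)) (e := modelExp lam) hDr
      (fun x hx => by simp [hDdef, normalizedPotential])
      (fun y hy => by simp [hDdef, normalizedPotential])
      (fun z hz => by rw [hG z hz]; exact hdet z (hsub hz))
      (HasConstantCurvatureOn.normalizedPotential hLr fun z hz => hcurv z (hsub hz))
      (modelExp_zero lam) (hasDerivAt_modelExp lam) hx hy
    have := hsum _ (hrD _ hxy)
    rw [hnf, hexp] at this
    refine this.congr_fun fun m => ?_
    simp only [hW x hx]
    rfl

end LocalStructure

/-! ### Inverting the coordinates. -/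

section InverseFunction

/-- Holomorphic inverse function theorem on `ℂⁿ`. -/
theorem exists_localInverse_of_fderiv_injective {n : ℕ} {V : (Fin n → ℂ) → Fin n → ℂ}
    {q : Fin n → ℂ} {r : ℝ} (hr : 0 < r) (hV : DifferentiableOn ℂ V (ball q r)) (h0 : V q = 0)
    (hinj : ∀ a, fderiv ℂ V q a = 0 → a = 0) :
    ∃ ρ > 0, ∃ Y : (Fin n → ℂ) → Fin n → ℂ, DifferentiableOn ℂ Y (ball 0 ρ) ∧ Y 0 = q ∧
      (∀ a, fderiv ℂ Y 0 a = 0 → a = 0) ∧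
      (∀ τ ∈ ball 0 ρ, Y τ ∈ ball q r ∧ V (Y τ) = τ) ∧ ∀ᶠ y in 𝓝 q, Y (V y) = y := by
  have hq : q ∈ ball q r := mem_ball_self hr
  have hC : ContDiffAt ℂ 1 V q :=
    (hV.contDiffOn_one_of_isOpen isOpen_ball).contDiffAt (isOpen_ball.mem_nhds hq)
  have hinj' : Function.Injective (fderiv ℂ V q) := (injective_iff_map_eq_zero _).mpr hinj
  let V' : (Fin n → ℂ) ≃L[ℂ] (Fin n → ℂ) :=
    (LinearEquiv.ofInjectiveEndo (fderiv ℂ V q : (Fin n → ℂ) →ₗ[ℂ] Fin n → ℂ)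
      hinj').toContinuousLinearEquiv
  have hV' : HasFDerivAt V (V' : (Fin n → ℂ) →L[ℂ] Fin n → ℂ) q := by
    have : (V' : (Fin n → ℂ) →L[ℂ] Fin n → ℂ) = fderiv ℂ V q := by ext; rfl
    rw [this]
    exact (hV.differentiableAt (isOpen_ball.mem_nhds hq)).hasFDerivAt
  have hs : HasStrictFDerivAt V (V' : (Fin n → ℂ) →L[ℂ] Fin n → ℂ) q :=
    hC.hasStrictFDerivAt' hV' one_ne_zero
  have hY : ContDiffAt ℂ 1 (hC.localInverse hV' one_ne_zero) (V q) :=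
    hC.to_localInverse hV' one_ne_zero
  have hYs : HasStrictFDerivAt (hC.localInverse hV' one_ne_zero)
      (V'.symm : (Fin n → ℂ) →L[ℂ] Fin n → ℂ) (V q) := hs.to_localInverse
  have hYq : hC.localInverse hV' one_ne_zero (V q) = q := hs.localInverse_apply_image
  have hYr : ∀ᶠ τ in 𝓝 (V q), V (hC.localInverse hV' one_ne_zero τ) = τ :=
    hs.eventually_right_inverse
  have hYl : ∀ᶠ y in 𝓝 q, hC.localInverse hV' one_ne_zero (V y) = y :=
    hs.eventually_left_inverse
  generalize hC.localInverse hV' one_ne_zero = Y at *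
  rw [h0] at *
  have h1 : ∀ᶠ τ in 𝓝 0, ContDiffAt ℂ 1 Y τ := hY.eventually (by simp)
  have h2 : ∀ᶠ τ in 𝓝 0, Y τ ∈ ball q r :=
    hY.continuousAt (by rw [hYq]; exact ball_mem_nhds q hr)
  obtain ⟨ρ, hρ, h⟩ := Metric.eventually_nhds_iff_ball.mp (h1.and (h2.and hYr))
  refine ⟨ρ, hρ, Y, fun τ hτ => ((h τ hτ).1.differentiableAt one_ne_zero).differentiableWithinAt,
    hYq, fun a ha => ?_, fun τ hτ => (h τ hτ).2, hYl⟩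
  rw [hYs.hasFDerivAt.fderiv] at ha
  exact V'.symm.map_eq_zero_iff.mp ha

end InverseFunction

/-! ### Taylor coefficients of holomorphic curves in a Hilbert space. -/

section TaylorCoefficients

/-- Uniqueness of the coefficients of a power series. -/
theorem coeff_eq_of_hasSum {a b : ℕ → ℂ} {f : ℂ → ℂ} {R : ℝ} (hR : 0 < R)
    (ha : ∀ t ∈ ball (0 : ℂ) R, HasSum (fun m => a m * t ^ m) (f t))
    (hb : ∀ t ∈ ball (0 : ℂ) R, HasSum (fun m => b m * t ^ m) (f t)) (m : ℕ) : a m = b m := by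
  have key : ∀ c : ℕ → ℂ, (∀ t ∈ ball (0 : ℂ) R, HasSum (fun m => c m * t ^ m) (f t)) →
      HasFPowerSeriesAt f (FormalMultilinearSeries.ofScalars ℂ c) 0 := by
    intro c hc
    rw [hasFPowerSeriesAt_iff]
    filter_upwards [ball_mem_nhds (0 : ℂ) hR] with t ht
    simpa [FormalMultilinearSeries.coeff_ofScalars, mul_comm] using hc t ht
  have := congrArg (fun p => p.coeff m) ((key a ha).eq_formalMultilinearSeries (key b hb))
  simpa [FormalMultilinearSeries.coeff_ofScalars] using this

variable {H : Type*} [NormedAddCommGroup H] [InnerProductSpace ℂ H]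

/-- The Taylor coefficients at `0` of a curve. -/
noncomputable def taylorVec (φ : ℂ → H) (m : ℕ) : H :=
  ((m.factorial : ℂ))⁻¹ • iteratedDeriv m φ 0

theorem taylorVec_zero (φ : ℂ → H) : taylorVec φ 0 = φ 0 := by
  simp [taylorVec]

theorem hasSum_taylorVec [CompleteSpace H] {φ : ℂ → H} {R : ℝ}
    (hφ : DifferentiableOn ℂ φ (ball 0 R)) {t : ℂ} (ht : t ∈ ball 0 R) :
    HasSum (fun m => t ^ m • taylorVec φ m) (φ t) := by
  refine (Complex.hasSum_taylorSeries_on_ball hφ ht).congr_fun fun m => ?_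
  rw [taylorVec, sub_zero, smul_comm]

theorem hasSum_inner_taylorVec [CompleteSpace H] {φ : ℂ → H} {R : ℝ}
    (hφ : DifferentiableOn ℂ φ (ball 0 R)) (f : H) {t : ℂ} (ht : t ∈ ball 0 R) :
    HasSum (fun m => inner ℂ f (taylorVec φ m) * t ^ m) (inner ℂ f (φ t)) := by
  refine ((innerSL ℂ f).hasSum (hasSum_taylorVec hφ ht)).congr_fun fun m => ?_
  simp [mul_comm]

theorem inner_taylorVec_eq [CompleteSpace H] {φ : ℂ → H} {R : ℝ} (hR : 0 < R)
    (hφ : DifferentiableOn ℂ φ (ball 0 R)) {f : H} {b : ℕ → ℂ}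
    (hb : ∀ t ∈ ball (0 : ℂ) R, HasSum (fun m => b m * t ^ m) (inner ℂ f (φ t))) (m : ℕ) :
    inner ℂ f (taylorVec φ m) = b m :=
  coeff_eq_of_hasSum hR (fun _ ht => hasSum_inner_taylorVec hφ f ht) hb m

end TaylorCoefficients

/-! ### Growth of the model coefficients. -/

section ModelEstimates

theorem modelCoeff_one (lam : ℝ) : modelCoeff lam 1 = 1 := by
  simp [modelCoeff]

/-- The ratio of consecutive coefficients, (1 - λm)/(m + 1), is a weighted mean of 1 and -λ. It is
therefore at least the smaller of the two, and at most the larger one in the companion bound. -/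
theorem pow_le_modelCoeff {lam : ℝ} (h : lam < 0) (m : ℕ) : min 1 (-lam) ^ m ≤ modelCoeff lam m := by
  have hν : 0 < min 1 (-lam) := lt_min one_pos (neg_pos.mpr h)
  induction m with
  | zero => simp [modelCoeff]
  | succ m ih =>
    rw [pow_succ', modelCoeff]
    refine mul_le_mul ?_ ih (by positivity) (div_nonneg ?_ (by positivity))
    · rw [le_div_iff₀ (by positivity)]
      have h1 := min_le_left 1 (-lam)
      have h2 := mul_le_mul_of_nonneg_right (min_le_right 1 (-lam)) m.cast_nonneg
      linarith
    · nlinarith [(Nat.cast_nonneg m : (0 : ℝ) ≤ m)]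

theorem modelCoeff_le_pow {lam : ℝ} (h : lam < 0) (m : ℕ) : modelCoeff lam m ≤ max 1 (-lam) ^ m := by
  have hμ : 1 ≤ max 1 (-lam) := le_max_left _ _
  have hν : 0 < min 1 (-lam) := lt_min one_pos (neg_pos.mpr h)
  induction m with
  | zero => simp [modelCoeff]
  | succ m ih =>
    rw [pow_succ', modelCoeff]
    refine mul_le_mul ?_ ih ((pow_pos hν m).le.trans (pow_le_modelCoeff h m)) (by positivity)
    rw [div_le_iff₀ (by positivity)]
    have h2 := mul_le_mul_of_nonneg_right (le_max_right 1 (-lam)) m.cast_nonneg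
    linarith

/-- Taking roots as m → ∞ removes the constant `M`. -/
theorem le_of_forall_pow_succ_le_mul_pow {a b M : ℝ} (hb : 0 ≤ b)
    (h : ∀ m : ℕ, a ^ (m + 1) ≤ M * b ^ (m + 1)) : a ≤ b := by
  by_contra! hab
  rcases hb.eq_or_lt with rfl | hb
  · have := h 0
    simp at this
    linarith
  · obtain ⟨m, hm⟩ := pow_unbounded_of_one_lt M ((one_lt_div hb).mpr hab)
    have h1 := h m
    rw [← div_le_iff₀ (by positivity), ← div_pow] at h1
    exact absurd (hm.trans_le ((pow_le_pow_right₀ ((one_lt_div hb).mpr hab).le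
      m.le_succ).trans h1)) (lt_irrefl _)

/-- If the weights `modelCoeff lam m * N ^ m` are nonnegative and do not decrease faster than
geometrically, then `lam` is negative. -/
theorem neg_of_modelCoeff_ratio {lam N δ : ℝ} (hN : 0 ≤ N) (hδ : 0 < δ)
    (h : ∀ m, δ * (modelCoeff lam m * N ^ m) ^ 2
      ≤ (modelCoeff lam m * N ^ m) * (modelCoeff lam (m + 1) * N ^ (m + 1))) : lam < 0 := by
  by_contra! hlam
  -- For λ > 0 the coefficients need not be positive a priori. The inequality in `h` forces
  -- positivity inductively, starting from the value 1 at m = 0.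
  have hpos : ∀ m, 0 < modelCoeff lam m * N ^ m := by
    intro m
    induction m with
    | zero => simp [modelCoeff]
    | succ m ih =>
      have h1 : 0 < δ * (modelCoeff lam m * N ^ m) ^ 2 := by positivity
      exact pos_of_mul_pos_right (h1.trans_le (h m)) ih.le
  -- The ratio of consecutive weights is at most N/(m + 1) when λ ≥ 0, which drops below δ for this
  -- `m`.
  obtain ⟨m, hm⟩ := exists_nat_gt (N / δ)
  have h1 := h m
  have h2 : δ * (modelCoeff lam m * N ^ m) ≤ (1 - lam * m) / (m + 1) * modelCoeff lam m * N ^ (m + 1) := by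
    refine le_of_mul_le_mul_left ?_ (hpos m)
    rw [modelCoeff] at h1
    linarith
  have h3 : δ ≤ (1 - lam * m) / (m + 1) * N := by
    refine le_of_mul_le_mul_right ?_ (hpos m)
    refine h2.trans_eq ?_
    ring
  have h4 : δ * (m + 1) ≤ (1 - lam * m) * N := by
    rwa [div_mul_eq_mul_div, le_div_iff₀ (by positivity)] at h3
  rw [div_lt_iff₀ hδ] at hm
  have h5 : 0 ≤ lam * m * N := by positivity
  nlinarith

end ModelEstimates

/-! ### Estimates along model curves. -/

section ModelCurve

variable {n : ℕ} {Ω : Set (Fin n → ℂ)} {H : Type*} [NormedAddCommGroup H] [InnerProductSpace ℂ H]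
  {k : (Fin n → ℂ) → H} {lam : ℝ} {p : Fin n → ℂ} {N : ℂ} {y : ℂ → Fin n → ℂ} {φ : ℂ → H}

/-- A holomorphic curve `y` through `star p` along which the normalized reproducing vectors
`φ t = k (star (y t)) / ⟪k p, k (star (y t))⟫` have the Gram matrix of the model kernel. -/
structure IsModelCurve (Ω : Set (Fin n → ℂ)) (k : (Fin n → ℂ) → H) (lam : ℝ) (p : Fin n → ℂ)
    (N : ℂ) (y : ℂ → Fin n → ℂ) (φ : ℂ → H) : Prop where
  mem : ∀ t ∈ ball (0 : ℂ) 2, star (y t) ∈ Ω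
  zero : y 0 = star p
  differentiableOn : DifferentiableOn ℂ y (ball 0 2)
  differentiableOn_normalized : DifferentiableOn ℂ φ (ball 0 2)
  eq_smul : ∀ t ∈ ball (0 : ℂ) 2, φ t = (polarKernel k (p, y t))⁻¹ • k (star (y t))
  hasSum_left : ∀ᶠ x in 𝓝 p, ∃ h l : ℂ, ∀ t ∈ ball (0 : ℂ) 2,
    HasSum (fun m => (h * modelCoeff lam m * l ^ m) * t ^ m) (inner ℂ (k x) (φ t))
  hasSum_self : ∀ s ∈ ball (0 : ℂ) 2, ∀ t ∈ ball (0 : ℂ) 2,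
    HasSum (fun m => (((‖k p‖ ^ 2)⁻¹ : ℝ) * modelCoeff lam m * N ^ m * conj s ^ m) * t ^ m)
      (inner ℂ (φ s) (φ t))

namespace IsModelCurve

theorem mem_center (hy : IsModelCurve Ω k lam p N y φ) : p ∈ Ω := by
  have := hy.mem 0 (mem_ball_self two_pos)
  rwa [hy.zero, star_star] at this

variable [CompleteSpace H]

/-- Comparing coefficients in the first variable of the Gram function leaves a single monomial in
`t`. In particular the Taylor coefficients are mutually orthogonal. -/
theorem inner_taylorVec_left (hy : IsModelCurve Ω k lam p N y φ) {t : ℂ}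
    (ht : t ∈ ball (0 : ℂ) 2) (m : ℕ) : inner ℂ (taylorVec φ m) (φ t)
      = conj (((‖k p‖ ^ 2)⁻¹ : ℝ) * modelCoeff lam m * N ^ m) * t ^ m := by
  have := inner_taylorVec_eq two_pos hy.differentiableOn_normalized (hy.hasSum_self t ht) m
  rw [← inner_conj_symm, this]
  simp

/-- The norm is the coefficient of tᵐ in the preceding monomial. -/
theorem norm_taylorVec_sq_complex (hy : IsModelCurve Ω k lam p N y φ) (m : ℕ) :
    ((‖taylorVec φ m‖ ^ 2 : ℝ) : ℂ)
      = conj (((‖k p‖ ^ 2)⁻¹ : ℝ) * modelCoeff lam m * N ^ m) := by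
  set B := conj (((‖k p‖ ^ 2)⁻¹ : ℝ) * modelCoeff lam m * N ^ m)
  have := inner_taylorVec_eq (f := taylorVec φ m) (b := fun l => if l = m then B else 0) two_pos
    hy.differentiableOn_normalized (fun t ht => by
      rw [hy.inner_taylorVec_left ht]
      change HasSum _ (B * t ^ m)
      have := hasSum_single (f := fun l => (if l = m then B else 0) * t ^ l) m
        fun l hl => by simp [hl]
      simpa using this) m
  rw [inner_self_eq_norm_sq_to_K] at this
  simpa using this

/-- The number `N` is a priori complex. The case m = 1 of the norm formula shows that it is real and
nonnegative. -/
theorem coe_eq (hy : IsModelCurve Ω k lam p N y φ) (hk : HolomorphicKernel Ω k) :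
    N = ((‖k p‖ ^ 2 * ‖taylorVec φ 1‖ ^ 2 : ℝ) : ℂ) := by
  have h1 := congrArg conj (hy.norm_taylorVec_sq_complex 1)
  have h2 : (‖k p‖ : ℂ) ≠ 0 := by
    exact_mod_cast norm_ne_zero_iff.mpr (hk.ne_zero p hy.mem_center)
  rw [Complex.conj_ofReal, Complex.conj_conj, modelCoeff_one] at h1
  push_cast at h1 ⊢
  rw [h1]
  field_simp

theorem ofReal_re (hy : IsModelCurve Ω k lam p N y φ) (hk : HolomorphicKernel Ω k) :
    (N.re : ℂ) = N := by
  rw [hy.coe_eq hk, Complex.ofReal_re]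

theorem re_nonneg (hy : IsModelCurve Ω k lam p N y φ) (hk : HolomorphicKernel Ω k) :
    0 ≤ N.re := by
  rw [hy.coe_eq hk, Complex.ofReal_re]; positivity

theorem norm_taylorVec_sq (hy : IsModelCurve Ω k lam p N y φ) (hk : HolomorphicKernel Ω k)
    (m : ℕ) : ‖taylorVec φ m‖ ^ 2 = (‖k p‖ ^ 2)⁻¹ * (modelCoeff lam m * N.re ^ m) := by
  have h1 := hy.norm_taylorVec_sq_complex m
  rw [← hy.ofReal_re hk, ← Complex.ofReal_pow, ← Complex.ofReal_mul, ← Complex.ofReal_mul,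
    Complex.conj_ofReal, Complex.ofReal_inj] at h1
  rw [h1, mul_assoc]

/-- Multiplication by a coordinate bounds consecutive Taylor coefficients. -/
theorem norm_deriv_mul_norm_sq_le (hy : IsModelCurve Ω k lam p N y φ) {j : Fin n} {C : ℝ}
    (hC : ∀ f : H, ∃ g : H, ‖g‖ ≤ C * ‖f‖ ∧
      ∀ z ∈ Ω, inner ℂ (k z) g = (z j - p j) * inner ℂ (k z) f) (m : ℕ) :
    ‖deriv (fun t => y t j) 0‖ * ‖taylorVec φ m‖ ^ 2
      ≤ C * ‖taylorVec φ m‖ * ‖taylorVec φ (m + 1)‖ := by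
  obtain ⟨g, hg, hgz⟩ := hC (taylorVec φ m)
  set B : ℂ := ((‖taylorVec φ m‖ ^ 2 : ℝ) : ℂ) with hB
  let ψ : ℂ → ℂ := fun t => y t j - star p j
  have hψ : DifferentiableOn ℂ ψ (ball 0 2) :=
    (differentiableOn_pi.mp hy.differentiableOn j).sub_const _
  have hgφ : ∀ t ∈ ball (0 : ℂ) 2, inner ℂ g (φ t) = ψ t * (B * t ^ m) := by
    intro t ht
    rw [hB, hy.norm_taylorVec_sq_complex, ← hy.inner_taylorVec_left ht, hy.eq_smul t ht,
      inner_smul_right, inner_smul_right, ← inner_conj_symm, hgz _ (hy.mem t ht), map_mul,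
      inner_conj_symm]
    simp [ψ]
    ring
  -- The pairing of `g` with the curve is `ψ t * (B * t ^ m)` and `ψ 0 = 0`, so the coefficient at
  -- `m + 1` is the derivative of the j-th coordinate of the curve times ‖φₘ‖².
  have h1 := inner_taylorVec_eq (f := g)
    (b := fun l => if m ≤ l then taylorVec ψ (l - m) * B else 0) two_pos
    hy.differentiableOn_normalized (fun t ht => by
      rw [hgφ t ht]
      have h2 := (hasSum_taylorVec hψ ht).mul_right (B * t ^ m)
      refine ((add_left_injective m).hasSum_iff ?_).mp (h2.congr_fun fun l => ?_)
      · intro l hl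
        have : ¬ m ≤ l := fun h => hl ⟨l - m, by simp [h]⟩
        simp [this]
      · simp [pow_add]
        ring) (m + 1)
  have h3 : taylorVec ψ 1 = deriv (fun t => y t j) 0 := by
    simp [taylorVec, ψ]
  simp only [le_add_iff_nonneg_right, zero_le, if_true, add_tsub_cancel_left, h3] at h1
  have h4 : ‖B‖ = ‖taylorVec φ m‖ ^ 2 := by
    rw [hB, Complex.norm_real, Real.norm_of_nonneg (by positivity)]
  rw [← h4, ← norm_mul, ← h1]
  exact (norm_inner_le_norm _ _).trans (mul_le_mul_of_nonneg_right hg (norm_nonneg _))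

/-- Multiplication by a bounded coordinate that is not stationary along the curve bounds ‖φₘ₊₁‖
below by a fixed multiple of ‖φₘ‖. This is incompatible with the decay of the model coefficients
when λ ≥ 0. -/
theorem lam_neg (hy : IsModelCurve Ω k lam p N y φ) (hk : HolomorphicKernel Ω k) {j : Fin n}
    (hj : deriv (fun t => y t j) 0 ≠ 0) : lam < 0 := by
  obtain ⟨C, hC0, hC⟩ := hk.exists_mul j (p j)
  have hK : 0 < (‖k p‖ ^ 2)⁻¹ := by
    have := norm_pos_iff.mpr (hk.ne_zero p hy.mem_center)
    positivity
  have hj' : 0 < ‖deriv (fun t => y t j) 0‖ := norm_pos_iff.mpr hj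
  -- The denominator is `C ^ 2 + 1` rather than `C ^ 2` so that it is positive even if `C = 0`.
  refine neg_of_modelCoeff_ratio (N := N.re)
    (δ := ‖deriv (fun t => y t j) 0‖ ^ 2 / (C ^ 2 + 1)) (hy.re_nonneg hk) (by positivity) fun m => ?_
  have h1 := pow_le_pow_left₀ (by positivity) (hy.norm_deriv_mul_norm_sq_le hC m) 2
  rw [mul_pow, mul_pow, mul_pow, hy.norm_taylorVec_sq hk, hy.norm_taylorVec_sq hk] at h1
  have hnn : 0 ≤ ‖taylorVec φ m‖ ^ 2 * ‖taylorVec φ (m + 1)‖ ^ 2 := by positivity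
  rw [hy.norm_taylorVec_sq hk, hy.norm_taylorVec_sq hk] at hnn
  generalize modelCoeff lam m * N.re ^ m = a at *
  generalize modelCoeff lam (m + 1) * N.re ^ (m + 1) = b at *
  have h5 : (‖k p‖ ^ 2)⁻¹ ^ 2 * (‖deriv (fun t => y t j) 0‖ ^ 2 * a ^ 2)
      ≤ (‖k p‖ ^ 2)⁻¹ ^ 2 * ((C ^ 2 + 1) * (a * b)) := by nlinarith
  have h6 := le_of_mul_le_mul_left h5 (by positivity)
  rw [div_mul_eq_mul_div, div_le_iff₀ (by positivity)]
  linarith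

/-- Near `p` the pairings are h cₘ lᵐ with h and l depending on the point. Eliminating h and l
leaves a polynomial identity between functions holomorphic on Ω, which continues to the whole domain
without any division. -/
theorem inner_taylorVec_mul_pow (hy : IsModelCurve Ω k lam p N y φ) (hk : HolomorphicKernel Ω k)
    (hΩ : IsOpen Ω) (hc : IsPreconnected Ω) {z : Fin n → ℂ} (hz : z ∈ Ω) (m : ℕ) :
    inner ℂ (k z) (taylorVec φ (m + 1)) * inner ℂ (k z) (φ 0) ^ m
      = modelCoeff lam (m + 1) * inner ℂ (k z) (taylorVec φ 1) ^ (m + 1) := by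
  have h := eqOn_zero_of_isPreconnected_of_eventually hΩ hc (a := p)
    (f := fun z => inner ℂ (k z) (taylorVec φ (m + 1)) * inner ℂ (k z) (φ 0) ^ m
      - modelCoeff lam (m + 1) * inner ℂ (k z) (taylorVec φ 1) ^ (m + 1))
    (((hk.differentiableOn_inner _).mul ((hk.differentiableOn_inner _).pow m)).sub
      (((hk.differentiableOn_inner _).pow (m + 1)).const_mul _)) hy.mem_center ?_ z hz
  · exact sub_eq_zero.mp h
  · filter_upwards [hy.hasSum_left] with x ⟨h, l, hx⟩
    have hx' := inner_taylorVec_eq two_pos hy.differentiableOn_normalized hx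
    have h0 := hx' 0
    rw [taylorVec_zero] at h0
    rw [hx', hx', h0, modelCoeff_one]
    simp [modelCoeff]
    ring

/-- The bound is uniform in `z` although ‖k z‖ is not bounded: ‖k z‖ appears only in a constant that
disappears after taking m-th roots. -/
theorem norm_inner_le (hy : IsModelCurve Ω k lam p N y φ) (hk : HolomorphicKernel Ω k)
    (hΩ : IsOpen Ω) (hc : IsPreconnected Ω) (hlam : lam < 0)
    (hN : max 1 (-lam) * √(N.re / min 1 (-lam)) ≤ 1 / 4) {z : Fin n → ℂ} (hz : z ∈ Ω)
    (h0 : inner ℂ (k z) (φ 0) ≠ 0) :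
    ‖inner ℂ (k z) (φ 1)‖ ≤ 4 / 3 * ‖inner ℂ (k z) (φ 0)‖ := by
  set e : ℕ → ℝ := fun m => ‖inner ℂ (k z) (taylorVec φ m)‖ with he
  set A := ‖inner ℂ (k z) (φ 0)‖ with hA
  set ν := min 1 (-lam) with hνd
  set μ := max 1 (-lam) with hμd
  have hν : 0 < ν := lt_min one_pos (neg_pos.mpr hlam)
  have hμ : 0 < μ := one_pos.trans_le (le_max_left _ _)
  have hA0 : 0 < A := norm_pos_iff.mpr h0
  have hcp : ∀ m, 0 < modelCoeff lam m := fun m => (pow_pos hν m).trans_le (pow_le_modelCoeff hlam m)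
  have hNr := hy.re_nonneg hk
  have hpow : ∀ m, e (m + 1) * A ^ m = modelCoeff lam (m + 1) * e 1 ^ (m + 1) := by
    intro m
    have := congrArg norm (hy.inner_taylorVec_mul_pow hk hΩ hc hz m)
    rwa [norm_mul, norm_mul, norm_pow, norm_pow, Complex.norm_real,
      Real.norm_of_nonneg (hcp _).le] at this
  have he2 : ∀ m, e m ^ 2 ≤ ‖k z‖ ^ 2 * ((‖k p‖ ^ 2)⁻¹ * (modelCoeff lam m * N.re ^ m)) := by
    intro m
    rw [← hy.norm_taylorVec_sq hk, ← mul_pow]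
    exact pow_le_pow_left₀ (norm_nonneg _) (norm_inner_le_norm _ _) 2
  -- Square the continued identity, bound the left side by Cauchy–Schwarz and cancel one factor
  -- cₘ₊₁. The lower bound νᵐ⁺¹ ≤ cₘ₊₁ replaces the remaining one, and the powers m + 1 are then
  -- compared.
  have h1 : ν * e 1 ^ 2 ≤ N.re * A ^ 2 := by
    refine le_of_forall_pow_succ_le_mul_pow (M := ‖k z‖ ^ 2 * (‖k p‖ ^ 2)⁻¹ / A ^ 2)
      (by positivity) fun m => ?_
    have h2 : modelCoeff lam (m + 1) * (modelCoeff lam (m + 1) * (e 1 ^ 2) ^ (m + 1))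
        ≤ modelCoeff lam (m + 1) * (‖k z‖ ^ 2 * (‖k p‖ ^ 2)⁻¹ * N.re ^ (m + 1) * (A ^ 2) ^ m) := by
      calc _ = (modelCoeff lam (m + 1) * e 1 ^ (m + 1)) ^ 2 := by ring
        _ = e (m + 1) ^ 2 * (A ^ 2) ^ m := by rw [← hpow]; ring
        _ ≤ _ := (mul_le_mul_of_nonneg_right (he2 (m + 1)) (by positivity)).trans_eq (by ring)
    have h3 := le_of_mul_le_mul_left h2 (hcp _)
    calc (ν * e 1 ^ 2) ^ (m + 1) = ν ^ (m + 1) * (e 1 ^ 2) ^ (m + 1) := mul_pow _ _ _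
      _ ≤ modelCoeff lam (m + 1) * (e 1 ^ 2) ^ (m + 1) :=
        mul_le_mul_of_nonneg_right (pow_le_modelCoeff hlam _) (by positivity)
      _ ≤ _ := h3
      _ = _ := by field_simp; ring
  have h2 : e 1 ≤ √(N.re / ν) * A := by
    refine le_of_sq_le_sq ?_ (by positivity)
    rw [mul_pow, Real.sq_sqrt (by positivity), div_mul_eq_mul_div, le_div_iff₀ hν]
    linarith
  have h3 : ∀ m, e m ≤ (1 / 4) ^ m * A := by
    rintro (_ | m)
    · simp [he, taylorVec_zero, hA]
    · refine le_of_mul_le_mul_right ?_ (pow_pos hA0 m)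
      calc e (m + 1) * A ^ m = modelCoeff lam (m + 1) * e 1 ^ (m + 1) := hpow m
        _ ≤ μ ^ (m + 1) * (√(N.re / ν) * A) ^ (m + 1) :=
          mul_le_mul (modelCoeff_le_pow hlam _) (pow_le_pow_left₀ (norm_nonneg _) h2 _)
            (by positivity) (by positivity)
        _ = (μ * √(N.re / ν)) ^ (m + 1) * A ^ (m + 1) := by ring
        _ ≤ (1 / 4) ^ (m + 1) * A ^ (m + 1) :=
          mul_le_mul_of_nonneg_right (pow_le_pow_left₀ (by positivity) hN _) (by positivity)
        _ = _ := by ring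
  -- The value at t = 1, which lies inside the disc of radius 2, is the sum of the pairings; the
  -- geometric series of ratio 1/4 has sum 4/3.
  have h4 := hasSum_inner_taylorVec hy.differentiableOn_normalized (k z)
    (show (1 : ℂ) ∈ ball (0 : ℂ) 2 by simp)
  have h5 := (hasSum_geometric_of_lt_one (r := 1 / 4) (by norm_num) (by norm_num)).mul_right A
  refine (h4.norm_le_of_bounded h5 fun m => ?_).trans_eq (by norm_num)
  simpa using h3 m

end IsModelCurve

end ModelCurve

/-! ### The bound on the kernel. -/

section KernelBound

variable {n : ℕ} {Ω : Set (Fin n → ℂ)} {H : Type*} [NormedAddCommGroup H] [InnerProductSpace ℂ H]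
  {k : (Fin n → ℂ) → H} {lam : ℝ} {p : Fin n → ℂ}

theorem polarKernel_star (k : (Fin n → ℂ) → H) (x y : Fin n → ℂ) :
    polarKernel k (star y, star x) = conj (polarKernel k (x, y)) := by
  simp [polarKernel]

theorem polarKernel_center (k : (Fin n → ℂ) → H) (p : Fin n → ℂ) :
    polarKernel k (p, star p) = ((‖k p‖ ^ 2 : ℝ) : ℂ) := by
  rw [polarKernel, star_star, inner_self_eq_norm_sq_to_K]
  simp

/-- The images of lines under the inverse of the coordinates `V` are model curves. -/
theorem isModelCurve_of_localStructure (hk : HolomorphicKernel Ω k) {r ρ : ℝ}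
    (hr : 0 < r) (hrΩ : ball p r ⊆ Ω) {V Y : (Fin n → ℂ) → Fin n → ℂ}
    {A : Matrix (Fin n) (Fin n) ℂ}
    (hV : ∀ x ∈ ball p r, ∀ y ∈ ball (star p) r,
        polarKernel k (x, star p) ≠ 0 ∧ polarKernel k (p, y) ≠ 0 ∧
        HasSum (fun m => (modelCoeff lam m : ℂ) *
          (∑ s, ∑ t, conj (V (star x) s) * A s t * V y t) ^ m)
          (polarKernel k (x, y) * polarKernel k (p, star p) /
            (polarKernel k (x, star p) * polarKernel k (p, y))))
    (hYd : DifferentiableOn ℂ Y (ball 0 ρ)) (hY0 : Y 0 = star p)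
    (hYV : ∀ τ ∈ ball 0 ρ, Y τ ∈ ball (star p) r ∧ V (Y τ) = τ) {v : Fin n → ℂ}
    (hv : ‖v‖ < ρ / 2) :
    IsModelCurve Ω k lam p (∑ s, ∑ t, conj (v s) * A s t * v t) (fun t : ℂ => Y (t • v))
      (fun t => (polarKernel k (p, Y (t • v)))⁻¹ • k (star (Y (t • v)))) := by
  -- Half the radius of the inverse chart suffices for the parameter disc of radius 2.
  have hline : ∀ t ∈ ball (0 : ℂ) 2, t • v ∈ ball 0 ρ := by
    intro t ht
    rw [mem_ball_zero_iff] at ht ⊢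
    rw [norm_smul]
    nlinarith [norm_nonneg t, norm_nonneg v]
  have hYt : ∀ t ∈ ball (0 : ℂ) 2, Y (t • v) ∈ ball (star p) r := fun t ht =>
    (hYV _ (hline t ht)).1
  have hst : ∀ y ∈ ball (star p) r, star y ∈ ball p r := fun y hy =>
    star_mem_ball_iff.mp (by rwa [star_star])
  have hpr : p ∈ ball p r := mem_ball_self hr
  have hcurve : DifferentiableOn ℂ (fun t : ℂ => Y (t • v)) (ball 0 2) :=
    hYd.comp (by fun_prop) hline
  have hκ : DifferentiableOn ℂ (fun t : ℂ => k (star (Y (t • v)))) (ball 0 2) :=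
    hk.differentiableOn_star.comp hcurve fun t ht => hrΩ (hst _ (hYt t ht))
  have hK0 : polarKernel k (p, star p) ≠ 0 := (hV p hpr _ (mem_ball_self hr)).2.1
  refine ⟨fun t ht => hrΩ (hst _ (hYt t ht)), by simp [hY0], hcurve, ?_, fun t _ => rfl, ?_, ?_⟩
  · refine DifferentiableOn.smul (DifferentiableOn.inv ?_ fun t ht => (hV p hpr _ (hYt t ht)).2.1) hκ
    exact (innerSL ℂ (k p)).differentiable.comp_differentiableOn hκ
  · filter_upwards [ball_mem_nhds p hr] with x hx
    refine ⟨polarKernel k (x, star p) / polarKernel k (p, star p),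
      ∑ s, ∑ t, conj (V (star x) s) * A s t * v t, fun t ht => ?_⟩
    obtain ⟨h1, h2, h3⟩ := hV x hx _ (hYt t ht)
    have h4 := h3.mul_left (polarKernel k (x, star p) / polarKernel k (p, star p))
    have h5 : inner ℂ (k x) ((polarKernel k (p, Y (t • v)))⁻¹ • k (star (Y (t • v))))
        = polarKernel k (x, star p) / polarKernel k (p, star p) *
          (polarKernel k (x, Y (t • v)) * polarKernel k (p, star p) /
            (polarKernel k (x, star p) * polarKernel k (p, Y (t • v)))) := by
      rw [inner_smul_right]
      change _ * polarKernel k (x, Y (t • v)) = _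
      field_simp
    rw [h5]
    refine h4.congr_fun fun m => ?_
    have h6 : ∑ s, ∑ j, conj (V (star x) s) * A s j * V (Y (t • v)) j
        = (∑ s, ∑ j, conj (V (star x) s) * A s j * v j) * t := by
      rw [(hYV _ (hline t ht)).2]
      simp only [Finset.sum_mul, Pi.smul_apply, smul_eq_mul]
      exact Finset.sum_congr rfl fun s _ => Finset.sum_congr rfl fun j _ => by ring
    rw [h6]
    ring
  · intro s hs t ht
    obtain ⟨h1, h2, h3⟩ := hV _ (hst _ (hYt s hs)) _ (hYt t ht)
    have h4 := h3.mul_left (((‖k p‖ ^ 2)⁻¹ : ℝ) : ℂ)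
    have h5 : inner ℂ ((polarKernel k (p, Y (s • v)))⁻¹ • k (star (Y (s • v))))
        ((polarKernel k (p, Y (t • v)))⁻¹ • k (star (Y (t • v))))
        = ((‖k p‖ ^ 2)⁻¹ : ℝ) *
          (polarKernel k (star (Y (s • v)), Y (t • v)) * polarKernel k (p, star p) /
            (polarKernel k (star (Y (s • v)), star p) * polarKernel k (p, Y (t • v)))) := by
      rw [inner_smul_right, inner_smul_left, map_inv₀, ← polarKernel_star,
        Complex.ofReal_inv, ← polarKernel_center]
      change _ * (_ * polarKernel k (star (Y (s • v)), Y (t • v))) = _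
      field_simp
    rw [h5]
    refine h4.congr_fun fun m => ?_
    have h6 : ∑ i, ∑ j, conj (V (star (star (Y (s • v)))) i) * A i j * V (Y (t • v)) j
        = (∑ i, ∑ j, conj (v i) * A i j * v j) * conj s * t := by
      rw [star_star, (hYV _ (hline t ht)).2, (hYV _ (hline s hs)).2]
      simp only [Finset.sum_mul, Pi.smul_apply, smul_eq_mul, map_mul]
      exact Finset.sum_congr rfl fun s _ => Finset.sum_congr rfl fun j _ => by ring
    rw [h6]
    ring

/-- If the metric of a holomorphic kernel has constant holomorphic sectional curvature, the
reproducing vectors near `p` are dominated by the one at `p`. -/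
theorem HolomorphicKernel.eventually_norm_inner_le [CompleteSpace H]
    (hk : HolomorphicKernel Ω k) (hn : 1 ≤ n) (hΩ : IsOpen Ω) (hconn : IsPreconnected Ω)
    (hK : ∀ z ∈ Ω, ∀ w ∈ Ω, bergmanKernel Ω z w = inner ℂ (k z) (k w))
    (hc : ∀ z ∈ Ω, ∀ v : Fin n → ℂ, v ≠ 0 →
      holomorphicSectionalCurvature (bergmanMetric Ω) z v = 2 * lam) (hp : p ∈ Ω) :
    ∀ᶠ ζ in 𝓝 p, ∀ z ∈ Ω, ‖inner ℂ (k z) (k ζ)‖ ≤ 2 * ‖inner ℂ (k z) (k p)‖ := by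
  obtain ⟨r, hr, V, A, hrΩ, hVd, hV0, hVinj, hV⟩ := hk.exists_localStructure hΩ hK hc hp
  obtain ⟨ρ, hρ, Y, hYd, hY0, hYinj, hYV, hYl⟩ :=
    exists_localInverse_of_fderiv_injective hr hVd hV0 hVinj
  have hcurve := fun {v : Fin n → ℂ} (hv : ‖v‖ < ρ / 2) =>
    isModelCurve_of_localStructure hk hr hrΩ hV hYd hY0 hYV hv
  -- Any nonzero small direction serves; `n ≥ 1` is what makes one available. The differential of
  -- `Y` is injective, so some coordinate of the curve has nonzero derivative.
  have hlam : lam < 0 := by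
    let v : Fin n → ℂ := fun _ => ((ρ / 4 : ℝ) : ℂ)
    have hv : ‖v‖ < ρ / 2 := by
      rw [pi_norm_lt_iff (by positivity)]
      intro i
      simp only [v, Complex.norm_real, Real.norm_of_nonneg (show 0 ≤ ρ / 4 by positivity)]
      linarith
    have hv0 : v ≠ 0 := fun h => by
      have := congrFun h ⟨0, hn⟩
      simp [v, hρ.ne'] at this
    have hd : HasDerivAt (fun t : ℂ => Y (t • v)) (fderiv ℂ Y 0 v) 0 := by
      have h1 : HasDerivAt (fun t : ℂ => t • v) v 0 := by
        simpa using (hasDerivAt_id (0 : ℂ)).smul_const v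
      have h2 : HasFDerivAt Y (fderiv ℂ Y 0) ((0 : ℂ) • v) := by
        rw [zero_smul]
        exact (hYd.differentiableAt (ball_mem_nhds _ hρ)).hasFDerivAt
      exact h2.comp_hasDerivAt 0 h1
    obtain ⟨j, hj⟩ := Function.ne_iff.mp fun h => hv0 (hYinj v h)
    refine (hcurve hv).lam_neg hk (j := j) ?_
    rw [(hasDerivAt_pi.mp hd j).deriv]
    exact hj
  have hstar : Tendsto (star : (Fin n → ℂ) → Fin n → ℂ) (𝓝 p) (𝓝 (star p)) :=
    continuous_star.continuousAt
  have hVp : Tendsto (fun ζ => V (star ζ)) (𝓝 p) (𝓝 0) := by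
    have : Tendsto V (𝓝 (star p)) (𝓝 (V (star p))) :=
      (hVd.differentiableAt (ball_mem_nhds _ hr)).continuousAt
    rw [hV0] at this
    exact this.comp hstar
  have hsmall : ∀ᶠ v : Fin n → ℂ in 𝓝 0, max 1 (-lam) *
      √((∑ s, ∑ t, conj (v s) * A s t * v t).re / min 1 (-lam)) < 1 / 4 := by
    have : Tendsto (fun v : Fin n → ℂ => max 1 (-lam) *
        √((∑ s, ∑ t, conj (v s) * A s t * v t).re / min 1 (-lam))) (𝓝 0) (𝓝 0) :=
      Continuous.tendsto' (by fun_prop) _ _ (by simp)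
    exact this.eventually_lt_const (by norm_num)
  have hnorm : ∀ᶠ v : Fin n → ℂ in 𝓝 0, ‖v‖ < ρ / 2 :=
    continuous_norm.tendsto' (0 : Fin n → ℂ) 0 norm_zero |>.eventually_lt_const (by positivity)
  have hkp : 0 < ‖k p‖ := norm_pos_iff.mpr (hk.ne_zero p hp)
  -- The normalization of the curve divides `k ζ` by ⟪k p, k ζ⟫ and `k p` by ‖k p‖². The factor 3/2
  -- that allows for this, times 4/3, gives 2.
  have hratio : ∀ᶠ ζ in 𝓝 p, ‖polarKernel k (p, star ζ)‖ < 3 / 2 * ‖k p‖ ^ 2 := by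
    have h1 : ContinuousAt (polarKernel k) (p, star p) :=
      (hk.differentiableOn_polarKernel.differentiableAt
        ((isOpen_polarDomain hΩ).mem_nhds ⟨hp, by simpa using hp⟩)).continuousAt
    have h2 : Tendsto (fun ζ => ‖polarKernel k (p, star ζ)‖) (𝓝 p)
        (𝓝 ‖polarKernel k (p, star p)‖) :=
      (h1.tendsto.comp (tendsto_const_nhds.prodMk_nhds hstar)).norm
    refine h2.eventually_lt_const ?_
    rw [polarKernel_center, Complex.norm_real, Real.norm_of_nonneg (by positivity)]
    nlinarith [pow_pos hkp 2]
  -- The point `ζ` is reached at t = 1 on the curve with direction `v = V (star ζ)`, and `p` at t =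
  -- 0.
  filter_upwards [hVp.eventually hsmall, hVp.eventually hnorm, hstar.eventually hYl, hratio,
    ball_mem_nhds p hr] with ζ h1 h2 h3 h4 h5
  have hne : ∀ z ∈ Ω, inner ℂ (k z) (k p) ≠ 0 →
      ‖inner ℂ (k z) (k ζ)‖ ≤ 2 * ‖inner ℂ (k z) (k p)‖ := by
    intro z hz hzp
    have hpζ : 0 < ‖polarKernel k (p, star ζ)‖ :=
      norm_pos_iff.mpr (hV p (mem_ball_self hr) _ (star_mem_ball_iff.mpr h5)).2.1
    have h6 := (hcurve h2).norm_inner_le hk hΩ hconn hlam h1.le hz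
    simp only [zero_smul, one_smul, h3, hY0, star_star, inner_smul_right, norm_mul, norm_inv,
      polarKernel_center] at h6
    rw [Complex.norm_real, Real.norm_of_nonneg (by positivity)] at h6
    have h7 := h6 (mul_ne_zero (inv_ne_zero (by exact_mod_cast (pow_pos hkp 2).ne')) hzp)
    rw [inv_mul_le_iff₀ hpζ] at h7
    refine h7.trans ((mul_le_mul_of_nonneg_right h4.le (by positivity)).trans_eq ?_)
    field_simp
    ring
  intro z hz
  -- A violation is an open condition on `z`. Near such a point the bound fails everywhere, so ⟪k x,
  -- k p⟫ vanishes there, and then on all of Ω by the identity theorem, contradicting ‖k p‖ ≠ 0.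
  by_contra! hlt
  have hcont : ∀ f : H, ContinuousAt (fun z => ‖inner ℂ (k z) f‖) z := fun f =>
    ((hk.differentiableOn_inner f).differentiableAt (hΩ.mem_nhds hz)).continuousAt.norm
  have hev : ∀ᶠ x in 𝓝 z, inner ℂ (k x) (k p) = 0 := by
    filter_upwards [((hcont (k p)).const_mul 2).eventually_lt (hcont (k ζ)) hlt,
      hΩ.mem_nhds hz] with x hx hxΩ
    by_contra h
    exact absurd (hne x hxΩ h) hx.not_ge
  have := eqOn_zero_of_isPreconnected_of_eventually hΩ hconn (hk.differentiableOn_inner (k p)) hz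
    hev p hp
  exact hk.ne_zero p hp (inner_self_eq_zero.mp this)

end KernelBound

theorem mainTheorem5 {n : ℕ} (hn : 1 ≤ n) (Ω : Set (Fin n → ℂ))
    (hopen : IsOpen Ω) (hconn : IsConnected Ω) (hbdd : Bornology.IsBounded Ω)
    (hcurv : ∃ c : ℝ, ∀ z ∈ Ω, ∀ v : Fin n → ℂ, v ≠ 0 →
      holomorphicSectionalCurvature (bergmanMetric Ω) z v = (c : ℂ)) :
    ∀ p ∈ Ω, ∃ U : Set (Fin n → ℂ), IsOpen U ∧ p ∈ U ∧ U ⊆ Ω ∧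
      ∀ z ∈ Ω, (⨆ ζ ∈ U, ‖bergmanKernel Ω z ζ‖ₑ) ≤ 2 * ‖bergmanKernel Ω z p‖ₑ := by
  intro p hp
  obtain ⟨c, hc⟩ := hcurv
  have : CompleteSpace (bergmanSubmodule Ω) := (isClosed_bergmanSubmodule hopen).completeSpace_coe
  obtain ⟨k, hk, hK⟩ := exists_holomorphicKernel_bergman hopen hbdd
  have hc' : ∀ z ∈ Ω, ∀ v : Fin n → ℂ, v ≠ 0 →
      holomorphicSectionalCurvature (bergmanMetric Ω) z v = 2 * ((c / 2 : ℝ) : ℂ) := by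
    intro z hz v hv
    rw [hc z hz v hv]
    push_cast
    ring
  obtain ⟨U, hU, hUo, hpU⟩ := _root_.eventually_nhds_iff.mp
    ((hk.eventually_norm_inner_le hn hopen hconn.isPreconnected hK hc' hp).and
      (hopen.mem_nhds hp))
  refine ⟨U, hUo, hpU, fun ζ hζ => (hU ζ hζ).2, fun z hz => iSup₂_le fun ζ hζ => ?_⟩
  obtain ⟨h1, h2⟩ := hU ζ hζ
  rw [hK z hz ζ h2, hK z hz p hp, ← ofReal_norm, ← ofReal_norm]
  refine (ENNReal.ofReal_le_ofReal (h1 z hz)).trans_eq ?_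
  rw [ENNReal.ofReal_mul zero_le_two, ENNReal.ofReal_ofNat]
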